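/- Work in $\mathsf{ZFC}$. For a regular cardinal $\theta$, $H(\theta)$ is the collection of sets hereditarily of cardinality less than $\theta$. For a cardinal $\kappa$, a *weak $\kappa$-model* is a (not necessarily transitive) set $M$ of size $\kappa$ with $\kappa+1\subseteq M$ and $\langle M,\in\rangle\models\mathsf{ZFC}^-$ ($\mathsf{ZFC}$ without the power set axiom, with the collection scheme); it is a *$\kappa$-model* if moreover $M^{<\kappa}\subseteq M$. A *filter* on $\kappa$ is a set $F\subseteq\mathcal P(\kappa)$ such that $|\bigcap_{i<n}A_i|=\kappa$ for every finite sequence $\langle A_i\mid i<n\rangle$ of elements of $F$. It *measures* $\mathcal P(\kappa)\cap M$ if $A\in F$ or $\kappa\setminus A\in F$ for every $A\subseteq\kappa$ with $A\in M$. It is *$M$-normal* if it measures $\mathcal P(\kappa)\cap M$ and contains the diagonal intersection $\{\xi<\kappa\mid\xi\in X_\alpha\text{ for all }\alpha<\xi\}$ of every sequence $\langle X_\alpha\mid\alpha<\kappa\rangle\in M$ of elements of $F$. The *ultrapower of $M$ by $F$* consists of the functions $f\colon\kappa\to M$ with $f\in M$, identified when they agree on a set in $F$, with the membership relation: $[f]$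 is a member of $[g]$ iff $\{\alpha<\kappa\mid f(\alpha)\in g(\alpha)\}\in F$. An infinite regular cardinal $\kappa$ is *$\omega$-Ramsey* if for arbitrarily large regular cardinals $\theta$, every $A\subseteq\kappa$ is an element of some weak $\kappa$-model $M\prec H(\theta)$ (closed under finite sequences) for which there are a transitive set $N$ and an elementary embedding $j\colon\langle M,\in\rangle\to\langle N,\in\rangle$ with critical point $\kappa$ such that $M$ and $N$ have the same subsets of $\kappa$. For an uncountable cardinal $\kappa=\kappa^{<\kappa}$ and a regular cardinal $\theta>\kappa$, the *well-founded filter game* of length $\omega$ is played as follows. At each stage $n<\omega$ the *challenger* plays a $\kappa$-model $M_n\prec H(\theta)$ with $M_m\subseteq M_n$ for all $m<n$, such that the sequences $\langle M_m\mid m<n\rangle$ and $\langle F_m\cap M_m\mid m<n\rangle$ are elements of $M_n$; then the *judge* plays a filter $F_n$ on $\kappa$ that measures $\mathcal P(\kappa)\cap M_n$ and satisfies $F_n\supseteq F_m$ for all $m<n$. A player who first breaks these rules loses. Otherwise let $M_\omega=\bigcup_{n<\omega}M_n$ and $F_\omega=\bigcup_{n<\omega}F_n$; the judge wins if $F_\omega$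 is an $M_\omega$-normal filter and the ultrapower of $M_\omega$ by $F_\omega$ is well-founded, and the challenger wins otherwise. The cardinal $\kappa$ has the *well-founded $\omega$-filter property* if for every regular $\theta>\kappa$ the challenger has no winning strategy in this game. **Corollary 5.8.** For every cardinal $\kappa$: $\kappa$ is $\omega$-Ramsey if and only if $\kappa$ is uncountable, $\kappa=\kappa^{<\kappa}$, and $\kappa$ has the well-founded $\omega$-filter property. -/

import Mathlib

universe u

namespace RamseyGames

open FirstOrder Cardinal

noncomputable section

/-! ### First-order set theory -/

/-- The relation symbols of the language of set theory: one binary symbol. -/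
inductive SetRel : ℕ → Type
  | mem : SetRel 2

/-- The first-order language `{∈}` of set theory. -/
def setL : Language := ⟨fun _ => Empty, SetRel⟩

/-- Every set or class of sets is a structure `⟨M, ∈⟩` for the language of set theory, with the
true membership relation. -/
instance memStructure (p : ZFSet.{u} → Prop) : setL.Structure {x // p x} where
  funMap := fun f _ => Empty.elim f
  RelMap := fun r =>
    match r with
    | SetRel.mem => fun v => (v 0 : ZFSet.{u}) ∈ (v 1 : ZFSet.{u})

/-- `M ≺ C`: `M` is a subset of `C`, and the inclusion is an elementary embedding of `⟨M, ∈⟩`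
into `⟨C, ∈⟩`. -/
def IsElemSub (M : ZFSet.{u}) (C : Set ZFSet.{u}) : Prop :=
  ∃ i : M ↪ₑ[setL] C, ∀ x : M, (i x : ZFSet.{u}) = x

/-- `H(θ)`, the class of sets that are hereditarily of cardinality less than `θ` (used for regular
`θ` only, where it agrees with the class of sets whose transitive closure has cardinality less
than `θ`). -/
def H (θ : Cardinal.{u}) : Set ZFSet.{u} :=
  {x | x.Hereditarily (fun y => y.card < θ)}

section ZFCMinus

variable {M : ZFSet.{u}}

/-- `⟨M, ∈⟩ ⊨ z = {x, y}`. -/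
def IsUPair (z x y : M) : Prop :=
  ∀ w : M, w.1 ∈ z.1 ↔ w = x ∨ w = y

/-- `⟨M, ∈⟩ ⊨ p = (x, y)`, for Kuratowski pairs. -/
def IsOPair (p x y : M) : Prop :=
  ∃ s t : M, IsUPair s x x ∧ IsUPair t x y ∧ IsUPair p s t

/-- `⟨M, ∈⟩ ⊨ (x, y) ∈ r`. -/
def RelatedBy (r x y : M) : Prop :=
  ∃ p : M, IsOPair p x y ∧ p.1 ∈ r.1

end ZFCMinus

/-- `⟨M, ∈⟩ ⊨ ZFC⁻`: all axioms of `ZFC` except for the power set axiom, with the collection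
scheme. All quantifiers range over `M`, and the two schemes are for all first-order formulas with
parameters `v` from `M`. -/
structure ModelsZFCMinus (M : ZFSet.{u}) : Prop where
  nonempty : Nonempty M
  extensionality : ∀ x y : M, (∀ z : M, z.1 ∈ x.1 ↔ z.1 ∈ y.1) → x = y
  foundation : ∀ x : M, (∃ y : M, y.1 ∈ x.1) →
    ∃ y : M, y.1 ∈ x.1 ∧ ∀ z : M, z.1 ∈ y.1 → z.1 ∉ x.1
  pairing : ∀ x y : M, ∃ z : M, IsUPair z x y
  union : ∀ x : M, ∃ z : M, ∀ w : M, w.1 ∈ z.1 ↔ ∃ y : M, y.1 ∈ x.1 ∧ w.1 ∈ y.1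
  infinity : ∃ z : M, (∃ e : M, e.1 ∈ z.1 ∧ ∀ w : M, w.1 ∉ e.1) ∧
    ∀ x : M, x.1 ∈ z.1 → ∃ s : M, s.1 ∈ z.1 ∧ ∀ w : M, w.1 ∈ s.1 ↔ w.1 ∈ x.1 ∨ w = x
  separation : ∀ (n : ℕ) (φ : setL.Formula (Fin (n + 1))) (v : Fin n → M) (a : M),
    ∃ b : M, ∀ x : M, x.1 ∈ b.1 ↔ x.1 ∈ a.1 ∧ φ.Realize (Fin.cons x v : Fin (n + 1) → M)
  collection : ∀ (n : ℕ) (φ : setL.Formula (Fin (n + 2))) (v : Fin n → M) (a : M),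
    (∀ x : M, x.1 ∈ a.1 →
      ∃ y : M, φ.Realize (Fin.cons x (Fin.cons y v : Fin (n + 1) → M) : Fin (n + 2) → M)) →
    ∃ b : M, ∀ x : M, x.1 ∈ a.1 → ∃ y : M, y.1 ∈ b.1 ∧
      φ.Realize (Fin.cons x (Fin.cons y v : Fin (n + 1) → M) : Fin (n + 2) → M)
  /-- the axiom of choice, in the form that every set `a` has a (strict) well-order `r` -/
  choice : ∀ a : M, ∃ r : M,
    (∀ x : M, x.1 ∈ a.1 → ¬ RelatedBy r x x) ∧
    (∀ x y z : M, x.1 ∈ a.1 → y.1 ∈ a.1 → z.1 ∈ a.1 →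
      RelatedBy r x y → RelatedBy r y z → RelatedBy r x z) ∧
    ∀ s : M, (∃ x : M, x.1 ∈ s.1) → (∀ x : M, x.1 ∈ s.1 → x.1 ∈ a.1) →
      ∃ m : M, m.1 ∈ s.1 ∧ ∀ x : M, x.1 ∈ s.1 → x ≠ m → RelatedBy r m x

/-! ### Models -/

/-- The cardinal `κ` as a set, that is, as a von Neumann ordinal. -/
def asSet (κ : Cardinal.{u}) : ZFSet.{u} := κ.ord.toZFSet

/-- A weak `κ`-model: a (not necessarily transitive) set `M` of size `κ` with `κ + 1 ⊆ M` and
`⟨M, ∈⟩ ⊨ ZFC⁻`. -/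
structure IsWeakModel (κ : Cardinal.{u}) (M : ZFSet.{u}) : Prop where
  card_eq : M.card = κ
  succ_subset : (κ.ord + 1).toZFSet ⊆ M
  models : ModelsZFCMinus M

/-- `M` is closed under `<α`-sequences, `M^{<α} ⊆ M`: every function from an ordinal below `α`
to `M` is an element of `M`. -/
def ClosedUnderSeq (α : Cardinal.{u}) (M : ZFSet.{u}) : Prop :=
  ∀ β < α.ord, ∀ s : ZFSet.{u}, ZFSet.IsFunc β.toZFSet M s → s ∈ M

/-- A `κ`-model: a weak `κ`-model that is closed under `<κ`-sequences. -/
def IsModel (κ : Cardinal.{u}) (M : ZFSet.{u}) : Prop :=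
  IsWeakModel κ M ∧ ClosedUnderSeq κ M

/-! ### Ramsey-like cardinals -/

/-- `j : M → N` is `κ`-powerset preserving: it has critical point `κ`, and `M` and `N` have the
same subsets of `κ`. -/
structure PowersetPreserving (κ : Cardinal.{u}) {M N : ZFSet.{u}} (j : M ↪ₑ[setL] N) : Prop where
  fix_below : ∀ x : M, x.1 ∈ asSet κ → (j x : ZFSet.{u}) = x
  moves : ∀ x : M, x.1 = asSet κ → (j x : ZFSet.{u}) ≠ x
  same_subsets : ∀ A : ZFSet.{u}, A ⊆ asSet κ → (A ∈ M ↔ A ∈ N)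

/-- `κ` is `α`-Ramsey: `α ≤ κ` are regular cardinals and, for arbitrarily large regular `θ`, every
`A ⊆ κ` is an element of a weak `κ`-model `M ≺ H(θ)` that is closed under `<α`-sequences and has a
`κ`-powerset preserving elementary embedding `j : M → N` into a transitive set `N`. -/
def IsRamsey (α κ : Cardinal.{u}) : Prop :=
  α.IsRegular ∧ κ.IsRegular ∧ α ≤ κ ∧
  ∀ μ : Cardinal.{u}, ∃ θ : Cardinal.{u}, μ ≤ θ ∧ θ.IsRegular ∧
    ∀ A : ZFSet.{u}, A ⊆ asSet κ →
      ∃ M : ZFSet.{u}, A ∈ M ∧ IsWeakModel κ M ∧ IsElemSub M (H θ) ∧ ClosedUnderSeq α M ∧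
        ∃ N : ZFSet.{u}, N.IsTransitive ∧ ∃ j : M ↪ₑ[setL] N, PowersetPreserving κ j

/-! ### Filters and ultrapowers -/

/-- A filter on `κ`: a family `F` of subsets of `κ` such that the intersection of any finite
sequence of elements of `F` (which is `κ` for the empty sequence) has size `κ`. -/
structure IsFilter (κ : Cardinal.{u}) (F : ZFSet.{u}) : Prop where
  subset : ∀ A ∈ F, A ⊆ asSet κ
  card_inter : ∀ (n : ℕ) (A : Fin n → ZFSet.{u}), (∀ i, A i ∈ F) →
    ((asSet κ).sep (fun ξ => ∀ i, ξ ∈ A i)).card = κ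

/-- `F` measures `P(κ) ∩ M`. -/
def Measures (κ : Cardinal.{u}) (F M : ZFSet.{u}) : Prop :=
  ∀ A ∈ M, A ⊆ asSet κ → A ∈ F ∨ asSet κ \ A ∈ F

/-- The diagonal intersection `{ξ < κ : ξ ∈ X_α for all α < ξ}` of a sequence
`X = ⟨X_α : α < κ⟩`. -/
def diagInter (κ : Cardinal.{u}) (X : ZFSet.{u}) : ZFSet.{u} :=
  (asSet κ).sep (fun ξ => ∀ α ∈ ξ, ∀ A, ZFSet.pair α A ∈ X → ξ ∈ A)

/-- `F` is an `M`-normal filter on `κ`: a filter that measures `P(κ) ∩ M` and contains the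
diagonal intersection of every `κ`-sequence of elements of `F` that is an element of `M`. -/
structure IsNormalFor (κ : Cardinal.{u}) (M F : ZFSet.{u}) : Prop where
  filter : IsFilter κ F
  measures : Measures κ F M
  diag : ∀ X ∈ M, ZFSet.IsFunc (asSet κ) F X → diagInter κ X ∈ F

/-- The functions `f : κ → M` with `f ∈ M`. -/
def InnerFun (κ : Cardinal.{u}) (M : ZFSet.{u}) : Type (u + 1) :=
  {f : ZFSet.{u} // f ∈ M ∧ ZFSet.IsFunc (asSet κ) M f}

/-- `{α < κ : f(α) = g(α)}`. -/
def eqSet (κ : Cardinal.{u}) {M : ZFSet.{u}} (f g : InnerFun κ M) : ZFSet.{u} :=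
  (asSet κ).sep (fun α => ∃ x y, ZFSet.pair α x ∈ f.1 ∧ ZFSet.pair α y ∈ g.1 ∧ x = y)

/-- `{α < κ : f(α) ∈ g(α)}`. -/
def memSet (κ : Cardinal.{u}) {M : ZFSet.{u}} (f g : InnerFun κ M) : ZFSet.{u} :=
  (asSet κ).sep (fun α => ∃ x y, ZFSet.pair α x ∈ f.1 ∧ ZFSet.pair α y ∈ g.1 ∧ x ∈ y)

/-- The ultrapower of `M` by `F`: the functions `f : κ → M` in `M` modulo agreement on a set
in `F`. -/
def Ultrapower (κ : Cardinal.{u}) (M F : ZFSet.{u}) : Type (u + 1) :=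
  Quot (fun f g : InnerFun κ M => eqSet κ f g ∈ F)

/-- The membership relation of the ultrapower of `M` by `F`. -/
def Ultrapower.Mem {κ : Cardinal.{u}} {M F : ZFSet.{u}} (a b : Ultrapower κ M F) : Prop :=
  ∃ f g : InnerFun κ M, Quot.mk _ f = a ∧ Quot.mk _ g = b ∧ memSet κ f g ∈ F

/-- The ultrapower of `M` by `F` is well-founded. -/
def WellFoundedUltrapower (κ : Cardinal.{u}) (M F : ZFSet.{u}) : Prop :=
  WellFounded (Ultrapower.Mem : Ultrapower κ M F → Ultrapower κ M F → Prop)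

/-! ### The well-founded filter games -/

/-- The sequence `⟨x_β : β < α⟩` as a set. -/
def seqSet (α : Ordinal.{u}) (x : Ordinal.{u} → ZFSet.{u}) : ZFSet.{u} :=
  ZFSet.range (fun β : Set.Iio α => ZFSet.pair (β : Ordinal.{u}).toZFSet (x β))

/-- The union of the `x_β` for `β < α`. -/
def unionBelow (α : Ordinal.{u}) (x : Ordinal.{u} → ZFSet.{u}) : ZFSet.{u} :=
  ZFSet.iUnion (fun β : Set.Iio α => x β)

/-- The challenger's move `M_α` obeys the rules, where the judge has played `F_β` for `β < α`. -/
structure ChallengerLegal (κ θ : Cardinal.{u}) (M F : Ordinal.{u} → ZFSet.{u})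
    (α : Ordinal.{u}) : Prop where
  model : IsModel κ (M α)
  elem : IsElemSub (M α) (H θ)
  increasing : ∀ β < α, M β ⊆ M α
  models_mem : seqSet α M ∈ M α
  filters_mem : seqSet α (fun β => F β ∩ M β) ∈ M α

/-- The judge's move `F_α`, in response to `M_α`, obeys the rules. -/
structure JudgeLegal (κ : Cardinal.{u}) (M F : Ordinal.{u} → ZFSet.{u})
    (α : Ordinal.{u}) : Prop where
  filter : IsFilter κ (F α)
  measures : Measures κ (F α) (M α)
  increasing : ∀ β < α, F β ⊆ F α

/-- The winning condition for the judge in a complete run of the well-founded filter game of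
length `γ`: the union of her filters is a normal filter for the union of the challenger's models,
and the corresponding ultrapower is well-founded. -/
def JudgeWins (κ : Cardinal.{u}) (γ : Ordinal.{u}) (M F : Ordinal.{u} → ZFSet.{u}) : Prop :=
  IsNormalFor κ (unionBelow γ M) (unionBelow γ F) ∧
    WellFoundedUltrapower κ (unionBelow γ M) (unionBelow γ F)

/-- A strategy for the challenger: it gives his move at stage `α` in terms of the moves made by the
judge at the stages before `α` (his own earlier moves are determined by these). -/
def ChallengerStrategy : Type (u + 1) :=
  (α : Ordinal.{u}) → (Set.Iio α → ZFSet.{u}) → ZFSet.{u}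

/-- The models played according to the strategy `σ` against the judge's moves `F`. -/
def ChallengerStrategy.play (σ : ChallengerStrategy.{u}) (F : Ordinal.{u} → ZFSet.{u}) :
    Ordinal.{u} → ZFSet.{u} :=
  fun α => σ α (fun β => F β)

/-- `σ` is a winning strategy for the challenger in the well-founded filter game of length `γ` at
`κ` and `θ`: as long as the judge obeys the rules, so does `σ`, and if the judge obeys the rules
throughout, then the winning condition for the judge fails. (A player who is the first to break the
rules loses.) -/
def ChallengerStrategy.IsWinning (σ : ChallengerStrategy.{u}) (κ θ : Cardinal.{u})
    (γ : Ordinal.{u}) : Prop :=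
  ∀ F : Ordinal.{u} → ZFSet.{u},
    (∀ α < γ, (∀ β < α, JudgeLegal κ (σ.play F) F β) →
      ChallengerLegal κ θ (σ.play F) F α) ∧
    ((∀ α < γ, JudgeLegal κ (σ.play F) F α) → ¬ JudgeWins κ γ (σ.play F) F)

/-- The well-founded `γ`-filter property of `κ` (for uncountable `κ = κ^{<κ}` and `γ ≤ κ⁺`): for no
regular `θ > κ` does the challenger have a winning strategy in the well-founded filter game of
length `γ`. -/
def HasWellFoundedFilterProperty (κ : Cardinal.{u}) (γ : Ordinal.{u}) : Prop :=
  ∀ θ : Cardinal.{u}, θ.IsRegular → κ < θ →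
    ¬ ∃ σ : ChallengerStrategy.{u}, σ.IsWinning κ θ γ

end

end RamseyGames

namespace RamseyGames

open FirstOrder Cardinal

noncomputable section

/-! ### Definable predicates -/

/-! From the filter property to embeddings. Given `A ⊆ κ` and `μ`, let `θ` be a successor cardinal
above `μ` and `κ`, and let the challenger play arbitrary `κ`-models `M_n ≺ H(θ)` that contain `A`
and the sequences of earlier moves (`pickSeq`; `exists_isModel` provides them). This strategy does
not win, so some run is won by the judge. The union `M_ω` of the elementary chain is elementary in
`H(θ)`, and Łoś's theorem (`UltraSetup.los`) turns the collapsed ultrapower of `M_ω` by `F_ω` into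
an elementary embedding into a transitive set. Normality, in the form that regressive functions are
constant on a large set (`UltraSetup.exists_const_of_regressive`), shows that ordinals below `κ` are
fixed and that every subset of `κ` in `M_ω` is in the target; the identity function shows that `κ`
is moved. Conversely, a subset of `κ` in the target that is represented by `f ∈ M_n` is `{α | {ξ | α
∈ f(ξ)} ∈ F_n ∩ M_n}`, and it belongs to `M_{n+1}` because the rules put `F_n ∩ M_n` there
(`exists_embedding_of_judgeWins`).

From embeddings to the filter property. Let `j : M → N` be powerset preserving, with `M ≺ H(θ')` and
`θ'` large. Then `κ ∈ j(κ)`, and reflection yields that `κ` is uncountable and a strong limit,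
whence `κ^{<κ} = κ`. Suppose that `σ` wins for the challenger at `θ`. The strategy need not be an
element of `M`, so it is replaced by something that elementarity can reflect. Its values on finite
sequences of families of subsets of `κ` form a set `code`, and `IsCode` isolates a property of this
set that is first-order over `H(θ')`, with `κ` as its only parameter, and that mentions neither `θ`
nor `κ`-models: there are no `U`, `R`, `Z` such that `U` is a base of a filter that is normal and
has well-founded membership for the functions in `Z`, and `R` is a set of positions without dead
ends, along which the strategy plays subsets of `Z` and is answered inside `U`. Such a triple would
yield, by successive choices, a run that `σ` loses (`isCode_code`). By elementarity some `s ∈ M` has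
the same property.

This is contradicted by `EmbeddingSetup.not_isCode`, with `U = {A ∈ M | κ ∈ j(A)}` and `Z = M`. A
move `m ∈ M` of the strategy has size at most `κ`, so `m ⊆ M`, and `U ∩ m ∈ M` because `M` and `N`
have the same subsets of `κ`. Hence the answer and the next position are again in `M`. Neither `U`
nor the whole run need be in `M`, but both are in `H(θ')`, and that is where the property of `s` is
evaluated. -/

/-- A class of sets that contains the elements of its elements. -/
def TransClass (C : Set ZFSet.{u}) : Prop := ∀ x ∈ C, ∀ y ∈ x, y ∈ C

/-- The stream with first term `x` and tail `v`. -/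
def scons {α : Type*} (x : α) (v : ℕ → α) : ℕ → α
  | 0 => x
  | i + 1 => v i

infixr:67 " .: " => scons

/-- A single formula defines the predicate `P` over all transitive classes in `𝒞`. -/
def Dfn (𝒞 : Set (Set ZFSet.{u})) (P : Set ZFSet.{u} → (ℕ → ZFSet.{u}) → Prop) : Prop :=
  ∃ φ : setL.Formula ℕ, ∀ C ∈ 𝒞, TransClass C → ∀ v : ℕ → C,
    φ.Realize v ↔ P C (fun i => (v i : ZFSet.{u}))

/-- `φ` holds of `w` in `⟨C, ∈⟩`. -/
def Sat {β : Type} (C : Set ZFSet.{u}) (φ : setL.Formula β) (w : β → ZFSet.{u}) : Prop :=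
  ∃ h : ∀ i, w i ∈ C, φ.Realize (fun i => (⟨w i, h i⟩ : C))

/-- The formula `x ∈ y`. -/
def memFormula {β : Type} (i j : β) : setL.Formula β :=
  (show setL.Relations 2 from SetRel.mem).formula₂ (Language.Term.var i) (Language.Term.var j)

theorem realize_memFormula {p : ZFSet.{u} → Prop} {β : Type} (i j : β) (v : β → {x // p x}) :
    (memFormula i j).Realize v ↔ (v i : ZFSet.{u}) ∈ (v j : ZFSet.{u}) := by
  unfold memFormula
  rw [Language.Formula.realize_rel₂]
  rfl

namespace Dfn

variable {𝒞 : Set (Set ZFSet.{u})}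

/-- The equivalence may use that the class is transitive and contains the parameters. This is what
makes predicates with bounded quantifiers definable. -/
theorem congr {P Q : Set ZFSet.{u} → (ℕ → ZFSet.{u}) → Prop} (hP : Dfn 𝒞 P)
    (h : ∀ C ∈ 𝒞, TransClass C → ∀ v : ℕ → ZFSet.{u}, (∀ i, v i ∈ C) → (Q C v ↔ P C v)) :
    Dfn 𝒞 Q := by
  obtain ⟨φ, hφ⟩ := hP
  exact ⟨φ, fun C hC ht v => (hφ C hC ht v).trans (h C hC ht _ fun i => (v i).2).symm⟩

theorem mem (i j : ℕ) : Dfn 𝒞 (fun _ v => v i ∈ v j) :=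
  ⟨memFormula i j, fun _ _ _ v => realize_memFormula i j v⟩

theorem eq (i j : ℕ) : Dfn 𝒞 (fun _ v => v i = v j) :=
  ⟨Language.Term.equal (Language.Term.var i) (Language.Term.var j), fun C _ _ v => by
    rw [Language.Formula.realize_equal]
    exact Subtype.ext_iff⟩

theorem const (p : Prop) : Dfn 𝒞 (fun _ _ => p) := by
  by_cases hp : p
  · exact ⟨⊤, fun C _ _ v => by simp [hp, Language.Formula.Realize]⟩
  · exact ⟨⊥, fun C _ _ v => by simp [hp, Language.Formula.Realize]⟩

theorem not {P : Set ZFSet.{u} → (ℕ → ZFSet.{u}) → Prop} (hP : Dfn 𝒞 P) :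
    Dfn 𝒞 (fun C v => ¬ P C v) := by
  obtain ⟨φ, hφ⟩ := hP
  exact ⟨φ.not, fun C hC ht v => by rw [Language.Formula.realize_not, hφ C hC ht]⟩

theorem and {P Q : Set ZFSet.{u} → (ℕ → ZFSet.{u}) → Prop} (hP : Dfn 𝒞 P) (hQ : Dfn 𝒞 Q) :
    Dfn 𝒞 (fun C v => P C v ∧ Q C v) := by
  obtain ⟨φ, hφ⟩ := hP
  obtain ⟨ψ, hψ⟩ := hQ
  exact ⟨φ ⊓ ψ, fun C hC ht v => by
    rw [Language.Formula.realize_inf, hφ C hC ht, hψ C hC ht]⟩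

theorem imp {P Q : Set ZFSet.{u} → (ℕ → ZFSet.{u}) → Prop} (hP : Dfn 𝒞 P) (hQ : Dfn 𝒞 Q) :
    Dfn 𝒞 (fun C v => P C v → Q C v) := by
  refine (hP.and hQ.not).not.congr fun C _ _ v _ => ?_
  tauto

theorem or {P Q : Set ZFSet.{u} → (ℕ → ZFSet.{u}) → Prop} (hP : Dfn 𝒞 P) (hQ : Dfn 𝒞 Q) :
    Dfn 𝒞 (fun C v => P C v ∨ Q C v) := by
  refine (hP.not.and hQ.not).not.congr fun C _ _ v _ => ?_
  tauto

theorem iff {P Q : Set ZFSet.{u} → (ℕ → ZFSet.{u}) → Prop} (hP : Dfn 𝒞 P) (hQ : Dfn 𝒞 Q) :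
    Dfn 𝒞 (fun C v => P C v ↔ Q C v) := by
  refine ((hP.imp hQ).and (hQ.imp hP)).congr fun C _ _ v _ => ?_
  tauto

/-- Here `f` sorts the variables of the matrix into parameters and members of the quantified tuple,
and `g` and `e` are its sections. -/
theorem exFin {β : Type} [Finite β] {P : Set ZFSet.{u} → (β → ZFSet.{u}) → (ℕ → ZFSet.{u}) → Prop}
    (f : ℕ → ℕ ⊕ β) (g : ℕ → ℕ) (e : β → ℕ) (hg : ∀ i, f (g i) = Sum.inl i)
    (he : ∀ b, f (e b) = Sum.inr b)
    (hP : Dfn 𝒞 (fun C v => P C (fun b => v (e b)) (fun i => v (g i)))) :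
    Dfn 𝒞 (fun C v => ∃ x : β → ZFSet.{u}, (∀ b, x b ∈ C) ∧ P C x v) := by
  obtain ⟨φ, hφ⟩ := hP
  refine ⟨Language.Formula.iExs β (φ.relabel f), fun C hC ht v => ?_⟩
  rw [Language.Formula.realize_iExs]
  have key : ∀ x : β → C, (φ.relabel f).Realize (Sum.elim v x) ↔
      P C (fun b => (x b : ZFSet.{u})) (fun i => (v i : ZFSet.{u})) := by
    intro x
    rw [Language.Formula.realize_relabel, hφ C hC ht]
    simp [hg, he]
  constructor
  · rintro ⟨x, hx⟩
    exact ⟨fun b => x b, fun b => (x b).2, (key x).1 hx⟩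
  · rintro ⟨x, hx, hP⟩
    exact ⟨fun b => ⟨x b, hx b⟩, (key _).2 hP⟩

theorem ex {P : Set ZFSet.{u} → ZFSet.{u} → (ℕ → ZFSet.{u}) → Prop}
    (hP : Dfn 𝒞 (fun C v => P C (v 0) (fun i => v (i + 1)))) :
    Dfn 𝒞 (fun C v => ∃ x ∈ C, P C x v) := by
  refine (exFin (β := Unit) (P := fun C x v => P C (x ()) v)
    (fun i => Nat.casesOn i (Sum.inr ()) Sum.inl) (fun i => i + 1) (fun _ => 0)
    (fun _ => rfl) (fun _ => rfl) hP).congr fun C _ _ v _ => ?_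
  constructor
  · rintro ⟨x, hx, h⟩
    exact ⟨fun _ => x, fun _ => hx, h⟩
  · rintro ⟨x, hx, h⟩
    exact ⟨x (), hx _, h⟩

theorem all {P : Set ZFSet.{u} → ZFSet.{u} → (ℕ → ZFSet.{u}) → Prop}
    (hP : Dfn 𝒞 (fun C v => P C (v 0) (fun i => v (i + 1)))) :
    Dfn 𝒞 (fun C v => ∀ x ∈ C, P C x v) := by
  refine (ex (P := fun C x v => ¬ P C x v) hP.not).not.congr fun C _ _ v _ => ?_
  push Not
  rfl

theorem bex {P : Set ZFSet.{u} → ZFSet.{u} → (ℕ → ZFSet.{u}) → Prop} {i : ℕ}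
    (hP : Dfn 𝒞 (fun C v => P C (v 0) (fun i => v (i + 1)))) :
    Dfn 𝒞 (fun C v => ∃ x ∈ v i, P C x v) := by
  refine (ex (P := fun C x v => x ∈ v i ∧ P C x v) ((mem _ _).and hP)).congr
    fun C _ ht v hv => ?_
  exact ⟨fun ⟨x, hx, h⟩ => ⟨x, ht _ (hv i) _ hx, hx, h⟩, fun ⟨x, _, hx, h⟩ => ⟨x, hx, h⟩⟩

theorem ball {P : Set ZFSet.{u} → ZFSet.{u} → (ℕ → ZFSet.{u}) → Prop} {i : ℕ}
    (hP : Dfn 𝒞 (fun C v => P C (v 0) (fun i => v (i + 1)))) :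
    Dfn 𝒞 (fun C v => ∀ x ∈ v i, P C x v) := by
  refine (bex (i := i) (P := fun C x v => ¬ P C x v) hP.not).not.congr fun C _ _ v _ => ?_
  push Not
  rfl

theorem subset (i j : ℕ) : Dfn 𝒞 (fun _ v => v i ⊆ v j) :=
  (ball (P := fun _ x v => x ∈ v j) (mem _ _)).congr fun _ _ _ _ _ => Iff.rfl

theorem upair (i j k : ℕ) : Dfn 𝒞 (fun _ v => v i = {v j, v k}) := by
  refine (((mem j i).and (mem k i)).and (ball (i := i) (P := fun _ x v => x = v j ∨ x = v k)
    ((eq _ _).or (eq _ _)))).congr fun C _ _ v _ => ?_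
  constructor
  · intro h
    simp [h]
  · rintro ⟨⟨h1, h2⟩, h3⟩
    ext x
    rw [ZFSet.mem_pair]
    exact ⟨h3 x, by rintro (rfl | rfl) <;> assumption⟩

theorem eq_pair (i j k : ℕ) : Dfn 𝒞 (fun _ v => v i = ZFSet.pair (v j) (v k)) := by
  refine (bex (i := i) (P := fun _ s v => ∃ t ∈ v i, s = {v j, v j} ∧ t = {v j, v k} ∧ v i = {s, t})
    (bex (P := fun _ t v => v 0 = {v (j+1), v (j+1)} ∧ t = {v (j+1), v (k+1)} ∧ v (i+1) = {v 0, t})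
    ((upair _ _ _).and ((upair _ _ _).and (upair _ _ _))))).congr fun C _ _ v _ => ?_
  constructor
  · intro h
    rw [h]
    exact ⟨{v j, v j}, by simp [ZFSet.pair], {v j, v k}, by simp [ZFSet.pair], rfl, rfl,
      by simp [ZFSet.pair]⟩
  · rintro ⟨s, _, t, _, rfl, rfl, h⟩
    rw [h]
    simp [ZFSet.pair]

theorem pair_mem (i j k : ℕ) : Dfn 𝒞 (fun _ v => ZFSet.pair (v i) (v j) ∈ v k) := by
  refine (bex (i := k) (P := fun _ p v => p = ZFSet.pair (v i) (v j)) (eq_pair _ _ _)).congr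
    fun C _ _ v _ => ?_
  simp

/-- The quantifier has no visible bound, but transitivity puts both coordinates of a pair in `v j`
into the class. -/
theorem exPair {P : Set ZFSet.{u} → ZFSet.{u} → (ℕ → ZFSet.{u}) → Prop} {i j : ℕ}
    (hP : Dfn 𝒞 (fun C v => P C (v 0) (fun i => v (i + 1)))) :
    Dfn 𝒞 (fun C v => ∃ x, ZFSet.pair (v i) x ∈ v j ∧ P C x v) := by
  refine (ex (P := fun C x v => ZFSet.pair (v i) x ∈ v j ∧ P C x v)
    ((pair_mem _ _ _).and hP)).congr fun C _ ht v hv => ?_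
  constructor
  · rintro ⟨x, hx, h⟩
    exact ⟨x, ht _ (ht _ (ht _ (hv j) _ hx) {v i, x} (by simp [ZFSet.pair])) _ (by simp), hx, h⟩
  · rintro ⟨x, _, hx, h⟩
    exact ⟨x, hx, h⟩

theorem allPair {P : Set ZFSet.{u} → ZFSet.{u} → (ℕ → ZFSet.{u}) → Prop} {i j : ℕ}
    (hP : Dfn 𝒞 (fun C v => P C (v 0) (fun i => v (i + 1)))) :
    Dfn 𝒞 (fun C v => ∀ x, ZFSet.pair (v i) x ∈ v j → P C x v) := by
  refine (exPair (i := i) (j := j) (P := fun C x v => ¬ P C x v) hP.not).not.congr fun C _ _ v _ => ?_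
  push Not
  rfl

theorem sat {β : Type} (φ : setL.Formula β) (r : β → ℕ) :
    Dfn 𝒞 (fun C v => Sat C φ (fun b => v (r b))) := by
  refine ⟨φ.relabel r, fun C _ _ v => ?_⟩
  rw [Language.Formula.realize_relabel]
  exact ⟨fun h => ⟨fun i => (v (r i)).2, h⟩, fun ⟨_, h⟩ => h⟩

theorem finAnd {k : ℕ} {P : Fin k → Set ZFSet.{u} → (ℕ → ZFSet.{u}) → Prop}
    (hP : ∀ b, Dfn 𝒞 (P b)) : Dfn 𝒞 (fun C v => ∀ b, P b C v) := by
  choose φ hφ using hP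
  refine ⟨Language.Formula.iInf φ, fun C hC ht v => ?_⟩
  rw [Language.Formula.realize_iInf]
  exact forall_congr' fun b => hφ b C hC ht v

end Dfn

/-! ### Elementary substructures -/

theorem IsElemSub.subset {M : ZFSet.{u}} {C : Set ZFSet.{u}} (h : IsElemSub M C) {x : ZFSet.{u}}
    (hx : x ∈ M) : x ∈ C := by
  obtain ⟨i, hi⟩ := h
  have := (i ⟨x, hx⟩).2
  rwa [hi] at this

theorem IsElemSub.realize {M : ZFSet.{u}} {C : Set ZFSet.{u}} (h : IsElemSub M C) {β : Type}
    (φ : setL.Formula β) (v : β → M) :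
    φ.Realize v ↔ Sat C φ (fun i => (v i : ZFSet.{u})) := by
  have h' := h
  obtain ⟨i, hi⟩ := h
  rw [← i.map_formula φ v]
  have : (i ∘ v) = fun b => (⟨v b, h'.subset (v b).2⟩ : C) := by
    funext b
    exact Subtype.ext (hi _)
  rw [this]
  exact ⟨fun h => ⟨_, h⟩, fun ⟨_, h⟩ => h⟩

/-- The Tarski–Vaught property, for a definable predicate with parameters from `M`. -/
theorem IsElemSub.exists_mem {M : ZFSet.{u}} {C : Set ZFSet.{u}} (h : IsElemSub M C)
    (ht : TransClass C) {P : Set ZFSet.{u} → (ℕ → ZFSet.{u}) → Prop} (hP : Dfn {C} P)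
    {v : ℕ → ZFSet.{u}} (hv : ∀ i, v i ∈ M) (hx : ∃ x ∈ C, P C (x .: v)) :
    ∃ x ∈ M, P C (x .: v) := by
  obtain ⟨φ, hφ⟩ := hP
  -- Variable 0 is the one to be quantified; variable `i + 1` is the parameter `v i`.
  let f : ℕ → ℕ ⊕ Unit := fun i => Nat.casesOn i (Sum.inr ()) Sum.inl
  have h3 : ∀ {D : Type (u + 1)} [setL.Structure D] (w : ℕ → D),
      (Language.Formula.iExs Unit (φ.relabel f)).Realize w ↔
        ∃ x : D, φ.Realize (x .: w) := by
    intro D _ w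
    rw [Language.Formula.realize_iExs]
    have key : ∀ x : Unit → D, (φ.relabel f).Realize (Sum.elim w x) ↔
        φ.Realize (x () .: w) := by
      intro x
      rw [Language.Formula.realize_relabel]
      have : (Sum.elim w x ∘ f) = (x () .: w) := by
        funext i
        cases i <;> rfl
      rw [this]
    exact ⟨fun ⟨x, hx⟩ => ⟨x (), (key x).1 hx⟩, fun ⟨x, hx⟩ => ⟨fun _ => x, (key _).2 hx⟩⟩
  have h4 : (Language.Formula.iExs Unit (φ.relabel f)).Realize
      (fun i => (⟨v i, h.subset (hv i)⟩ : C)) := by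
    rw [h3]
    obtain ⟨x, hx, hPx⟩ := hx
    refine ⟨⟨x, hx⟩, ?_⟩
    rw [hφ C rfl ht]
    convert hPx using 1
    funext i
    cases i <;> rfl
  have h5 : (Language.Formula.iExs Unit (φ.relabel f)).Realize (fun i => (⟨v i, hv i⟩ : M)) := by
    rw [h.realize]
    exact ⟨_, h4⟩
  rw [h3] at h5
  obtain ⟨x, hx⟩ := h5
  refine ⟨x, x.2, ?_⟩
  obtain ⟨_, hx⟩ := (h.realize _ _).1 hx
  rw [hφ C rfl ht] at hx
  convert hx using 1
  funext i
  cases i <;> rfl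

/-- An element of `C` that is definable from parameters in `M ≺ C` belongs to `M`. -/
theorem IsElemSub.mem_of_unique {M : ZFSet.{u}} {C : Set ZFSet.{u}} (h : IsElemSub M C)
    (ht : TransClass C) {P : Set ZFSet.{u} → (ℕ → ZFSet.{u}) → Prop} (hP : Dfn {C} P)
    {v : ℕ → ZFSet.{u}} (hv : ∀ i, v i ∈ M) {x : ZFSet.{u}} (hxC : x ∈ C) (hx : P C (x .: v))
    (hu : ∀ y ∈ C, P C (y .: v) → y = x) : x ∈ M := by
  obtain ⟨y, hy, hPy⟩ := h.exists_mem ht hP hv ⟨x, hxC, hx⟩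
  rwa [← hu y (h.subset hy) hPy]

/-- A definable predicate is preserved by an elementary embedding of `M ≺ C`. -/
theorem IsElemSub.transfer {M N : ZFSet.{u}} {C : Set ZFSet.{u}} (h : IsElemSub M C)
    (ht : TransClass C) (hN : N.IsTransitive) (j : M ↪ₑ[setL] N)
    {P : Set ZFSet.{u} → (ℕ → ZFSet.{u}) → Prop} (hP : Dfn Set.univ P) (v : ℕ → M) :
    P C (fun i => (v i : ZFSet.{u})) ↔ P {x | x ∈ N} (fun i => (j (v i) : ZFSet.{u})) := by
  obtain ⟨φ, hφ⟩ := hP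
  have h1 := hφ C trivial ht (fun i => ⟨v i, h.subset (v i).2⟩)
  have h2 := hφ {x | x ∈ N} trivial (fun x hx y hy => hN x hx hy) (fun i => j (v i))
  rw [← h1, ← h2]
  have h3 := (h.realize φ v)
  have h4 : φ.Realize (fun i => j (v i)) ↔ φ.Realize v := j.map_formula φ v
  refine Iff.trans ?_ (h3.symm.trans h4.symm)
  exact ⟨fun h => ⟨_, h⟩, fun ⟨_, h⟩ => h⟩

/-- The Tarski–Vaught criterion. -/
theorem isElemSub_of_forall {M : ZFSet.{u}} {C : Set ZFSet.{u}} (hMC : ∀ x ∈ M, x ∈ C)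
    (h : ∀ (n : ℕ) (φ : setL.Formula (Fin (n + 1))) (v : Fin n → ZFSet.{u}) (x : ZFSet.{u}),
      (∀ i, v i ∈ M) → Sat C φ (Fin.snoc v x : Fin (n + 1) → ZFSet.{u}) →
        ∃ y ∈ M, Sat C φ (Fin.snoc v y : Fin (n + 1) → ZFSet.{u})) : IsElemSub M C := by
  let i : M ↪[setL] C :=
    { toFun := fun x => ⟨x, hMC x x.2⟩
      inj' := fun x y hxy => Subtype.ext (congrArg (fun z : C => (z : ZFSet.{u})) hxy)
      map_fun' := fun f => Empty.elim f
      map_rel' := fun r x => by cases r; rfl }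
  have key : ∀ (n : ℕ) (φ : setL.BoundedFormula Empty (n + 1)) (w : Fin n → C) (a : C),
      φ.Realize default (Fin.snoc w a : Fin (n + 1) → C) ↔
      Sat C (φ.toFormula.relabel (Sum.elim Empty.elim id))
        (Fin.snoc (fun k => (w k : ZFSet.{u})) (a : ZFSet.{u}) : Fin (n + 1) → ZFSet.{u}) := by
    intro n φ w a
    have hs : ∀ k, (Fin.snoc (fun k => (w k : ZFSet.{u})) (a : ZFSet.{u}) :
        Fin (n + 1) → ZFSet.{u}) k = ((Fin.snoc w a : Fin (n + 1) → C) k : ZFSet.{u}) := by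
      intro k
      refine Fin.lastCases ?_ (fun k => ?_) k <;> simp
    unfold Sat
    simp only [hs]
    rw [exists_prop_of_true (fun k => ((Fin.snoc w a : Fin (n + 1) → C) k).2)]
    rw [Language.Formula.realize_relabel, Language.BoundedFormula.realize_toFormula]
    exact iff_of_eq (congrArg₂ _ (Subsingleton.elim _ _) rfl)
  refine ⟨i.toElementaryEmbedding fun n φ x a hφ => ?_, fun _ => rfl⟩
  rw [key] at hφ
  obtain ⟨y, hy, hs⟩ := h n _ _ _ (fun k => (x k).2) hφ
  refine ⟨⟨y, hy⟩, ?_⟩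
  rw [key]
  exact hs

/-! ### Cardinalities of sets and the classes `H(θ)` -/

theorem card_le_mk {x : ZFSet.{u}} {α : Type u} (f : α → ZFSet.{u})
    (h : ∀ y ∈ x, ∃ a, f a = y) : x.card ≤ #α := by
  choose g hg using fun y : x => h y y.2
  refine Cardinal.mk_le_of_injective (f := fun y : Shrink x => g ((equivShrink x).symm y)) ?_
  intro y z hyz
  have h1 := hg ((equivShrink x).symm y)
  simp only at hyz
  rw [hyz, hg] at h1
  exact (equivShrink x).symm.injective (Subtype.ext h1.symm)

theorem card_le_card {x y : ZFSet.{u}} (f : ZFSet.{u} → ZFSet.{u})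
    (h : ∀ z ∈ x, ∃ a ∈ y, f a = z) : x.card ≤ y.card :=
  card_le_mk (α := Shrink y) (fun a => f ((equivShrink y).symm a)) fun z hz => by
    obtain ⟨a, ha, rfl⟩ := h z hz
    exact ⟨equivShrink y ⟨a, ha⟩, by simp⟩

theorem card_le_mul {x y z : ZFSet.{u}} (f : ZFSet.{u} → ZFSet.{u} → ZFSet.{u})
    (h : ∀ w ∈ x, ∃ a ∈ y, ∃ b ∈ z, f a b = w) : x.card ≤ y.card * z.card :=
  (card_le_mk (α := Shrink y × Shrink z)
    (fun a => f ((equivShrink y).symm a.1) ((equivShrink z).symm a.2)) fun w hw => by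
    obtain ⟨a, ha, b, hb, rfl⟩ := h w hw
    exact ⟨(equivShrink y ⟨a, ha⟩, equivShrink z ⟨b, hb⟩), by simp⟩).trans_eq
    (by rw [Cardinal.mk_prod, Cardinal.lift_id, Cardinal.lift_id]; rfl)

theorem card_pair_lt_aleph0 (x y : ZFSet.{u}) : ({x, y} : ZFSet.{u}).card < ℵ₀ := by
  refine (ZFSet.card_insert_le).trans_lt ?_
  rw [ZFSet.card_singleton]
  exact add_lt_aleph0 one_lt_aleph0 one_lt_aleph0

theorem mem_H_iff {θ : Cardinal.{u}} {x : ZFSet.{u}} :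
    x ∈ H θ ↔ x.card < θ ∧ ∀ y ∈ x, y ∈ H θ :=
  ZFSet.hereditarily_iff

theorem transClass_H (θ : Cardinal.{u}) : TransClass (H θ) :=
  fun _ hx _ hy => (mem_H_iff.1 hx).2 _ hy

theorem mem_H_of_subset {θ : Cardinal.{u}} {x y : ZFSet.{u}} (hy : y ∈ H θ) (h : x ⊆ y) :
    x ∈ H θ :=
  mem_H_iff.2 ⟨(ZFSet.card_mono h).trans_lt (mem_H_iff.1 hy).1,
    fun z hz => (mem_H_iff.1 hy).2 z (h hz)⟩

theorem upair_mem_H {θ : Cardinal.{u}} (hθ : ℵ₀ ≤ θ) {x y : ZFSet.{u}} (hx : x ∈ H θ)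
    (hy : y ∈ H θ) : ({x, y} : ZFSet.{u}) ∈ H θ := by
  refine mem_H_iff.2 ⟨(card_pair_lt_aleph0 x y).trans_le hθ, fun z hz => ?_⟩
  rcases ZFSet.mem_pair.1 hz with rfl | rfl <;> assumption

theorem pair_mem_H {θ : Cardinal.{u}} (hθ : ℵ₀ ≤ θ) {x y : ZFSet.{u}} (hx : x ∈ H θ)
    (hy : y ∈ H θ) : ZFSet.pair x y ∈ H θ := by
  refine upair_mem_H hθ ?_ (upair_mem_H hθ hx hy)
  have := upair_mem_H hθ hx hx
  rwa [ZFSet.pair_eq_singleton] at this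

theorem toZFSet_mem_H {θ : Cardinal.{u}} (a : Ordinal.{u}) (ha : a.card < θ) :
    a.toZFSet ∈ H θ := by
  induction a using WellFoundedLT.induction with
  | ind a ih =>
    refine mem_H_iff.2 ⟨by rwa [Ordinal.card_toZFSet], fun y hy => ?_⟩
    obtain ⟨b, hb, rfl⟩ := Ordinal.mem_toZFSet_iff.1 hy
    exact ih b hb ((Ordinal.card_le_card hb.le).trans_lt ha)

theorem mem_H_of_subset_vonNeumann {θ : Cardinal.{u}} {o : Ordinal.{u}}
    (ho : (ZFSet.vonNeumann o).card < θ) (x : ZFSet.{u}) (hx : x ⊆ ZFSet.vonNeumann o) :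
    x ∈ H θ := by
  induction x using ZFSet.inductionOn with
  | _ x ih =>
    refine mem_H_iff.2 ⟨(ZFSet.card_mono hx).trans_lt ho, fun y hy => ih y hy ?_⟩
    exact ZFSet.isTransitive_vonNeumann o y (hx hy)

/-- All subsets of a level of the cumulative hierarchy are hereditarily bounded by the size of that
level. This places the code of a strategy in `H θ` for all large `θ`. -/
theorem exists_forall_mem_H (x : ZFSet.{u}) : ∃ μ : Cardinal.{u}, ∀ θ, μ < θ → x ∈ H θ :=
  ⟨_, fun _ h => mem_H_of_subset_vonNeumann h x (ZFSet.subset_vonNeumann_self x)⟩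

/-- A sum of fewer than `θ` cardinals below `θ` stays below `θ` by regularity. -/
theorem sUnion_mem_H {θ : Cardinal.{u}} (hθ : θ.IsRegular) {x : ZFSet.{u}} (hx : x ∈ H θ) :
    x.sUnion ∈ H θ := by
  rw [mem_H_iff] at hx
  refine mem_H_iff.2 ⟨?_, fun y hy => ?_⟩
  · have h1 : x.sUnion.card ≤
        #(Σ y : Shrink x, Shrink ((equivShrink x).symm y : ZFSet.{u})) := by
      refine card_le_mk (fun p => ((equivShrink ((equivShrink x).symm p.1 : ZFSet.{u})).symm p.2 : ZFSet.{u})) fun z hz => ?_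
      obtain ⟨y, hy, hz⟩ := ZFSet.mem_sUnion.1 hz
      refine ⟨⟨equivShrink x ⟨y, hy⟩, equivShrink _ ⟨z, by simpa using hz⟩⟩, by simp⟩
    refine h1.trans_lt ?_
    rw [Cardinal.mk_sigma]
    refine Cardinal.sum_lt_of_isRegular hθ hx.1 fun y => ?_
    exact (mem_H_iff.1 (hx.2 _ ((equivShrink x).symm y).2)).1
  · obtain ⟨z, hz, hy⟩ := ZFSet.mem_sUnion.1 hy
    exact (mem_H_iff.1 (hx.2 z hz)).2 y hy

/-! ### Elementary substructures of `H(θ)` -/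

/-- As `M` need not be transitive, distinct elements might have the same elements in `M`.
Elementarity excludes this: an element of the symmetric difference is reflected into `M`. -/
theorem IsElemSub.ext {M : ZFSet.{u}} {C : Set ZFSet.{u}} (h : IsElemSub M C) (ht : TransClass C)
    {x y : ZFSet.{u}} (hx : x ∈ M) (hy : y ∈ M) (hxy : ∀ z ∈ M, z ∈ x ↔ z ∈ y) : x = y := by
  by_contra hne
  obtain ⟨z, hz, hzxy⟩ := h.exists_mem ht (v := x .: fun _ => y)
    (P := fun _ v => ¬ (v 0 ∈ v 1 ↔ v 0 ∈ v 2))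
    (((Dfn.mem _ _).iff (Dfn.mem _ _)).not) (by rintro (_ | i) <;> assumption) (by
      by_contra hn
      push Not at hn
      refine hne (ZFSet.ext fun z => ?_)
      by_cases hz : z ∈ C
      · exact hn z hz
      · exact iff_of_false (fun h' => hz (ht _ (h.subset hx) _ h'))
          (fun h' => hz (ht _ (h.subset hy) _ h')))
  exact hzxy (hxy z hz)

theorem IsElemSub.exists_mem_mem {M : ZFSet.{u}} {C : Set ZFSet.{u}} (h : IsElemSub M C)
    (ht : TransClass C) {P : Set ZFSet.{u} → (ℕ → ZFSet.{u}) → Prop} (hP : Dfn {C} P)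
    {v : ℕ → ZFSet.{u}} (hv : ∀ i, v i ∈ M) {a : ZFSet.{u}} (ha : a ∈ M)
    (hx : ∃ x ∈ a, P C (x .: a .: v)) :
    ∃ x ∈ M, x ∈ a ∧ P C (x .: a .: v) := by
  obtain ⟨x, hxa, hx⟩ := hx
  exact h.exists_mem ht (v := a .: v) (P := fun C v => v 0 ∈ v 1 ∧ P C v) ((Dfn.mem _ _).and hP)
    (by rintro (_ | i); exacts [ha, hv i]) ⟨x, ht _ (h.subset ha) _ hxa, hxa, hx⟩

theorem IsElemSub.upair_mem {M : ZFSet.{u}} {θ : Cardinal.{u}} (h : IsElemSub M (H θ))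
    (hθ : ℵ₀ ≤ θ) {x y : ZFSet.{u}} (hx : x ∈ M) (hy : y ∈ M) : ({x, y} : ZFSet.{u}) ∈ M :=
  h.mem_of_unique (transClass_H θ) (Dfn.upair 0 1 2) (v := x .: fun _ => y)
    (by rintro (_ | i) <;> assumption) (upair_mem_H hθ (h.subset hx) (h.subset hy)) rfl
    fun _ _ h => h

theorem IsElemSub.pair_mem {M : ZFSet.{u}} {θ : Cardinal.{u}} (h : IsElemSub M (H θ))
    (hθ : ℵ₀ ≤ θ) {x y : ZFSet.{u}} (hx : x ∈ M) (hy : y ∈ M) : ZFSet.pair x y ∈ M := by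
  refine h.upair_mem hθ ?_ (h.upair_mem hθ hx hy)
  have := h.upair_mem hθ hx hx
  rwa [ZFSet.pair_eq_singleton] at this

/-- Separation for definable predicates. -/
theorem IsElemSub.sep_mem {M : ZFSet.{u}} {θ : Cardinal.{u}} (h : IsElemSub M (H θ))
    {P : Set ZFSet.{u} → (ℕ → ZFSet.{u}) → Prop} (hP : Dfn {H θ} P)
    {v : ℕ → ZFSet.{u}} (hv : ∀ i, v i ∈ M) {a : ZFSet.{u}} (ha : a ∈ M) :
    a.sep (fun x => P (H θ) (x .: v)) ∈ M := by
  -- Below, variable 0 is the element, 1 the candidate for the separated set and 2 the set `a`, so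
  -- the parameters of `P` start at 3.
  have hP' : Dfn {H θ} (fun C v => P C (v 0 .: fun i => v (i + 3))) := by
    obtain ⟨φ, hφ⟩ := hP
    refine ⟨φ.relabel (0 .: fun i => i + 3), fun C hC ht v => ?_⟩
    rw [Language.Formula.realize_relabel, hφ C hC ht]
    have : (fun i => ((v ∘ (0 .: fun i => i + 3)) i : ZFSet.{u})) =
        ((v 0 : ZFSet.{u}) .: fun i => (v (i + 3) : ZFSet.{u})) := by
      funext i
      cases i <;> rfl
    rw [this]
  refine h.mem_of_unique (transClass_H θ) (v := a .: v)
    (P := fun C v => (∀ x ∈ v 0, x ∈ v 1) ∧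
      ∀ x ∈ v 1, (x ∈ v 0 ↔ P C (x .: fun i => v (i + 2)))) ?_ ?_
    (mem_H_of_subset (h.subset ha) ZFSet.sep_subset) ?_ ?_
  · exact (Dfn.subset 0 1).and (Dfn.ball ((Dfn.mem _ _).iff hP'))
  · rintro (_ | i); exacts [ha, hv i]
  · refine ⟨fun x (hx : x ∈ a.sep (fun x => P (H θ) (x .: v))) => (ZFSet.mem_sep.1 hx).1,
      fun x (hx : x ∈ a) => ?_⟩
    change x ∈ a.sep (fun x => P (H θ) (x .: v)) ↔ P (H θ) (x .: v)
    exact ZFSet.mem_sep.trans (and_iff_right hx)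
  · intro y _ hy
    ext x
    rw [ZFSet.mem_sep]
    exact ⟨fun hx => ⟨hy.1 x hx, (hy.2 x (hy.1 x hx)).1 hx⟩, fun hx => (hy.2 x hx.1).2 hx.2⟩

/-! ### The axioms of `ZFC⁻` in elementary substructures of `H(θ)` -/

section ZFCMinus

variable {M : ZFSet.{u}} {θ : Cardinal.{u}}

/-- Pairs are absolute for `M` although `M` may fail to be transitive, since the true pair belongs
to `M` and extensionality holds there. -/
theorem isUPair_iff (h : IsElemSub M (H θ)) (hθ : ℵ₀ ≤ θ) (z x y : M) :
    IsUPair z x y ↔ z.1 = {x.1, y.1} := by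
  constructor
  · intro hz
    refine h.ext (transClass_H θ) z.2 (h.upair_mem hθ x.2 y.2) fun w hw => ?_
    rw [hz ⟨w, hw⟩, ZFSet.mem_pair]
    exact or_congr Subtype.ext_iff Subtype.ext_iff
  · intro hz w
    rw [hz, ZFSet.mem_pair]
    exact or_congr Subtype.ext_iff.symm Subtype.ext_iff.symm

theorem relatedBy_iff (h : IsElemSub M (H θ)) (hθ : ℵ₀ ≤ θ) (r x y : M) :
    RelatedBy r x y ↔ ZFSet.pair x.1 y.1 ∈ r.1 := by
  constructor
  · rintro ⟨p, ⟨s, t, hs, ht, hp⟩, hpr⟩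
    rw [isUPair_iff h hθ] at hs ht hp
    rw [hp, hs, ht, ZFSet.pair_eq_singleton] at hpr
    exact hpr
  · intro hxy
    refine ⟨⟨_, h.pair_mem hθ x.2 y.2⟩, ⟨⟨_, h.upair_mem hθ x.2 x.2⟩,
      ⟨_, h.upair_mem hθ x.2 y.2⟩, ?_, ?_, ?_⟩, hxy⟩
    · rw [isUPair_iff h hθ]
    · rw [isUPair_iff h hθ]
    · rw [isUPair_iff h hθ]
      simp [ZFSet.pair]

/-- Restrict a well-order of the whole universe to `a`. The sets `s` range over `H θ` only, which
keeps the statement definable over `H θ` so that it reflects to `M`. -/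
theorem exists_wellOrder_mem_H (hθ : ℵ₀ ≤ θ) {a : ZFSet.{u}} (ha : a ∈ H θ) :
    ∃ r ∈ H θ, (∀ x ∈ a, ZFSet.pair x x ∉ r) ∧
      (∀ x ∈ a, ∀ y ∈ a, ∀ z ∈ a, ZFSet.pair x y ∈ r → ZFSet.pair y z ∈ r → ZFSet.pair x z ∈ r) ∧
      ∀ s ∈ H θ, s ⊆ a → (∃ x ∈ s, True) → ∃ m ∈ s, ∀ x ∈ s, x = m ∨ ZFSet.pair m x ∈ r := by
  let R : ZFSet.{u} → ZFSet.{u} → Prop := WellOrderingRel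
  have hr : ∀ x y, ZFSet.pair x y ∈ ZFSet.sep (fun p => ∃ x y, p = ZFSet.pair x y ∧ R x y)
      (ZFSet.prod a a) ↔ x ∈ a ∧ y ∈ a ∧ R x y := by
    intro x y
    rw [ZFSet.mem_sep, ZFSet.pair_mem_prod]
    constructor
    · rintro ⟨⟨hx, hy⟩, x', y', hp, h⟩
      obtain ⟨rfl, rfl⟩ := ZFSet.pair_injective hp
      exact ⟨hx, hy, h⟩
    · rintro ⟨hx, hy, h⟩
      exact ⟨⟨hx, hy⟩, x, y, rfl, h⟩
  refine ⟨ZFSet.sep (fun p => ∃ x y, p = ZFSet.pair x y ∧ R x y) (ZFSet.prod a a),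
    mem_H_iff.2 ⟨?_, fun p hp => ?_⟩, fun x hx h => ?_, fun x hx y hy z hz hxy hyz => ?_,
    fun s hs hsa hne => ?_⟩
  · refine (card_le_mul (y := a) (z := a) ZFSet.pair fun w hw => ?_).trans_lt
      (Cardinal.mul_lt_of_lt hθ (mem_H_iff.1 ha).1 (mem_H_iff.1 ha).1)
    obtain ⟨x, hx, y, hy, rfl⟩ := ZFSet.mem_prod.1 (ZFSet.mem_sep.1 hw).1
    exact ⟨x, hx, y, hy, rfl⟩
  · obtain ⟨x, hx, y, hy, rfl⟩ := ZFSet.mem_prod.1 (ZFSet.mem_sep.1 hp).1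
    exact pair_mem_H hθ ((mem_H_iff.1 ha).2 x hx) ((mem_H_iff.1 ha).2 y hy)
  · exact irrefl_of R x ((hr x x).1 h).2.2
  · exact (hr _ _).2 ⟨hx, hz, trans_of R ((hr _ _).1 hxy).2.2 ((hr _ _).1 hyz).2.2⟩
  · obtain ⟨x, hx, -⟩ := hne
    have hwf : WellFounded R := IsWellFounded.wf
    refine ⟨hwf.min (s : Set ZFSet.{u}) ⟨x, hx⟩, hwf.min_mem _ _, fun y hy => ?_⟩
    rcases trichotomous_of R y (hwf.min (s : Set ZFSet.{u}) ⟨x, hx⟩) with h | h | h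
    · exact absurd h (hwf.not_lt_min _ hy)
    · exact Or.inl h
    · exact Or.inr ((hr _ _).2 ⟨hsa (hwf.min_mem (s : Set ZFSet.{u}) ⟨x, hx⟩), hsa hy, h⟩)

theorem dfn_sat_cons {𝒞 : Set (Set ZFSet.{u})} {n : ℕ} (φ : setL.Formula (Fin (n + 1))) (k : ℕ) :
    Dfn 𝒞 (fun C v => Sat C φ (Fin.cons (v 0) (fun i : Fin n => v (i + k)))) := by
  refine (Dfn.sat φ (Fin.cons 0 fun i => (i : ℕ) + k)).congr fun C _ _ v _ => ?_
  rw [show (fun b => v ((Fin.cons 0 fun i : Fin n => (i : ℕ) + k : Fin (n + 1) → ℕ) b)) =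
    Fin.cons (v 0) (fun i : Fin n => v (i + k)) from ?_]
  funext b
  refine Fin.cases ?_ (fun i => ?_) b <;> simp

theorem dfn_sat_cons₂ {𝒞 : Set (Set ZFSet.{u})} {n : ℕ} (φ : setL.Formula (Fin (n + 2)))
    (k l : ℕ) : Dfn 𝒞 (fun C v => Sat C φ
      (Fin.cons (v l) (Fin.cons (v 0) (fun i : Fin n => v (i + k)) : Fin (n + 1) → ZFSet.{u}))) := by
  refine (Dfn.sat φ (Fin.cons l (Fin.cons 0 fun i => (i : ℕ) + k : Fin (n + 1) → ℕ))).congr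
    fun C _ _ v _ => ?_
  rw [show (fun b => v ((Fin.cons l (Fin.cons 0 fun i : Fin n => (i : ℕ) + k : Fin (n + 1) → ℕ) :
    Fin (n + 2) → ℕ) b)) = Fin.cons (v l) (Fin.cons (v 0) (fun i : Fin n => v (i + k)) :
    Fin (n + 1) → ZFSet.{u}) from ?_]
  funext b
  refine Fin.cases ?_ (fun i => ?_) b
  · simp
  · refine Fin.cases ?_ (fun i => ?_) i <;> simp

/-- The stream that starts with `v` and continues with the constant value `a`. -/
def extend {n : ℕ} (v : Fin n → ZFSet.{u}) (a : ZFSet.{u}) (i : ℕ) : ZFSet.{u} :=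
  if h : i < n then v ⟨i, h⟩ else a

theorem extend_mem {n : ℕ} {v : Fin n → ZFSet.{u}} {a : ZFSet.{u}} (hv : ∀ i, v i ∈ M)
    (ha : a ∈ M) (i : ℕ) : extend v a i ∈ M := by
  unfold extend
  split_ifs
  exacts [hv _, ha]

theorem extend_fin {n : ℕ} (v : Fin n → ZFSet.{u}) (a : ZFSet.{u}) :
    (fun i : Fin n => extend v a i) = v := by
  funext i
  simp [extend]

/-- For every axiom a witness is found in `H θ` and then moved into `M` by the Tarski–Vaught
property. Infinity uses that `ω` and its elements are in `M`. -/
theorem IsElemSub.modelsZFCMinus (hθ : θ.IsRegular) (h : IsElemSub M (H θ))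
    (hω : ∀ x ∈ (Ordinal.omega0.{u} + 1).toZFSet, x ∈ M) : ModelsZFCMinus M := by
  have hθ' := hθ.aleph0_le
  have ht := transClass_H θ
  have hω0 : Ordinal.omega0.toZFSet ∈ M := hω _ (Ordinal.toZFSet_mem_toZFSet_iff.2 (by simp))
  refine ⟨⟨_, hω0⟩, ?_, ?_, ?_, ?_, ?_, ?_, ?_, ?_⟩
  · exact fun x y hxy => Subtype.ext (h.ext ht x.2 y.2 fun z hz => hxy ⟨z, hz⟩)
  · rintro x ⟨y, hy⟩
    obtain ⟨y, hyM, hyx, hy⟩ := h.exists_mem_mem ht (v := fun _ => x.1) (a := x.1)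
      (P := fun _ v => ∀ z ∈ v 0, z ∉ v 1) (Dfn.ball (Dfn.mem _ _).not) (fun _ => x.2) x.2 (by
        obtain ⟨z, hz, hzx⟩ := ZFSet.regularity x.1 (by rintro hx; simp [hx] at hy)
        refine ⟨z, hz, fun w hw hwx => ?_⟩
        have : w ∈ x.1 ∩ z := ZFSet.mem_inter.2 ⟨hwx, hw⟩
        simp [hzx] at this)
    exact ⟨⟨y, hyM⟩, hyx, fun z hz => hy z.1 hz⟩
  · intro x y
    exact ⟨⟨_, h.upair_mem hθ' x.2 y.2⟩, (isUPair_iff h hθ' _ _ _).2 rfl⟩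
  · intro x
    have hU : x.1.sUnion ∈ M := by
      refine h.mem_of_unique ht (v := fun _ => x.1)
        (P := fun _ v => (∀ y ∈ v 0, ∃ z ∈ v 1, y ∈ z) ∧ ∀ z ∈ v 1, ∀ y ∈ z, y ∈ v 0)
        ((Dfn.ball (Dfn.bex (Dfn.mem _ _))).and (Dfn.ball (Dfn.ball (Dfn.mem _ _))))
        (fun _ => x.2) (sUnion_mem_H hθ (h.subset x.2)) ⟨?_, ?_⟩ ?_
      · intro y hy
        exact ZFSet.mem_sUnion.1 hy
      · intro z hz y hy
        exact ZFSet.mem_sUnion.2 ⟨z, hz, hy⟩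
      · intro y _ hy
        ext z
        rw [ZFSet.mem_sUnion]
        exact ⟨fun hz => hy.1 z hz, fun ⟨w, hw, hz⟩ => hy.2 w hw z hz⟩
    refine ⟨⟨_, hU⟩, fun w => ?_⟩
    refine ZFSet.mem_sUnion.trans ?_
    constructor
    · intro hw
      obtain ⟨y, hyM, hyx, hy⟩ := h.exists_mem_mem ht (v := fun _ => w.1) (a := x.1)
        (P := fun _ v => v 2 ∈ v 0) (Dfn.mem _ _) (fun _ => w.2) x.2 hw
      exact ⟨⟨y, hyM⟩, hyx, hy⟩
    · rintro ⟨y, hy⟩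
      exact ⟨y.1, hy⟩
  · have hn : ∀ a < Ordinal.omega0.{u}, a.toZFSet ∈ M := fun a ha =>
      hω _ (Ordinal.toZFSet_mem_toZFSet_iff.2 (ha.trans (by simp)))
    refine ⟨⟨_, hω0⟩, ⟨⟨_, hn 0 Ordinal.omega0_pos⟩, ?_, ?_⟩, fun x hx => ?_⟩
    · exact Ordinal.toZFSet_mem_toZFSet_iff.2 Ordinal.omega0_pos
    · simp
    · obtain ⟨a, ha, hax⟩ := Ordinal.mem_toZFSet_iff.1 hx
      have ha1 : a + 1 < Ordinal.omega0 := Ordinal.isSuccLimit_omega0.succ_lt ha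
      refine ⟨⟨_, hn _ ha1⟩, Ordinal.toZFSet_mem_toZFSet_iff.2 ha1, fun w => ?_⟩
      change w.1 ∈ (a + 1).toZFSet ↔ _
      rw [Ordinal.toZFSet_add_one, ZFSet.mem_insert_iff, hax, or_comm, Subtype.ext_iff]
  · intro n φ v a
    refine ⟨⟨_, h.sep_mem (v := extend (fun i => (v i).1) a.1)
      (dfn_sat_cons φ 1) (extend_mem (fun i => (v i).2) a.2) a.2⟩, fun x => ?_⟩
    simp only [ZFSet.mem_sep]
    rw [h.realize]
    refine and_congr_right fun _ => ?_
    rw [show (fun i : Fin n => (x.1 .: extend (fun i => (v i).1) a.1) ((i : ℕ) + 1)) =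
      fun i => (v i).1 from extend_fin (fun i => (v i).1) a.1]
    rw [show (fun i => ((Fin.cons x v : Fin (n + 1) → M) i : ZFSet.{u})) =
      Fin.cons x.1 (fun i => (v i).1) from ?_]
    · rfl
    · funext i
      refine Fin.cases ?_ (fun i => ?_) i <;> simp
  · intro n φ v a hcol
    have hcons : ∀ x y : M, (fun i => ((Fin.cons x (Fin.cons y v : Fin (n + 1) → M) :
        Fin (n + 2) → M) i : ZFSet.{u})) =
        Fin.cons x.1 (Fin.cons y.1 (fun i => (v i).1) : Fin (n + 1) → ZFSet.{u}) := by
      intro x y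
      funext i
      refine Fin.cases ?_ (fun i => ?_) i
      · simp
      · refine Fin.cases ?_ (fun i => ?_) i <;> simp
    let Q : ZFSet.{u} → ZFSet.{u} → Prop := fun x y =>
      Sat (H θ) φ (Fin.cons x (Fin.cons y (fun i => (v i).1) : Fin (n + 1) → ZFSet.{u}))
    have hQ : ∀ x y : M, Q x.1 y.1 ↔
        φ.Realize (Fin.cons x (Fin.cons y v : Fin (n + 1) → M) : Fin (n + 2) → M) := by
      intro x y
      rw [h.realize, hcons]
    -- The collecting set is required only for those `x ∈ a` that have a witness at all; such a set
    -- exists outright in `H θ`, as the image of `a` under a choice function with default value `x`.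
    obtain ⟨b, hb, hbQ⟩ := h.exists_mem ht (v := a.1 .: extend (fun i => (v i).1) a.1)
      (P := fun C v => ∀ x ∈ v 1, (∃ y ∈ C, Sat C φ (Fin.cons x (Fin.cons y
          (fun i : Fin n => v (i + 2)) : Fin (n + 1) → ZFSet.{u}))) →
        ∃ y ∈ v 0, Sat C φ (Fin.cons x (Fin.cons y
          (fun i : Fin n => v (i + 2)) : Fin (n + 1) → ZFSet.{u})))
      (Dfn.ball ((Dfn.ex (dfn_sat_cons₂ φ 4 1)).imp (Dfn.bex (dfn_sat_cons₂ φ 4 1))))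
      (by rintro (_ | i); exacts [a.2, extend_mem (fun i => (v i).2) a.2 i]) (by
        rw [show (∃ x ∈ H θ, (_ : Prop)) ↔ ∃ b ∈ H θ, ∀ x ∈ a.1, (∃ y ∈ H θ, Q x y) →
          ∃ y ∈ b, Q x y from ?_]
        · classical
          have ha := mem_H_iff.1 (h.subset a.2)
          let f : ZFSet.{u} → ZFSet.{u} := fun x =>
            if hx : ∃ y ∈ H θ, Q x y then hx.choose else x
          refine ⟨ZFSet.range (fun x : a.1 => f x), mem_H_iff.2 ⟨?_, ?_⟩, ?_⟩
          · refine (card_le_card (y := a.1) f fun z hz => ?_).trans_lt ha.1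
            obtain ⟨x, rfl⟩ := ZFSet.mem_range.1 hz
            exact ⟨x, x.2, rfl⟩
          · intro z hz
            obtain ⟨x, rfl⟩ := ZFSet.mem_range.1 hz
            simp only [f]
            split_ifs with hx
            · exact hx.choose_spec.1
            · exact ha.2 _ x.2
          · intro x hxa hx
            refine ⟨f x, ZFSet.mem_range.2 ⟨⟨x, hxa⟩, rfl⟩, ?_⟩
            simp only [f, dif_pos hx]
            exact hx.choose_spec.2
        · refine exists_congr fun b => and_congr_right fun _ => ?_
          rw [show (fun i : Fin n => (b .: a.1 .: extend (fun i => (v i).1) a.1) ((i : ℕ) + 2)) =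
            fun i => (v i).1 from extend_fin (fun i => (v i).1) a.1]
          rfl)
    refine ⟨⟨b, hb⟩, fun x hx => ?_⟩
    rw [show (fun i : Fin n => (b .: a.1 .: extend (fun i => (v i).1) a.1) ((i : ℕ) + 2)) =
            fun i => (v i).1 from extend_fin (fun i => (v i).1) a.1] at hbQ
    obtain ⟨y, hy⟩ := hcol x hx
    have h1 := hbQ x.1 hx ⟨y.1, h.subset y.2, (hQ x y).2 hy⟩
    obtain ⟨y, hyM, hyb, hyQ⟩ := h.exists_mem_mem ht
      (v := x.1 .: extend (fun i => (v i).1) a.1) (a := b)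
      (P := fun C v => Sat C φ (Fin.cons (v 2) (Fin.cons (v 0)
          (fun i : Fin n => v (i + 3)) : Fin (n + 1) → ZFSet.{u})))
      (dfn_sat_cons₂ φ 3 2)
      (by rintro (_ | i); exacts [x.2, extend_mem (fun i => (v i).2) a.2 i]) hb (by
        obtain ⟨y, hy, hQy⟩ := h1
        refine ⟨y, hy, ?_⟩
        rw [show (fun i : Fin n => (y .: b .: x.1 .: extend (fun i => (v i).1) a.1) ((i : ℕ) + 3)) =
            fun i => (v i).1 from extend_fin (fun i => (v i).1) a.1]
        exact hQy)
    rw [show (fun i : Fin n => (y .: b .: x.1 .: extend (fun i => (v i).1) a.1) ((i : ℕ) + 3)) =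
            fun i => (v i).1 from extend_fin (fun i => (v i).1) a.1] at hyQ
    exact ⟨⟨y, hyM⟩, hyb, (hQ x ⟨y, hyM⟩).1 hyQ⟩
  · intro a
    obtain ⟨r, hr, h1, h2, h3⟩ := h.exists_mem ht (v := fun _ => a.1)
      (P := fun C v => (∀ x ∈ v 1, ZFSet.pair x x ∉ v 0) ∧
        (∀ x ∈ v 1, ∀ y ∈ v 1, ∀ z ∈ v 1, ZFSet.pair x y ∈ v 0 → ZFSet.pair y z ∈ v 0 →
          ZFSet.pair x z ∈ v 0) ∧
        ∀ s ∈ C, s ⊆ v 1 → (∃ x ∈ s, True) → ∃ m ∈ s, ∀ x ∈ s, x = m ∨ ZFSet.pair m x ∈ v 0)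
      ((Dfn.ball (Dfn.pair_mem _ _ _).not).and ((Dfn.ball (Dfn.ball (Dfn.ball
        ((Dfn.pair_mem _ _ _).imp ((Dfn.pair_mem _ _ _).imp (Dfn.pair_mem _ _ _)))))).and
        (Dfn.all ((Dfn.subset _ _).imp ((Dfn.bex (Dfn.const _)).imp
          (Dfn.bex (Dfn.ball ((Dfn.eq _ _).or (Dfn.pair_mem _ _ _)))))))))
      (fun _ => a.2) (exists_wellOrder_mem_H hθ' (h.subset a.2))
    refine ⟨⟨r, hr⟩, fun x hx => ?_, fun x y z hx hy hz => ?_, fun s hs hsa => ?_⟩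
    · rw [relatedBy_iff h hθ']
      exact h1 x.1 hx
    · simp only [relatedBy_iff h hθ']
      exact h2 x.1 hx y.1 hy z.1 hz
    · obtain ⟨m, hm, hms, hmr⟩ := h.exists_mem_mem ht (v := fun _ => r) (a := s.1)
        (P := fun _ v => ∀ x ∈ v 1, x = v 0 ∨ ZFSet.pair (v 0) x ∈ v 2)
        (Dfn.ball ((Dfn.eq _ _).or (Dfn.pair_mem _ _ _))) (fun _ => hr) s.2
        (h3 s.1 (h.subset s.2) (by
          -- Inclusion of `s` in `a` is known only for elements of `M`; an element of `s` outside
          -- `a` would be reflected to one in `M`.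
          intro x hx
          by_contra hxa
          obtain ⟨y, hy, hys, hya⟩ := h.exists_mem_mem ht (v := fun _ => a.1) (a := s.1)
            (P := fun _ v => v 0 ∉ v 2) (Dfn.mem _ _).not (fun _ => a.2) s.2 ⟨x, hx, hxa⟩
          exact hya (hsa ⟨y, hy⟩ hys)) (by
          obtain ⟨x, hx⟩ := hs
          exact ⟨x.1, hx, trivial⟩))
      refine ⟨⟨m, hm⟩, hms, fun x hx hxm => ?_⟩
      rw [relatedBy_iff h hθ']
      exact (hmr x.1 hx).resolve_left fun h => hxm (Subtype.ext h)

end ZFCMinus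

/-! ### Unions of chains -/

theorem mem_unionBelow {α : Ordinal.{u}} {x : Ordinal.{u} → ZFSet.{u}} {y : ZFSet.{u}} :
    y ∈ unionBelow α x ↔ ∃ β < α, y ∈ x β := by
  unfold unionBelow
  rw [ZFSet.mem_iUnion]
  exact ⟨fun ⟨β, h⟩ => ⟨β, β.2, h⟩, fun ⟨β, hβ, h⟩ => ⟨⟨β, hβ⟩, h⟩⟩

theorem card_unionBelow_le {κ : Cardinal.{u}} (hκ : ℵ₀ ≤ κ) {α : Ordinal.{u}} (hα : α.card ≤ κ)
    {x : Ordinal.{u} → ZFSet.{u}} (hx : ∀ β < α, (x β).card ≤ κ) : (unionBelow α x).card ≤ κ := by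
  let I := Shrink.{u} α.toZFSet
  -- The ordinal is recovered from its von Neumann set as the rank.
  let o : I → Ordinal.{u} := fun b => ((equivShrink α.toZFSet).symm b : ZFSet.{u}).rank
  have ho : ∀ b, o b < α := by
    intro b
    obtain ⟨a, ha, hb⟩ := Ordinal.mem_toZFSet_iff.1 ((equivShrink _).symm b).2
    simpa only [o, ← hb, Ordinal.rank_toZFSet] using ha
  have h1 : (unionBelow α x).card ≤ #(Σ b : I, Shrink.{u} (x (o b))) := by
    refine card_le_mk (fun p => ((equivShrink (x (o p.1))).symm p.2 : ZFSet.{u})) fun z hz => ?_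
    obtain ⟨b, hb, hz⟩ := mem_unionBelow.1 hz
    have hob : o (equivShrink _ ⟨b.toZFSet, Ordinal.toZFSet_mem_toZFSet_iff.2 hb⟩) = b := by
      simp [o]
    refine ⟨⟨_, equivShrink _ ⟨z, hob.symm ▸ hz⟩⟩, by simp⟩
  refine h1.trans ?_
  rw [Cardinal.mk_sigma]
  refine (Cardinal.sum_le_sum _ (fun _ => κ) fun b => hx _ (ho b)).trans ?_
  rw [Cardinal.sum_const, Cardinal.lift_id, Cardinal.lift_id]
  refine (mul_le_mul' ?_ le_rfl).trans (Cardinal.mul_eq_self hκ).le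
  change ZFSet.card α.toZFSet ≤ κ
  rwa [Ordinal.card_toZFSet]

theorem exists_ordinal_bound {κ : Cardinal.{u}} (hκ : κ.IsRegular) {x : ZFSet.{u}}
    (hx : x.card < κ) (f : ZFSet.{u} → Ordinal.{u}) (hf : ∀ c ∈ x, f c < κ.ord) :
    ∃ γ < κ.ord, ∀ c ∈ x, f c ≤ γ := by
  let g : Shrink.{u} x → Ordinal.{u} := fun b => f ((equivShrink x).symm b : ZFSet.{u})
  refine ⟨iSup g, Ordinal.iSup_lt_of_lt_cof (by rwa [hκ.cof_ord])
    fun b => hf _ ((equivShrink _).symm b).2, fun c hc => ?_⟩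
  have := Ordinal.le_iSup g (equivShrink _ ⟨c, hc⟩)
  simpa [g] using this

/-- The union of an elementary chain: finitely many parameters already lie in one member of the
chain, and the Tarski–Vaught property of that member gives the witness. The element `a` only fills
the unused variables. -/
theorem isElemSub_unionBelow {C : Set ZFSet.{u}} (ht : TransClass C) {α : Ordinal.{u}}
    {X : Ordinal.{u} → ZFSet.{u}} (hα : 0 < α) (hX : ∀ k < α, IsElemSub (X k) C)
    (hmono : ∀ k l, k ≤ l → l < α → X k ⊆ X l) {a : ZFSet.{u}} (ha : a ∈ X 0) :
    IsElemSub (unionBelow α X) C := by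
  refine isElemSub_of_forall (fun x hx => ?_) fun n φ v x hv hφ => ?_
  · obtain ⟨k, hk, hx⟩ := mem_unionBelow.1 hx
    exact (hX k hk).subset hx
  · obtain ⟨k, hk, hvk⟩ : ∃ k < α, ∀ i, v i ∈ X k := by
      choose f hf hvf using fun i => mem_unionBelow.1 (hv i)
      rcases Nat.eq_zero_or_pos n with rfl | hn
      · exact ⟨0, hα, fun i => i.elim0⟩
      · have : Nonempty (Fin n) := ⟨⟨0, hn⟩⟩
        obtain ⟨i, hi⟩ := Finite.exists_max f
        exact ⟨f i, hf i, fun l => hmono _ _ (hi l) (hf i) (hvf l)⟩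
    have hs : ∀ y, (fun b => (y .: extend v a)
        ((Fin.snoc (fun i : Fin n => (i : ℕ) + 1) 0 : Fin (n + 1) → ℕ) b)) =
        (Fin.snoc v y : Fin (n + 1) → ZFSet.{u}) := by
      intro y
      funext b
      refine Fin.lastCases ?_ (fun i => ?_) b
      · rw [Fin.snoc_last, Fin.snoc_last]
        rfl
      · rw [Fin.snoc_castSucc, Fin.snoc_castSucc]
        exact congrFun (extend_fin v a) i
    obtain ⟨y, hy, hφy⟩ := (hX k hk).exists_mem ht (v := extend v a)
      (Dfn.sat φ (Fin.snoc (fun i : Fin n => (i : ℕ) + 1) 0 : Fin (n + 1) → ℕ))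
      (extend_mem hvk (hmono 0 k bot_le hk ha))
      ⟨x, by simpa using hφ.1 (Fin.last n), by rwa [hs]⟩
    refine ⟨y, mem_unionBelow.2 ⟨k, hk, hy⟩, ?_⟩
    rwa [hs] at hφy

/-! ### The construction of `κ`-models -/

theorem exists_isElemSub_of_elementarySubstructure {C : Set ZFSet.{u}}
    (S : setL.ElementarySubstructure C) [Small.{u} S] :
    IsElemSub (ZFSet.range (fun x : S => ((x : C) : ZFSet.{u}))) C := by
  have hM : ∀ x : ZFSet.range (fun x : S => ((x : C) : ZFSet.{u})), ∃ y : S,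
      ((y : C) : ZFSet.{u}) = x := fun x => ZFSet.mem_range.1 x.2
  choose f hf using hM
  let e : ZFSet.range (fun x : S => ((x : C) : ZFSet.{u})) ≃[setL] S :=
    { toFun := f
      invFun := fun y => ⟨_, ZFSet.mem_range.2 ⟨y, rfl⟩⟩
      left_inv := fun x => Subtype.ext (hf x)
      right_inv := fun y => Subtype.ext (Subtype.ext (hf _))
      map_fun' := fun g => Empty.elim g
      map_rel' := fun r x => by
        cases r
        change ((f (x 0) : C) : ZFSet.{u}) ∈ ((f (x 1) : C) : ZFSet.{u}) ↔ (x 0).1 ∈ (x 1).1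
        rw [hf, hf] }
  exact ⟨S.subtype.comp e.toElementaryEmbedding, hf⟩

theorem card_setL_le : setL.card ≤ ℵ₀ := by
  have : ∀ n, Countable (setL.Relations n) := by
    intro n
    refine Function.Injective.countable (f := fun _ => (0 : ℕ)) ?_
    rintro ⟨⟩ ⟨⟩ _
    rfl
  have : ∀ n, Countable (setL.Functions n) := fun n => inferInstanceAs (Countable Empty)
  exact Cardinal.mk_le_aleph0_iff.2 (inferInstanceAs (Countable (_ ⊕ _)))

/-- Downward Löwenheim–Skolem. The class `H θ` has at least `κ` elements because it contains `κ` as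
a subset, and a substructure of size `κ` is small enough to be a set. -/
theorem exists_isElemSub {κ θ : Cardinal.{u}} (hκ : ℵ₀ ≤ κ) (hκθ : κ < θ) {Y : ZFSet.{u}}
    (hY : Y.card ≤ κ) (hYH : ∀ y ∈ Y, y ∈ H θ) :
    ∃ M : ZFSet.{u}, M.card = κ ∧ IsElemSub M (H θ) ∧ Y ⊆ M := by
  let s : Set (H θ) := {x | (x : ZFSet.{u}) ∈ Y}
  obtain ⟨S, hS, hcard⟩ := Language.exists_elementarySubstructure_card_eq setL s κ hκ (by
      rw [Cardinal.lift_id'.{u, u + 1}]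
      refine le_trans ?_ (Cardinal.lift_le.2 hY)
      rw [← ZFSet.cardinalMk_coe_sort]
      exact Cardinal.mk_le_of_injective (f := fun x : s => (⟨x.1, x.2⟩ : Y)) fun x y hxy =>
        Subtype.ext (Subtype.ext (Subtype.mk.inj hxy)))
    (by
      refine (Cardinal.lift_le.2 card_setL_le).trans ?_
      simpa using hκ)
    (by
      rw [Cardinal.lift_id'.{u, u + 1}]
      have h1 : Cardinal.lift.{u + 1} κ = #(κ.ord.toZFSet) := by
        rw [ZFSet.cardinalMk_coe_sort, Ordinal.card_toZFSet, Cardinal.card_ord]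
      rw [h1]
      refine Cardinal.mk_le_of_injective
        (f := fun x : κ.ord.toZFSet => (⟨x.1, ?_⟩ : H θ)) fun x y hxy =>
        Subtype.ext (Subtype.mk.inj hxy)
      have := toZFSet_mem_H (θ := θ) κ.ord (by rwa [Cardinal.card_ord])
      exact transClass_H θ _ this _ x.2)
  rw [Cardinal.lift_id'.{u, u + 1}] at hcard
  have hsm : Small.{u} S := by
    rw [Cardinal.small_iff_lift_mk_lt_univ, Cardinal.lift_id'.{u + 1, u + 1}, hcard]
    exact Cardinal.lift_lt_univ' κ
  refine ⟨_, ?_, exists_isElemSub_of_elementarySubstructure S, fun y hy => ?_⟩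
  · rw [← Cardinal.lift_inj.{u, u + 1}, ← ZFSet.cardinalMk_coe_sort, ← hcard]
    refine Cardinal.mk_congr (Equiv.ofBijective
      (fun x : S => ⟨_, ZFSet.mem_range.2 ⟨x, rfl⟩⟩) ⟨fun x y hxy => ?_, fun x => ?_⟩).symm
    · exact Subtype.ext (Subtype.ext (Subtype.mk.inj hxy))
    · obtain ⟨y, hy⟩ := ZFSet.mem_range.1 x.2
      exact ⟨y, Subtype.ext hy⟩
  · exact ZFSet.mem_range.2 ⟨⟨⟨y, hYH y hy⟩, hS hy⟩, rfl⟩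

theorem isFunc_pair_mem {x y f a b : ZFSet.{u}} (hf : ZFSet.IsFunc x y f)
    (h : ZFSet.pair a b ∈ f) : a ∈ x ∧ b ∈ y :=
  ZFSet.pair_mem_prod.1 (hf.1 h)

theorem isFunc_eq {x y f a b c : ZFSet.{u}} (hf : ZFSet.IsFunc x y f)
    (hb : ZFSet.pair a b ∈ f) (hc : ZFSet.pair a c ∈ f) : b = c :=
  (hf.2 a (isFunc_pair_mem hf hb).1).unique hb hc

theorem isFunc_mem_H {θ : Cardinal.{u}} (hθ : ℵ₀ ≤ θ) {x y f : ZFSet.{u}}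
    (hf : ZFSet.IsFunc x y f) (hx : x ∈ H θ) (hy : ∀ z ∈ y, z ∈ H θ) : f ∈ H θ := by
  refine mem_H_iff.2 ⟨lt_of_le_of_lt ?_ (mem_H_iff.1 hx).1, fun p hp => ?_⟩
  · classical
    refine card_le_card (fun a => if h : ∃ w, ZFSet.pair a w ∈ f then ZFSet.pair a h.choose else a)
      fun p hp => ?_
    obtain ⟨a, ha, b, hb, rfl⟩ := ZFSet.mem_prod.1 (hf.1 hp)
    have h : ∃ w, ZFSet.pair a w ∈ f := ⟨b, hp⟩
    refine ⟨a, ha, ?_⟩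
    rw [dif_pos h, isFunc_eq hf hp h.choose_spec]
  · obtain ⟨a, ha, b, hb, rfl⟩ := ZFSet.mem_prod.1 (hf.1 hp)
    exact pair_mem_H hθ ((mem_H_iff.1 hx).2 a ha) (hy b hb)

/-- The set of functions from elements of `x` to `Y`. -/
def funsBelow (x Y : ZFSet.{u}) : ZFSet.{u} :=
  ZFSet.sUnion (ZFSet.range (fun b : x => ZFSet.funs b Y))

theorem mem_funsBelow {x Y s : ZFSet.{u}} :
    s ∈ funsBelow x Y ↔ ∃ b ∈ x, ZFSet.IsFunc b Y s := by
  unfold funsBelow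
  rw [ZFSet.mem_sUnion]
  constructor
  · rintro ⟨z, hz, hs⟩
    obtain ⟨b, rfl⟩ := ZFSet.mem_range.1 hz
    exact ⟨b, b.2, ZFSet.mem_funs.1 hs⟩
  · rintro ⟨b, hb, hs⟩
    exact ⟨_, ZFSet.mem_range.2 ⟨⟨b, hb⟩, rfl⟩, ZFSet.mem_funs.2 hs⟩

/-- There are `κ` many domains, and for each of them at most `κ^{<κ} = κ` functions. -/
theorem card_funsBelow_le {κ : Cardinal.{u}} (hκ : ℵ₀ ≤ κ) (hpow : κ ^< κ = κ) {Y : ZFSet.{u}}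
    (hY : Y.card ≤ κ) : (funsBelow (asSet κ) Y).card ≤ κ := by
  let I := Shrink.{u} (asSet κ)
  let o : I → ZFSet.{u} := fun b => ((equivShrink (asSet κ)).symm b : ZFSet.{u})
  have h1 : (funsBelow (asSet κ) Y).card ≤ #(Σ b : I, (Shrink.{u} (o b) → Shrink.{u} Y)) := by
    refine card_le_mk (fun p => ZFSet.range (fun c : o p.1 => ZFSet.pair c
      ((equivShrink Y).symm (p.2 (equivShrink _ c)) : ZFSet.{u}))) fun s hs => ?_
    obtain ⟨b, hb, hs⟩ := mem_funsBelow.1 hs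
    obtain ⟨i, rfl⟩ : ∃ i, o i = b := ⟨equivShrink _ ⟨b, hb⟩, by simp [o]⟩
    choose g hg using fun c : o i => (hs.2 c c.2).exists
    refine ⟨⟨i, fun c => equivShrink Y ⟨g ((equivShrink _).symm c),
      (isFunc_pair_mem hs (hg _)).2⟩⟩, ?_⟩
    ext p
    rw [ZFSet.mem_range]
    simp only [Equiv.symm_apply_apply]
    constructor
    · rintro ⟨c, rfl⟩
      exact hg c
    · intro hp
      obtain ⟨a, ha, w, hw, rfl⟩ := ZFSet.mem_prod.1 (hs.1 hp)
      exact ⟨⟨a, ha⟩, by rw [isFunc_eq hs hp (hg ⟨a, ha⟩)]⟩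
  refine h1.trans ?_
  rw [Cardinal.mk_sigma]
  refine (Cardinal.sum_le_sum _ (fun _ => κ) fun b => ?_).trans ?_
  · rw [← Cardinal.power_def]
    change Y.card ^ (o b).card ≤ κ
    refine (Cardinal.power_le_power_right hY).trans ?_
    refine (Cardinal.le_powerlt κ ?_).trans hpow.le
    obtain ⟨a, ha, hb⟩ := Ordinal.mem_toZFSet_iff.1 ((equivShrink (asSet κ)).symm b).2
    simp only [o]
    rw [← hb, Ordinal.card_toZFSet]
    exact Cardinal.lt_ord.1 ha
  · rw [Cardinal.sum_const, Cardinal.lift_id, Cardinal.lift_id]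
    refine (mul_le_mul' ?_ le_rfl).trans (Cardinal.mul_eq_self hκ).le
    change ZFSet.card κ.ord.toZFSet ≤ κ
    rw [Ordinal.card_toZFSet, Cardinal.card_ord]

/-- An elementary substructure of `H(θ)` of size `κ` that contains `Y` and the `<κ`-sequences
from `Y`, if there is one. -/
def hullStep (κ θ : Cardinal.{u}) (Y : ZFSet.{u}) : ZFSet.{u} :=
  open Classical in
  if h : ∃ M : ZFSet.{u}, M.card = κ ∧ IsElemSub M (H θ) ∧ Y ∪ funsBelow (asSet κ) Y ⊆ M then
    h.choose
  else ∅

theorem hullStep_spec {κ θ : Cardinal.{u}} (hκ : ℵ₀ ≤ κ) (hpow : κ ^< κ = κ) (hκθ : κ < θ)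
    {Y : ZFSet.{u}} (hY : Y.card ≤ κ) (hYH : ∀ y ∈ Y, y ∈ H θ) :
    (hullStep κ θ Y).card = κ ∧ IsElemSub (hullStep κ θ Y) (H θ) ∧
      Y ∪ funsBelow (asSet κ) Y ⊆ hullStep κ θ Y := by
  have h : ∃ M : ZFSet.{u}, M.card = κ ∧ IsElemSub M (H θ) ∧
      Y ∪ funsBelow (asSet κ) Y ⊆ M := by
    refine exists_isElemSub hκ hκθ ?_ fun y hy => ?_
    · refine ZFSet.card_union_le.trans ?_
      exact (add_le_add hY (card_funsBelow_le hκ hpow hY)).trans (Cardinal.add_eq_self hκ).le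
    · rcases ZFSet.mem_union.1 hy with hy | hy
      · exact hYH y hy
      · obtain ⟨b, hb, hs⟩ := mem_funsBelow.1 hy
        refine isFunc_mem_H (hκ.trans hκθ.le) hs ?_ hYH
        have := toZFSet_mem_H (θ := θ) κ.ord (by rwa [Cardinal.card_ord])
        exact transClass_H θ _ this _ hb
  unfold hullStep
  rw [dif_pos h]
  exact h.choose_spec

/-- The increasing sequence of approximations to a `κ`-model that contains `Y`. -/
def hullSeq (κ θ : Cardinal.{u}) (Y : ZFSet.{u}) (i : Ordinal.{u}) : ZFSet.{u} :=
  hullStep κ θ (Y ∪ ZFSet.iUnion (fun k : Set.Iio i => hullSeq κ θ Y k))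
termination_by i
decreasing_by exact k.2

theorem hullSeq_eq (κ θ : Cardinal.{u}) (Y : ZFSet.{u}) (i : Ordinal.{u}) :
    hullSeq κ θ Y i = hullStep κ θ (Y ∪ unionBelow i (hullSeq κ θ Y)) := by
  rw [hullSeq]
  rfl

/-- Iterate hulls `κ` many times, each stage containing all `<κ`-sequences from the union of the
earlier ones. By regularity, a `<κ`-sequence from the final union takes its values in one stage, so
it has been added at a later one. -/
theorem exists_isModel {κ θ : Cardinal.{u}} (hκ : κ.IsRegular) (hpow : κ ^< κ = κ)
    (hθ : θ.IsRegular) (hκθ : κ < θ) {Y : ZFSet.{u}} (hY : Y.card ≤ κ)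
    (hYH : ∀ y ∈ Y, y ∈ H θ) :
    ∃ M : ZFSet.{u}, IsModel κ M ∧ IsElemSub M (H θ) ∧ Y ⊆ M := by
  have hκ0 := hκ.aleph0_le
  have hκH : ∀ x ∈ (κ.ord + 1).toZFSet, x ∈ H θ := by
    intro x hx
    rw [Ordinal.toZFSet_add_one, ZFSet.mem_insert_iff] at hx
    have := toZFSet_mem_H (θ := θ) κ.ord (by rwa [Cardinal.card_ord])
    rcases hx with rfl | hx
    · exact this
    · exact transClass_H θ _ this _ hx
  have hκc : (κ.ord + 1).toZFSet.card ≤ κ := by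
    rw [Ordinal.toZFSet_add_one]
    refine ZFSet.card_insert_le.trans ?_
    rw [Ordinal.card_toZFSet, Cardinal.card_ord]
    exact (Cardinal.add_one_eq hκ0).le
  let Z := Y ∪ (κ.ord + 1).toZFSet
  let X := hullSeq κ θ Z
  have hspec : ∀ i < κ.ord, (X i).card = κ ∧ IsElemSub (X i) (H θ) ∧
      (Z ∪ unionBelow i X) ∪ funsBelow (asSet κ) (Z ∪ unionBelow i X) ⊆ X i := by
    intro i
    induction i using WellFoundedLT.induction with
    | ind i ih =>
      intro hi
      have h1 : X i = hullStep κ θ (Z ∪ unionBelow i X) := hullSeq_eq κ θ Z i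
      rw [h1]
      refine hullStep_spec hκ0 hpow hκθ ?_ fun y hy => ?_
      · refine ZFSet.card_union_le.trans ((add_le_add (ZFSet.card_union_le.trans
          ((add_le_add hY hκc).trans (Cardinal.add_eq_self hκ0).le)) ?_).trans
          (Cardinal.add_eq_self hκ0).le)
        exact card_unionBelow_le hκ0 (Cardinal.lt_ord.1 hi).le
          fun k hk => (ih k hk (hk.trans hi)).1.le
      · rcases ZFSet.mem_union.1 hy with hy | hy
        · rcases ZFSet.mem_union.1 hy with hy | hy
          exacts [hYH y hy, hκH y hy]
        · obtain ⟨k, hk, hy⟩ := mem_unionBelow.1 hy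
          exact (ih k hk (hk.trans hi)).2.1.subset hy
  have hmono : ∀ k l, k ≤ l → l < κ.ord → X k ⊆ X l := by
    intro k l hkl hl
    rcases hkl.eq_or_lt with rfl | hkl
    · exact fun _ h => h
    · intro x hx
      exact (hspec l hl).2.2 (ZFSet.mem_union.2 (Or.inl (ZFSet.mem_union.2 (Or.inr
        (mem_unionBelow.2 ⟨k, hkl, hx⟩)))))
  have hZ : ∀ i < κ.ord, Z ⊆ X i := fun i hi x hx =>
    (hspec i hi).2.2 (ZFSet.mem_union.2 (Or.inl (ZFSet.mem_union.2 (Or.inl hx))))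
  have hpos : 0 < κ.ord := hκ.ord_pos
  have hκZ : asSet κ ∈ Z := ZFSet.mem_union.2 (Or.inr (by
    unfold asSet
    rw [Ordinal.toZFSet_mem_toZFSet_iff]
    exact lt_add_one _))
  have hZM : Z ⊆ unionBelow κ.ord X := fun x hx => mem_unionBelow.2 ⟨0, hpos, hZ 0 hpos hx⟩
  have hM : IsElemSub (unionBelow κ.ord X) (H θ) :=
    isElemSub_unionBelow (transClass_H θ) hpos (fun k hk => (hspec k hk).2.1) hmono
      (hZ 0 hpos hκZ)
  have hsucc : (κ.ord + 1).toZFSet ⊆ unionBelow κ.ord X :=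
    fun x hx => hZM (ZFSet.mem_union.2 (Or.inr hx))
  refine ⟨unionBelow κ.ord X, ⟨⟨le_antisymm ?_ ?_, hsucc, ?_⟩, ?_⟩, hM,
    fun y hy => hZM (ZFSet.mem_union.2 (Or.inl hy))⟩
  · exact card_unionBelow_le hκ0 (Cardinal.card_ord κ).le fun k hk => (hspec k hk).1.le
  · refine (hspec 0 hpos).1.ge.trans ?_
    exact ZFSet.card_mono fun x hx => mem_unionBelow.2 ⟨0, hpos, hx⟩
  · refine hM.modelsZFCMinus hθ fun x hx => hsucc ?_
    refine Ordinal.toZFSet_subset_toZFSet_iff.2 ?_ hx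
    have : Ordinal.omega0 ≤ κ.ord := by
      rw [← Cardinal.ord_aleph0]
      exact Cardinal.ord_le_ord.2 hκ0
    gcongr
  · intro β hβ s hs
    choose! f hf using fun c (hc : c ∈ β.toZFSet) => (hs.2 c hc).exists
    choose! k hk hfk using fun c (hc : c ∈ β.toZFSet) =>
      mem_unionBelow.1 (isFunc_pair_mem hs (hf c hc)).2
    obtain ⟨γ, hγ, hkγ⟩ := exists_ordinal_bound hκ (x := β.toZFSet)
      (by rw [Ordinal.card_toZFSet]; exact Cardinal.lt_ord.1 hβ) k hk
    -- The values lie in stage `γ`, so stage `γ + 1` contains the sequence.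
    have hγ1 : γ + 1 < κ.ord := (Cardinal.isSuccLimit_ord hκ0).succ_lt hγ
    refine mem_unionBelow.2 ⟨γ + 1, hγ1, (hspec _ hγ1).2.2 (ZFSet.mem_union.2 (Or.inr
      (mem_funsBelow.2 ⟨β.toZFSet, Ordinal.toZFSet_mem_toZFSet_iff.2 hβ, ?_, hs.2⟩)))⟩
    intro p hp
    obtain ⟨a, ha, b, hb, rfl⟩ := ZFSet.mem_prod.1 (hs.1 hp)
    refine ZFSet.pair_mem_prod.2 ⟨ha, ZFSet.mem_union.2 (Or.inr (mem_unionBelow.2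
      ⟨γ, lt_add_one _, hmono _ _ (hkγ a ha) hγ ?_⟩))⟩
    rw [isFunc_eq hs hp (hf a ha)]
    exact hfk a ha

/-! ### Functions in elementary substructures -/

/-- `h` is a function with domain `k`. -/
def IsFn (k h : ZFSet.{u}) : Prop :=
  (∀ p ∈ h, ∃ x ∈ k, ∃ y, ZFSet.pair x y ∈ h ∧ p = ZFSet.pair x y) ∧
    ∀ x ∈ k, ∃ y, ZFSet.pair x y ∈ h ∧ ∀ z, ZFSet.pair x z ∈ h → z = y

namespace Dfn

variable {𝒞 : Set (Set ZFSet.{u})}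

theorem isFn (i j : ℕ) : Dfn 𝒞 (fun _ v => IsFn (v i) (v j)) :=
  (ball (i := j) (P := fun _ p v => ∃ x ∈ v i, ∃ y, ZFSet.pair x y ∈ v j ∧ p = ZFSet.pair x y)
    (bex (P := fun _ x v => ∃ y, ZFSet.pair x y ∈ v (j + 1) ∧ v 0 = ZFSet.pair x y)
      (exPair (P := fun _ y v => v 1 = ZFSet.pair (v 0) y) (eq_pair _ _ _)))).and
  (ball (i := i) (P := fun _ x v => ∃ y, ZFSet.pair x y ∈ v j ∧ ∀ z, ZFSet.pair x z ∈ v j → z = y)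
    (exPair (P := fun _ y v => ∀ z, ZFSet.pair (v 0) z ∈ v (j + 1) → z = y)
      (allPair (P := fun _ z v => z = v 0) (eq _ _))))

theorem rename {P : Set ZFSet.{u} → (ℕ → ZFSet.{u}) → Prop} (hP : Dfn 𝒞 P) (r : ℕ → ℕ) :
    Dfn 𝒞 (fun C v => P C (fun i => v (r i))) := by
  obtain ⟨φ, hφ⟩ := hP
  refine ⟨φ.relabel r, fun C hC ht v => ?_⟩
  rw [Language.Formula.realize_relabel, hφ C hC ht]
  rfl

theorem rename₂ {P : Set ZFSet.{u} → (ℕ → ZFSet.{u}) → Prop} (hP : Dfn 𝒞 P) (a b k : ℕ) :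
    Dfn 𝒞 (fun C v => P C (v a .: v b .: fun i => v (i + k))) := by
  refine (hP.rename (a .: b .: fun i => i + k)).congr fun C _ _ v _ => ?_
  rw [show (fun i => v ((a .: b .: fun i => i + k) i)) = (v a .: v b .: fun i => v (i + k)) from ?_]
  funext i
  rcases i with _ | _ | i <;> rfl

/-- Definability of satisfaction of a formula at the values of functions. -/
theorem satValues {m : ℕ} {β : Type} (φ : setL.Formula β) (r : β → ℕ) (s : Fin m → ℕ) :
    Dfn 𝒞 (fun C v => ∃ y : Fin m → ZFSet.{u}, (∀ b, y b ∈ C) ∧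
      (∀ b, ZFSet.pair (v 0) (y b) ∈ v (s b)) ∧
      Sat C φ (fun b => if h : r b < m then y ⟨r b, h⟩ else v (r b - m))) := by
  refine exFin (β := Fin m) (P := fun C y v => (∀ b, ZFSet.pair (v 0) (y b) ∈ v (s b)) ∧
      Sat C φ (fun b => if h : r b < m then y ⟨r b, h⟩ else v (r b - m)))
    (fun i => if h : i < m then Sum.inr ⟨i, h⟩ else Sum.inl (i - m)) (fun i => i + m)
    (fun b => b) (fun i => by simp) (fun b => by simp) ?_
  refine (finAnd fun b => pair_mem _ _ _).and ((sat φ r).congr fun C _ _ v _ => ?_)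
  rw [show (fun b => if h : r b < m then v ((⟨r b, h⟩ : Fin m) : ℕ) else v (r b - m + m)) =
    fun b => v (r b) from ?_]
  funext b
  split_ifs with h
  · rfl
  · rw [Nat.sub_add_cancel (not_lt.1 h)]

end Dfn

/-- The value of a function in `M` at an argument in `M` is definable from both, hence in `M`. -/
theorem IsFn.isFunc {k h : ZFSet.{u}} (hf : IsFn k h) {M : ZFSet.{u}} {C : Set ZFSet.{u}}
    (hM : IsElemSub M C) (ht : TransClass C) (hk : ∀ x ∈ k, x ∈ M) (hh : h ∈ M) :
    ZFSet.IsFunc k M h := by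
  constructor
  · intro p hp
    obtain ⟨x, hx, y, hy, rfl⟩ := hf.1 p hp
    refine ZFSet.pair_mem_prod.2 ⟨hx, ?_⟩
    obtain ⟨w, hw, hu⟩ := hf.2 x hx
    refine hM.mem_of_unique ht (P := fun _ v => ZFSet.pair (v 1) (v 0) ∈ v 2)
      (v := x .: fun _ => h) (Dfn.pair_mem _ _ _) (by rintro (_ | i); exacts [hk x hx, hh])
      ?_ hy fun z _ hz => (hu z hz).trans (hu y hy).symm
    exact ht _ (ht _ (ht _ (hM.subset hh) _ hy) {x, y} (by simp [ZFSet.pair])) _ (by simp)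
  · intro x hx
    obtain ⟨w, hw, hu⟩ := hf.2 x hx
    exact ⟨w, hw, hu⟩

/-! ### Functions in `M` modulo an `M`-normal filter -/

section InnerFun

variable {κ θ : Cardinal.{u}} {M F : ZFSet.{u}}

/-- The value of a function at `ξ`. -/
def ev (f : InnerFun κ M) (ξ : ZFSet.{u}) : ZFSet.{u} :=
  open Classical in if h : ∃ y, ZFSet.pair ξ y ∈ f.1 then h.choose else ∅

theorem pair_ev_mem (f : InnerFun κ M) {ξ : ZFSet.{u}} (hξ : ξ ∈ asSet κ) :
    ZFSet.pair ξ (ev f ξ) ∈ f.1 := by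
  have h := (f.2.2.2 ξ hξ).exists
  unfold ev
  rw [dif_pos h]
  exact h.choose_spec

theorem eq_ev (f : InnerFun κ M) {ξ y : ZFSet.{u}} (h : ZFSet.pair ξ y ∈ f.1) : y = ev f ξ :=
  isFunc_eq f.2.2 h (pair_ev_mem f (isFunc_pair_mem f.2.2 h).1)

theorem ev_mem (f : InnerFun κ M) {ξ : ZFSet.{u}} (hξ : ξ ∈ asSet κ) : ev f ξ ∈ M :=
  (isFunc_pair_mem f.2.2 (pair_ev_mem f hξ)).2

theorem sep_congr {a : ZFSet.{u}} {p q : ZFSet.{u} → Prop} (h : ∀ x ∈ a, p x ↔ q x) :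
    a.sep p = a.sep q := by
  ext x
  rw [ZFSet.mem_sep, ZFSet.mem_sep]
  exact and_congr_right (h x)

theorem eqSet_eq (f g : InnerFun κ M) :
    eqSet κ f g = (asSet κ).sep (fun ξ => ev f ξ = ev g ξ) :=
  sep_congr fun ξ hξ =>
    ⟨fun ⟨_, _, hx, hy, h⟩ => by rw [← eq_ev f hx, ← eq_ev g hy, h],
      fun h => ⟨_, _, pair_ev_mem f hξ, pair_ev_mem g hξ, h⟩⟩

theorem memSet_eq (f g : InnerFun κ M) :
    memSet κ f g = (asSet κ).sep (fun ξ => ev f ξ ∈ ev g ξ) :=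
  sep_congr fun ξ hξ =>
    ⟨fun ⟨_, _, hx, hy, h⟩ => by rwa [← eq_ev f hx, ← eq_ev g hy],
      fun h => ⟨_, _, pair_ev_mem f hξ, pair_ev_mem g hξ, h⟩⟩

/-- Needed to form the collapse of the ultrapower as a set. -/
instance : Small.{u} (InnerFun κ M) :=
  small_of_injective (β := M) (f := fun f => ⟨f.1, f.2.1⟩)
    fun _ _ h => Subtype.ext (Subtype.mk.inj h)

/-- The assumptions under which the ultrapower of `M` by `F` is considered. -/
structure UltraSetup (κ θ : Cardinal.{u}) (M F : ZFSet.{u}) : Prop where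
  reg : κ.IsRegular
  lt : κ < θ
  elem : IsElemSub M (H θ)
  mem : asSet κ ∈ M
  sub : ∀ x ∈ asSet κ, x ∈ M
  normal : IsNormalFor κ M F

namespace UltraSetup

variable (S : UltraSetup κ θ M F)

include S

theorem le : ℵ₀ ≤ θ := S.reg.aleph0_le.trans S.lt.le

/-- A definable relation on `κ` has a choice function in `M`. -/
theorem exists_fun {R : Set ZFSet.{u} → (ℕ → ZFSet.{u}) → Prop} (hR : Dfn {H θ} R)
    {v : ℕ → ZFSet.{u}} (hv : ∀ i, v i ∈ M) :
    ∃ h : InnerFun κ M, ∀ ξ ∈ asSet κ, (∃ y ∈ H θ, R (H θ) (ξ .: y .: v)) →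
      R (H θ) (ξ .: ev h ξ .: v) := by
  obtain ⟨h, hM, hfn, hh⟩ := S.elem.exists_mem (transClass_H θ) (v := asSet κ .: v)
    (P := fun C w => IsFn (w 1) (w 0) ∧ ∀ ξ ∈ w 1, ∀ y, ZFSet.pair ξ y ∈ w 0 →
      (∃ z ∈ C, R C (ξ .: z .: fun i => w (i + 2))) → R C (ξ .: y .: fun i => w (i + 2)))
    ((Dfn.isFn _ _).and (Dfn.ball (Dfn.allPair ((Dfn.ex (hR.rename₂ 2 0 5)).imp
      (hR.rename₂ 1 0 4))))) (by rintro (_ | i); exacts [S.mem, hv i]) (by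
      classical
      -- A choice function in `H θ`, with the harmless default value `ξ`. Being such a function is
      -- definable, so `M` contains one as well.
      let f : ZFSet.{u} → ZFSet.{u} := fun ξ =>
        if h : ∃ y ∈ H θ, R (H θ) (ξ .: y .: v) then h.choose else ξ
      have hf : ∀ ξ ∈ asSet κ, f ξ ∈ H θ := by
        intro ξ hξ
        simp only [f]
        split_ifs with h
        exacts [h.choose_spec.1, S.elem.subset (S.sub ξ hξ)]
      have hpair : ∀ x y, ZFSet.pair x y ∈
          ZFSet.range (fun ξ : asSet κ => ZFSet.pair ξ (f ξ)) ↔ x ∈ asSet κ ∧ y = f x := by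
        intro x y
        rw [ZFSet.mem_range]
        constructor
        · rintro ⟨ξ, hξ⟩
          obtain ⟨rfl, rfl⟩ := ZFSet.pair_injective hξ
          exact ⟨ξ.2, rfl⟩
        · rintro ⟨hx, rfl⟩
          exact ⟨⟨x, hx⟩, rfl⟩
      have hκH := mem_H_iff.1 (S.elem.subset S.mem)
      refine ⟨ZFSet.range (fun ξ : asSet κ => ZFSet.pair ξ (f ξ)), mem_H_iff.2 ⟨?_, ?_⟩,
        ⟨?_, ?_⟩, ?_⟩
      · refine (card_le_card (y := asSet κ) (fun ξ => ZFSet.pair ξ (f ξ)) fun z hz => ?_).trans_lt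
          hκH.1
        obtain ⟨x, rfl⟩ := ZFSet.mem_range.1 hz
        exact ⟨x, x.2, rfl⟩
      · intro z hz
        obtain ⟨x, rfl⟩ := ZFSet.mem_range.1 hz
        exact pair_mem_H S.le (hκH.2 _ x.2) (hf _ x.2)
      · intro p hp
        obtain ⟨ξ, rfl⟩ := ZFSet.mem_range.1 hp
        exact ⟨ξ, ξ.2, f ξ, hp, rfl⟩
      · intro x hx
        exact ⟨f x, (hpair _ _).2 ⟨hx, rfl⟩, fun z hz => ((hpair _ _).1 hz).2⟩
      · intro ξ hξ y hy hex
        have hy' := ((hpair _ _).1 hy).2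
        have hex' : ∃ y ∈ H θ, R (H θ) (ξ .: y .: v) := hex
        have hfξ : f ξ = hex'.choose := dif_pos hex'
        rw [hy', hfξ]
        exact hex'.choose_spec.2)
  have hfun : ZFSet.IsFunc (asSet κ) M h := hfn.isFunc S.elem (transClass_H θ) S.sub hM
  exact ⟨⟨h, hM, hfun⟩, fun ξ hξ hex => hh ξ hξ _ (pair_ev_mem ⟨h, hM, hfun⟩ hξ) hex⟩

/-- The constant function with value `x`. -/
theorem exists_const {x : ZFSet.{u}} (hx : x ∈ M) :
    ∃ h : InnerFun κ M, ∀ ξ ∈ asSet κ, ev h ξ = x := by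
  obtain ⟨h, hh⟩ := S.exists_fun (R := fun _ v => v 1 = v 2) (v := fun _ => x) (Dfn.eq _ _)
    (fun _ => hx)
  exact ⟨h, fun ξ hξ => hh ξ hξ ⟨x, S.elem.subset hx, rfl⟩⟩

theorem exists_id : ∃ h : InnerFun κ M, ∀ ξ ∈ asSet κ, ev h ξ = ξ := by
  obtain ⟨h, hh⟩ := S.exists_fun (R := fun _ v => v 1 = v 0) (v := fun _ => asSet κ) (Dfn.eq _ _)
    (fun _ => S.mem)
  exact ⟨h, fun ξ hξ => hh ξ hξ ⟨ξ, S.elem.subset (S.sub ξ hξ), rfl⟩⟩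

/-- Separation at the values of functions from `M`. Truth is evaluated in `H θ`, over which it is
definable by `φ` itself, so no truth predicate is involved. -/
theorem sep_sat_mem {m : ℕ} (φ : setL.Formula (Fin m)) (f : Fin m → InnerFun κ M) :
    (asSet κ).sep (fun ξ => Sat (H θ) φ (fun b => ev (f b) ξ)) ∈ M := by
  have h := S.elem.sep_mem (v := extend (fun b => (f b).1) (asSet κ))
    (Dfn.satValues (m := m) φ (fun b => b) (fun b => b + 1))
    (extend_mem (fun i => (f i).2.1) S.mem) S.mem
  rw [show (asSet κ).sep _ = (asSet κ).sep _ from ?_]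
  · exact h
  · refine sep_congr fun ξ hξ => ?_
    have he : ∀ b : Fin m, (ξ .: extend (fun b => (f b).1) (asSet κ)) (b + 1) = (f b).1 :=
      fun b => congrFun (extend_fin (fun b => (f b).1) (asSet κ)) b
    constructor
    · intro hs
      refine ⟨fun b => ev (f b) ξ, hs.1, fun b => ?_, by simpa using hs⟩
      rw [he]
      exact pair_ev_mem (f b) hξ
    · rintro ⟨y, -, hy, hs⟩
      rw [show (fun b => ev (f b) ξ) = y from funext fun b => ?_]
      · simpa using hs
      · have := hy b
        rw [he] at this
        exact (eq_ev _ this).symm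

theorem eqSet_mem (f g : InnerFun κ M) : (asSet κ).sep (fun ξ => ev f ξ = ev g ξ) ∈ M := by
  have h := S.elem.sep_mem (v := f.1 .: fun _ => g.1) (a := asSet κ)
    (P := fun _ v => ∃ y, ZFSet.pair (v 0) y ∈ v 1 ∧ ZFSet.pair (v 0) y ∈ v 2)
    (Dfn.exPair (Dfn.pair_mem _ _ _)) (by rintro (_ | i); exacts [f.2.1, g.2.1]) S.mem
  rw [show (asSet κ).sep _ = (asSet κ).sep _ from ?_]
  · exact h
  · refine sep_congr fun ξ hξ => ⟨fun h => ⟨_, pair_ev_mem f hξ, h ▸ pair_ev_mem g hξ⟩, ?_⟩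
    rintro ⟨y, h1, h2⟩
    exact (eq_ev f h1).symm.trans (eq_ev g h2)

theorem memSet_mem (f g : InnerFun κ M) : (asSet κ).sep (fun ξ => ev f ξ ∈ ev g ξ) ∈ M := by
  have h := S.elem.sep_mem (v := f.1 .: fun _ => g.1) (a := asSet κ)
    (P := fun _ v => ∃ y, ZFSet.pair (v 0) y ∈ v 1 ∧ ∃ z, ZFSet.pair (v 0) z ∈ v 2 ∧ y ∈ z)
    (Dfn.exPair (Dfn.exPair (Dfn.mem _ _))) (by rintro (_ | i); exacts [f.2.1, g.2.1]) S.mem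
  rw [show (asSet κ).sep _ = (asSet κ).sep _ from ?_]
  · exact h
  · refine sep_congr fun ξ hξ =>
      ⟨fun h => ⟨_, pair_ev_mem f hξ, _, pair_ev_mem g hξ, h⟩, ?_⟩
    rintro ⟨y, h1, z, h2, h⟩
    exact eq_ev f h1 ▸ eq_ev g h2 ▸ h

theorem compl_mem {A : ZFSet.{u}} (hA : A ∈ M) : asSet κ \ A ∈ M := by
  have h := S.elem.sep_mem (v := fun _ => A) (a := asSet κ)
    (P := fun _ v => v 0 ∉ v 1) (Dfn.mem _ _).not (fun _ => hA) S.mem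
  rw [← ZFSet.sep_notMem]
  exact h

theorem sep_not_mem {p : ZFSet.{u} → Prop} (hp : (asSet κ).sep p ∈ M) :
    (asSet κ).sep (fun ξ => ¬ p ξ) ∈ M := by
  rw [show (asSet κ).sep (fun ξ => ¬ p ξ) = asSet κ \ (asSet κ).sep p from ?_]
  · exact S.compl_mem hp
  · ext x
    simp only [ZFSet.mem_sep, ZFSet.mem_sdiff]
    tauto

/-- The intersection has size `κ` and cannot be contained in `α + 1`. With `α = ∅` this is the
statement that two elements of `F` meet. -/
theorem exists_gt {A B : ZFSet.{u}} (hA : A ∈ F) (hB : B ∈ F) {α : ZFSet.{u}}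
    (hα : α ∈ asSet κ) : ∃ ξ ∈ asSet κ, ξ ∈ A ∧ ξ ∈ B ∧ α ∈ ξ := by
  obtain ⟨a, ha, rfl⟩ := Ordinal.mem_toZFSet_iff.1 hα
  have h := S.normal.filter.card_inter 2 ![A, B] (by
    intro i
    fin_cases i
    exacts [hA, hB])
  by_contra hn
  push Not at hn
  have hsub : (asSet κ).sep (fun ξ => ∀ i, ξ ∈ ![A, B] i) ⊆ (a + 1).toZFSet := by
    intro ξ hξ
    rw [ZFSet.mem_sep] at hξ
    have h1 := hn ξ hξ.1 (hξ.2 0) (hξ.2 1)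
    obtain ⟨b, hb, rfl⟩ := Ordinal.mem_toZFSet_iff.1 hξ.1
    rw [Ordinal.toZFSet_mem_toZFSet_iff, not_lt] at h1
    exact Ordinal.toZFSet_mem_toZFSet_iff.2 (Order.lt_add_one_iff.2 h1)
  have h2 := ZFSet.card_mono hsub
  rw [h, Ordinal.card_toZFSet] at h2
  have h3 : a + 1 < κ.ord := (Cardinal.isSuccLimit_ord S.reg.aleph0_le).succ_lt ha
  exact (Cardinal.lt_ord.1 h3).not_ge h2

theorem zero_mem : (∅ : ZFSet.{u}) ∈ asSet κ := by
  rw [← Ordinal.toZFSet_zero]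
  exact Ordinal.toZFSet_mem_toZFSet_iff.2 S.reg.ord_pos

/-- A filter in the present sense is neither upward closed nor closed under intersections by
definition. For sets in `M` both follow: `F` measures the set, and its complement would have empty
intersection with `A` and `B`. -/
theorem big_of_imp₂ {A B : ZFSet.{u}} (hA : A ∈ F) (hB : B ∈ F) {p : ZFSet.{u} → Prop}
    (hp : (asSet κ).sep p ∈ M) (h : ∀ ξ ∈ asSet κ, ξ ∈ A → ξ ∈ B → p ξ) :
    (asSet κ).sep p ∈ F := by
  refine (S.normal.measures _ hp ZFSet.sep_subset).resolve_right fun hc => ?_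
  have h3 := S.normal.filter.card_inter 3 ![A, B, asSet κ \ (asSet κ).sep p] (by
    intro i
    fin_cases i
    exacts [hA, hB, hc])
  rw [show (asSet κ).sep (fun ξ => ∀ i, ξ ∈ ![A, B, asSet κ \ (asSet κ).sep p] i) = ∅ from ?_,
    ZFSet.card_empty] at h3
  · exact S.reg.ne_zero h3.symm
  · rw [ZFSet.eq_empty]
    intro ξ hξ
    rw [ZFSet.mem_sep] at hξ
    have h4 : ξ ∈ asSet κ \ (asSet κ).sep p := hξ.2 2
    rw [ZFSet.mem_sdiff, ZFSet.mem_sep] at h4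
    exact h4.2 ⟨hξ.1, h ξ hξ.1 (hξ.2 0) (hξ.2 1)⟩

theorem big_of_imp {A : ZFSet.{u}} (hA : A ∈ F) {p : ZFSet.{u} → Prop}
    (hp : (asSet κ).sep p ∈ M) (h : ∀ ξ ∈ asSet κ, ξ ∈ A → p ξ) : (asSet κ).sep p ∈ F :=
  S.big_of_imp₂ hA hA hp fun ξ hξ hξA _ => h ξ hξ hξA

theorem big_not {p : ZFSet.{u} → Prop} (hp : (asSet κ).sep p ∈ M) :
    (asSet κ).sep (fun ξ => ¬ p ξ) ∈ F ↔ (asSet κ).sep p ∉ F := by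
  constructor
  · intro h1 h2
    obtain ⟨ξ, _, h3, h4, _⟩ := S.exists_gt h1 h2 S.zero_mem
    exact (ZFSet.mem_sep.1 h3).2 (ZFSet.mem_sep.1 h4).2
  · intro h
    refine S.big_of_imp ((S.normal.measures _ hp ZFSet.sep_subset).resolve_left h)
      (S.sep_not_mem hp) fun ξ hξ h1 hpξ => ?_
    exact (ZFSet.mem_sdiff.1 h1).2 (ZFSet.mem_sep.2 ⟨hξ, hpξ⟩)

theorem big_true {p : ZFSet.{u} → Prop} (h : ∀ ξ ∈ asSet κ, p ξ) : (asSet κ).sep p ∈ F := by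
  rw [show (asSet κ).sep p = asSet κ from ?_]
  · refine (S.normal.measures _ S.mem fun _ h => h).resolve_right fun hc => ?_
    obtain ⟨ξ, h1, h2, -⟩ := S.exists_gt hc hc S.zero_mem
    exact (ZFSet.mem_sdiff.1 h2).2 h1
  · ext ξ
    rw [ZFSet.mem_sep]
    exact ⟨And.left, fun hξ => ⟨hξ, h ξ hξ⟩⟩

theorem big_false {p : ZFSet.{u} → Prop} (h : ∀ ξ ∈ asSet κ, ¬ p ξ) : (asSet κ).sep p ∉ F := by
  intro hF
  obtain ⟨ξ, h1, h2, -⟩ := S.exists_gt hF hF S.zero_mem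
  exact h ξ h1 (ZFSet.mem_sep.1 h2).2

/-- A regressive function in `M` is constant on a set in `F`. -/
theorem exists_const_of_regressive {g : InnerFun κ M} {A : ZFSet.{u}} (hA : A ∈ F)
    (h : ∀ ξ ∈ asSet κ, ξ ∈ A → ev g ξ ∈ ξ) :
    ∃ β ∈ asSet κ, (asSet κ).sep (fun ξ => ev g ξ = β) ∈ F := by
  by_contra hn
  push Not at hn
  have hM : ∀ β ∈ asSet κ, (asSet κ).sep (fun ξ => ev g ξ = β) ∈ M := by
    intro β hβ
    obtain ⟨c, hc⟩ := S.exists_const (S.sub β hβ)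
    rw [sep_congr (q := fun ξ => ev g ξ = ev c ξ) fun ξ hξ => by rw [hc ξ hξ] ]
    exact S.eqSet_mem g c
  -- The sequence of the sets `X_β = {ξ | g(ξ) ≠ β}`, all of which are in `F` if the claim fails.
  obtain ⟨X, hX⟩ := S.exists_fun (v := g.1 .: fun _ => asSet κ)
    (R := fun _ v => v 1 ⊆ v 3 ∧ ∀ ξ ∈ v 3, ξ ∈ v 1 ↔ ZFSet.pair ξ (v 0) ∉ v 2)
    ((Dfn.subset _ _).and (Dfn.ball ((Dfn.mem _ _).iff (Dfn.pair_mem _ _ _).not)))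
    (by rintro (_ | i); exacts [g.2.1, S.mem])
  have hXβ : ∀ β ∈ asSet κ, ev X β = (asSet κ).sep (fun ξ => ¬ ev g ξ = β) := by
    intro β hβ
    have hN : ∀ ξ ∈ asSet κ, (ZFSet.pair ξ β ∉ g.1 ↔ ¬ ev g ξ = β) := fun ξ hξ =>
      not_congr ⟨fun h => (eq_ev g h).symm, fun h => h ▸ pair_ev_mem g hξ⟩
    have hsub : (asSet κ).sep (fun ξ => ¬ ev g ξ = β) ⊆ asSet κ := ZFSet.sep_subset
    obtain ⟨h1, h2⟩ := hX β hβ ⟨(asSet κ).sep (fun ξ => ¬ ev g ξ = β),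
      S.elem.subset (S.sep_not_mem (hM β hβ)), hsub, fun ξ (hξ : ξ ∈ asSet κ) => by
        change ξ ∈ (asSet κ).sep (fun ξ => ¬ ev g ξ = β) ↔ ZFSet.pair ξ β ∉ g.1
        rw [ZFSet.mem_sep]
        exact (and_iff_right hξ).trans (hN ξ hξ).symm⟩
    have h1' : ev X β ⊆ asSet κ := h1
    have h2' : ∀ ξ ∈ asSet κ, (ξ ∈ ev X β ↔ ZFSet.pair ξ β ∉ g.1) := h2
    ext ξ
    rw [ZFSet.mem_sep]
    exact ⟨fun hξ => ⟨h1' hξ, (hN ξ (h1' hξ)).1 ((h2' ξ (h1' hξ)).1 hξ)⟩,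
      fun hξ => (h2' ξ hξ.1).2 ((hN ξ hξ.1).2 hξ.2)⟩
  have hXF : ZFSet.IsFunc (asSet κ) F X.1 := by
    refine ⟨fun p hp => ?_, X.2.2.2⟩
    obtain ⟨β, hβ, A, -, rfl⟩ := ZFSet.mem_prod.1 (X.2.2.1 hp)
    refine ZFSet.pair_mem_prod.2 ⟨hβ, ?_⟩
    rw [eq_ev X hp, hXβ β hβ]
    exact (S.big_not (hM β hβ)).2 (hn β hβ)
  -- For `ξ` in the diagonal intersection, `g(ξ) ∈ ξ` yields `ξ ∈ X_{g(ξ)}`, that is, `g(ξ) ≠ g(ξ)`.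
  obtain ⟨ξ, hξ, h1, h2, -⟩ := S.exists_gt hA (S.normal.diag _ X.2.1 hXF) S.zero_mem
  have h3 := h ξ hξ h1
  have h4 : ev g ξ ∈ asSet κ :=
    (ZFSet.isOrdinal_toZFSet κ.ord).mem_trans h3 hξ
  have h5 := (ZFSet.mem_sep.1 h2).2 _ h3 _ (pair_ev_mem X h4)
  rw [hXβ _ h4] at h5
  exact (ZFSet.mem_sep.1 h5).2 rfl

end UltraSetup

end InnerFun

/-! ### The ultrapower and its transitive collapse -/

/-- A formula with bound variables only, as a formula with free variables. -/
def toFin {n : ℕ} (φ : setL.BoundedFormula Empty n) : setL.Formula (Fin n) :=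
  φ.toFormula.relabel (Sum.elim Empty.elim id)

theorem realize_toFin {D : Type*} [setL.Structure D] {n : ℕ} (φ : setL.BoundedFormula Empty n)
    (w : Fin n → D) : (toFin φ).Realize w ↔ φ.Realize default w := by
  unfold toFin
  rw [Language.Formula.realize_relabel, Language.BoundedFormula.realize_toFormula]
  exact iff_of_eq (congrArg₂ _ (Subsingleton.elim _ _) rfl)

theorem term_eq_var {n : ℕ} (t : setL.Term (Empty ⊕ Fin n)) :
    ∃ k, t = Language.Term.var (Sum.inr k) := by
  cases t with
  | var i =>
    rcases i with i | k
    · exact i.elim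
    · exact ⟨k, rfl⟩
  | func f _ => exact Empty.elim f

section InnerFun

variable {κ θ : Cardinal.{u}} {M F : ZFSet.{u}}

theorem sat_toFin_iff {C : Set ZFSet.{u}} {n : ℕ} (φ : setL.BoundedFormula Empty n)
    {w : Fin n → ZFSet.{u}} (hw : ∀ k, w k ∈ C) :
    Sat C (toFin φ) w ↔ φ.Realize default (fun k => (⟨w k, hw k⟩ : C)) := by
  rw [← realize_toFin]
  exact ⟨fun h => h.2, fun h => ⟨hw, h⟩⟩

theorem sat_all_iff {C : Set ZFSet.{u}} {n : ℕ} (φ : setL.BoundedFormula Empty (n + 1))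
    {w : Fin n → ZFSet.{u}} (hw : ∀ k, w k ∈ C) :
    Sat C (toFin φ.all) w ↔
      ∀ x ∈ C, Sat C (toFin φ) (Fin.snoc w x : Fin (n + 1) → ZFSet.{u}) := by
  rw [sat_toFin_iff _ hw, Language.BoundedFormula.realize_all]
  have hs : ∀ (x : C) k, (Fin.snoc w (x : ZFSet.{u}) : Fin (n + 1) → ZFSet.{u}) k =
      ((Fin.snoc (fun k => (⟨w k, hw k⟩ : C)) x : Fin (n + 1) → C) k : ZFSet.{u}) := by
    intro x k
    refine Fin.lastCases ?_ (fun k => ?_) k <;> simp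
  have key : ∀ x : C, Sat C (toFin φ) (Fin.snoc w (x : ZFSet.{u}) : Fin (n + 1) → ZFSet.{u}) ↔
      φ.Realize default (Fin.snoc (fun k => (⟨w k, hw k⟩ : C)) x : Fin (n + 1) → C) := by
    intro x
    rw [sat_toFin_iff φ (fun k => by rw [hs]; exact Subtype.coe_prop _)]
    simp only [hs]
  exact ⟨fun h x hx => (key ⟨x, hx⟩).2 (h _), fun h x => (key x).1 (h x x.2)⟩

/-- The membership relation between functions. -/
def InnerMem (F : ZFSet.{u}) (f g : InnerFun κ M) : Prop := memSet κ f g ∈ F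

theorem wf_innerMem (h : WellFoundedUltrapower κ M F) :
    WellFounded (InnerMem F : InnerFun κ M → InnerFun κ M → Prop) :=
  Subrelation.wf (r := InvImage Ultrapower.Mem (Quot.mk _))
    (fun {f g} hfg => ⟨f, g, rfl, rfl, hfg⟩) (InvImage.wf _ h)

/-- The transitive collapse of the ultrapower. -/
def collapse (h : WellFoundedUltrapower κ M F) : InnerFun κ M → ZFSet.{u} :=
  (wf_innerMem h).fix fun f ih =>
    ZFSet.range (fun g : {g : InnerFun κ M // InnerMem F g f} => ih g g.2)

theorem mem_collapse {h : WellFoundedUltrapower κ M F} {f : InnerFun κ M} {x : ZFSet.{u}} :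
    x ∈ collapse h f ↔ ∃ g, memSet κ g f ∈ F ∧ collapse h g = x := by
  unfold collapse
  rw [(wf_innerMem h).fix_eq, ZFSet.mem_range]
  exact ⟨fun ⟨g, hg⟩ => ⟨g, g.2, hg⟩, fun ⟨g, hg, hx⟩ => ⟨⟨g, hg⟩, hx⟩⟩

namespace UltraSetup

variable (S : UltraSetup κ θ M F)

include S

/-- The collapse is defined on representatives, so its independence of the representative has to be
checked. -/
theorem collapse_eq_of {h : WellFoundedUltrapower κ M F} {f g : InnerFun κ M}
    (hfg : (asSet κ).sep (fun ξ => ev f ξ = ev g ξ) ∈ F) : collapse h f = collapse h g := by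
  ext x
  simp only [mem_collapse, memSet_eq]
  constructor <;> rintro ⟨a, ha, rfl⟩ <;> refine ⟨a, ?_, rfl⟩ <;>
    refine S.big_of_imp₂ hfg ha (S.memSet_mem _ _) fun ξ _ h1 h2 => ?_ <;>
    rw [ZFSet.mem_sep] at h1 h2
  · rw [← h1.2]
    exact h2.2
  · rw [h1.2]
    exact h2.2

/-- Extensionality of the ultrapower: if `f` and `g` differ on a large set, a function in `M`
selects elements of the symmetric differences, and it represents an element of exactly one of the
two. -/
theorem eq_of_collapse_eq {h : WellFoundedUltrapower κ M F} (f g : InnerFun κ M)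
    (hfg : collapse h f = collapse h g) : (asSet κ).sep (fun ξ => ev f ξ = ev g ξ) ∈ F := by
  induction f using (wf_innerMem h).induction generalizing g with
  | _ f ih =>
    by_contra hn
    rw [← S.big_not (S.eqSet_mem f g)] at hn
    -- The value `d(ξ)` separates `f(ξ)` from `g(ξ)` wherever they differ.
    obtain ⟨d, hd⟩ := S.exists_fun (v := f.1 .: fun _ => g.1)
      (R := fun _ v => ∃ a, ZFSet.pair (v 0) a ∈ v 2 ∧ ∃ b, ZFSet.pair (v 0) b ∈ v 3 ∧
        ¬ (v 1 ∈ a ↔ v 1 ∈ b))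
      (Dfn.exPair (Dfn.exPair ((Dfn.mem _ _).iff (Dfn.mem _ _)).not))
      (by rintro (_ | i); exacts [f.2.1, g.2.1])
    have hd' : ∀ ξ ∈ asSet κ, ev f ξ ≠ ev g ξ → ¬ (ev d ξ ∈ ev f ξ ↔ ev d ξ ∈ ev g ξ) := by
      intro ξ hξ hne
      obtain ⟨a, ha, b, hb, hab⟩ := hd ξ hξ (by
        by_contra hn
        refine hne (ZFSet.ext fun z => ?_)
        by_cases hz : z ∈ H θ
        · by_contra hc
          exact hn ⟨z, hz, _, pair_ev_mem f hξ, _, pair_ev_mem g hξ, hc⟩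
        · exact iff_of_false
            (fun h' => hz (transClass_H θ _ (S.elem.subset (ev_mem f hξ)) _ h'))
            (fun h' => hz (transClass_H θ _ (S.elem.subset (ev_mem g hξ)) _ h')))
      rwa [eq_ev f ha, eq_ev g hb] at hab
    by_cases hdf : (asSet κ).sep (fun ξ => ev d ξ ∈ ev f ξ) ∈ F
    · have h1 : collapse h d ∈ collapse h g := by
        rw [← hfg, mem_collapse]
        exact ⟨d, by rwa [memSet_eq], rfl⟩
      obtain ⟨d', hd'g, hdd⟩ := mem_collapse.1 h1
      rw [memSet_eq] at hd'g
      have h2 := ih d (show memSet κ d f ∈ F by rwa [memSet_eq]) d' hdd.symm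
      have h3 : (asSet κ).sep (fun ξ => ev d ξ ∈ ev g ξ) ∈ F := by
        refine S.big_of_imp₂ h2 hd'g (S.memSet_mem _ _) fun ξ _ h4 h5 => ?_
        rw [(ZFSet.mem_sep.1 h4).2]
        exact (ZFSet.mem_sep.1 h5).2
      have h4 : (asSet κ).sep (fun ξ => ev d ξ ∈ ev f ξ ∧ ev d ξ ∈ ev g ξ) ∉ F := by
        intro h4
        obtain ⟨ξ, hξ, h5, h6, -⟩ := S.exists_gt h4 hn S.zero_mem
        have := (ZFSet.mem_sep.1 h5).2
        exact hd' ξ hξ (ZFSet.mem_sep.1 h6).2 (iff_of_true this.1 this.2)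
      have h5 := S.big_of_imp₂ h3 hn (p := fun ξ => ¬ ev d ξ ∈ ev f ξ)
        (S.sep_not_mem (S.memSet_mem _ _)) fun ξ hξ h6 h7 h8 =>
          hd' ξ hξ (ZFSet.mem_sep.1 h7).2 (iff_of_true h8 (ZFSet.mem_sep.1 h6).2)
      exact (S.big_not (S.memSet_mem _ _)).1 h5 hdf
    · rw [← S.big_not (S.memSet_mem _ _)] at hdf
      have h3 : (asSet κ).sep (fun ξ => ev d ξ ∈ ev g ξ) ∈ F := by
        refine S.big_of_imp₂ hdf hn (S.memSet_mem _ _) fun ξ hξ h4 h5 => ?_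
        by_contra hc
        exact hd' ξ hξ (ZFSet.mem_sep.1 h5).2 (iff_of_false (ZFSet.mem_sep.1 h4).2 hc)
      have h1 : collapse h d ∈ collapse h f := by
        rw [hfg, mem_collapse]
        exact ⟨d, by rwa [memSet_eq], rfl⟩
      obtain ⟨d', hd'f, hdd⟩ := mem_collapse.1 h1
      -- Now `d` lies below `g` and not below `f`, so the induction hypothesis is applied to the
      -- function `d'` below `f` with the same collapse.
      have h2 := ih d' hd'f d hdd
      rw [memSet_eq] at hd'f
      obtain ⟨ξ, hξ, h4, h5, -⟩ := S.exists_gt (S.big_of_imp₂ h2 hd'f (S.memSet_mem d f)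
        fun ξ _ h4 h5 => by
          rw [← (ZFSet.mem_sep.1 h4).2]
          exact (ZFSet.mem_sep.1 h5).2) hdf S.zero_mem
      exact (ZFSet.mem_sep.1 h5).2 (ZFSet.mem_sep.1 h4).2

theorem collapse_eq_iff {h : WellFoundedUltrapower κ M F} {f g : InnerFun κ M} :
    collapse h f = collapse h g ↔ (asSet κ).sep (fun ξ => ev f ξ = ev g ξ) ∈ F :=
  ⟨S.eq_of_collapse_eq f g, S.collapse_eq_of⟩

theorem collapse_mem_iff {h : WellFoundedUltrapower κ M F} {f g : InnerFun κ M} :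
    collapse h f ∈ collapse h g ↔ (asSet κ).sep (fun ξ => ev f ξ ∈ ev g ξ) ∈ F := by
  rw [mem_collapse]
  constructor
  · rintro ⟨d, hd, hdf⟩
    rw [memSet_eq] at hd
    refine S.big_of_imp₂ (S.eq_of_collapse_eq _ _ hdf) hd (S.memSet_mem _ _) fun ξ _ h1 h2 => ?_
    rw [← (ZFSet.mem_sep.1 h1).2]
    exact (ZFSet.mem_sep.1 h2).2
  · intro hfg
    exact ⟨f, by rwa [memSet_eq], rfl⟩

theorem ev_mem_H (f : InnerFun κ M) {ξ : ZFSet.{u}} (hξ : ξ ∈ asSet κ) : ev f ξ ∈ H θ :=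
  S.elem.subset (ev_mem f hξ)

/-- Łoś's theorem. -/
theorem los (h : WellFoundedUltrapower κ M F) {n : ℕ} (φ : setL.BoundedFormula Empty n)
    (f : Fin n → InnerFun κ M) :
    φ.Realize default (fun k => (⟨collapse h (f k), ZFSet.mem_range.2 ⟨f k, rfl⟩⟩ :
      ZFSet.range (collapse h))) ↔
    (asSet κ).sep (fun ξ => Sat (H θ) (toFin φ) (fun k => ev (f k) ξ)) ∈ F := by
  induction φ with
  | falsum =>
    refine iff_of_false (fun h => h) (S.big_false fun ξ hξ hs => ?_)
    exact (sat_toFin_iff _ fun k => S.ev_mem_H (f k) hξ).1 hs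
  | equal t₁ t₂ =>
    obtain ⟨k, rfl⟩ := term_eq_var t₁
    obtain ⟨l, rfl⟩ := term_eq_var t₂
    rw [sep_congr (q := fun ξ => ev (f k) ξ = ev (f l) ξ) fun ξ hξ => ?_]
    · rw [← S.collapse_eq_iff (h := h)]
      exact Subtype.ext_iff
    · rw [sat_toFin_iff _ fun k => S.ev_mem_H (f k) hξ]
      exact Subtype.ext_iff
  | rel r ts =>
    cases r
    obtain ⟨k, hk⟩ := term_eq_var (ts 0)
    obtain ⟨l, hl⟩ := term_eq_var (ts 1)
    have key : ∀ {p : ZFSet.{u} → Prop} (w : Fin _ → {x // p x}),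
        (Language.BoundedFormula.rel (L := setL) (n := _) SetRel.mem ts).Realize default w ↔
          (w k : ZFSet.{u}) ∈ (w l : ZFSet.{u}) := by
      intro p w
      change ((Language.Term.realize _ (ts 0) : {x // p x}) : ZFSet.{u}) ∈
        ((Language.Term.realize _ (ts 1) : {x // p x}) : ZFSet.{u}) ↔ _
      rw [hk, hl]
      rfl
    rw [sep_congr (q := fun ξ => ev (f k) ξ ∈ ev (f l) ξ) fun ξ hξ => ?_]
    · rw [← S.collapse_mem_iff (h := h)]
      exact key _
    · rw [sat_toFin_iff _ fun k => S.ev_mem_H (f k) hξ]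
      exact key _
  | imp φ ψ ihφ ihψ =>
    rw [Language.BoundedFormula.realize_imp, ihφ f, ihψ f]
    have hs : ∀ ξ ∈ asSet κ, (Sat (H θ) (toFin (φ.imp ψ)) (fun k => ev (f k) ξ) ↔
        (Sat (H θ) (toFin φ) (fun k => ev (f k) ξ) → Sat (H θ) (toFin ψ) (fun k => ev (f k) ξ))) := by
      intro ξ hξ
      have hw := fun k => S.ev_mem_H (f k) hξ
      rw [sat_toFin_iff _ hw, sat_toFin_iff _ hw, sat_toFin_iff _ hw,
        Language.BoundedFormula.realize_imp]
    constructor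
    · intro himp
      by_cases hφ : (asSet κ).sep (fun ξ => Sat (H θ) (toFin φ) (fun k => ev (f k) ξ)) ∈ F
      · exact S.big_of_imp (himp hφ) (S.sep_sat_mem _ _) fun ξ hξ h1 =>
          (hs ξ hξ).2 fun _ => (ZFSet.mem_sep.1 h1).2
      · rw [← S.big_not (S.sep_sat_mem _ _)] at hφ
        exact S.big_of_imp hφ (S.sep_sat_mem _ _) fun ξ hξ h1 =>
          (hs ξ hξ).2 fun h2 => absurd h2 (ZFSet.mem_sep.1 h1).2
    · intro himp hφ
      exact S.big_of_imp₂ himp hφ (S.sep_sat_mem _ _) fun ξ hξ h1 h2 =>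
        (hs ξ hξ).1 (ZFSet.mem_sep.1 h1).2 (ZFSet.mem_sep.1 h2).2
  | @all n φ ih =>
    rw [Language.BoundedFormula.realize_all]
    have hs : ∀ ξ ∈ asSet κ, (Sat (H θ) (toFin φ.all) (fun k => ev (f k) ξ) ↔ ∀ x ∈ H θ,
        Sat (H θ) (toFin φ) (Fin.snoc (fun k => ev (f k) ξ) x : Fin (n + 1) → ZFSet.{u})) :=
      fun ξ hξ => sat_all_iff φ fun k => S.ev_mem_H (f k) hξ
    have hsnoc : ∀ (g : InnerFun κ M) (ξ : ZFSet.{u}),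
        (fun k => ev ((Fin.snoc f g : Fin (n + 1) → InnerFun κ M) k) ξ) =
        (Fin.snoc (fun k => ev (f k) ξ) (ev g ξ) : Fin (n + 1) → ZFSet.{u}) := by
      intro g ξ
      funext k
      refine Fin.lastCases ?_ (fun k => ?_) k <;> simp
    have hall : (∀ a : ZFSet.range (collapse h), φ.Realize default (Fin.snoc
        (fun k => (⟨collapse h (f k), ZFSet.mem_range.2 ⟨f k, rfl⟩⟩ : ZFSet.range (collapse h))) a :
        Fin (n + 1) → ZFSet.range (collapse h))) ↔ ∀ g : InnerFun κ M,
        (asSet κ).sep (fun ξ => Sat (H θ) (toFin φ)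
          (Fin.snoc (fun k => ev (f k) ξ) (ev g ξ) : Fin (n + 1) → ZFSet.{u})) ∈ F := by
      have h1 : ∀ g : InnerFun κ M, (Fin.snoc
          (fun k => (⟨collapse h (f k), ZFSet.mem_range.2 ⟨f k, rfl⟩⟩ : ZFSet.range (collapse h)))
          ⟨collapse h g, ZFSet.mem_range.2 ⟨g, rfl⟩⟩ : Fin (n + 1) → ZFSet.range (collapse h)) =
          fun k => ⟨collapse h ((Fin.snoc f g : Fin (n + 1) → InnerFun κ M) k),
            ZFSet.mem_range.2 ⟨_, rfl⟩⟩ := by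
        intro g
        funext k
        refine Fin.lastCases ?_ (fun k => ?_) k <;> simp
      have h2 : ∀ g : InnerFun κ M, φ.Realize default (Fin.snoc
          (fun k => (⟨collapse h (f k), ZFSet.mem_range.2 ⟨f k, rfl⟩⟩ : ZFSet.range (collapse h)))
          ⟨collapse h g, ZFSet.mem_range.2 ⟨g, rfl⟩⟩ : Fin (n + 1) → ZFSet.range (collapse h)) ↔
          (asSet κ).sep (fun ξ => Sat (H θ) (toFin φ)
          (Fin.snoc (fun k => ev (f k) ξ) (ev g ξ) : Fin (n + 1) → ZFSet.{u})) ∈ F := by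
        intro g
        rw [h1, ih]
        simp only [hsnoc]
      constructor
      · intro ha g
        exact (h2 g).1 (ha _)
      · rintro ha ⟨a, ha'⟩
        obtain ⟨g, rfl⟩ := ZFSet.mem_range.1 ha'
        exact (h2 g).2 (ha g)
    have hM : ∀ g : InnerFun κ M, (asSet κ).sep (fun ξ => Sat (H θ) (toFin φ)
          (Fin.snoc (fun k => ev (f k) ξ) (ev g ξ) : Fin (n + 1) → ZFSet.{u})) ∈ M := by
      intro g
      have := S.sep_sat_mem (toFin φ) (Fin.snoc f g : Fin (n + 1) → InnerFun κ M)
      simpa only [hsnoc] using this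
    rw [hall]
    constructor
    · intro hg
      by_contra hn
      rw [← S.big_not (S.sep_sat_mem _ _)] at hn
      -- Otherwise a function `g ∈ M` chooses a counterexample at every `ξ` that has one, and the
      -- hypothesis fails for `g`. In `R`, variable 0 is `ξ` and variable 1 the counterexample; the
      -- index `n + 1` of the last argument becomes 1 after the `n` values are removed.
      obtain ⟨g, hgR⟩ := S.exists_fun (v := extend (fun b => (f b).1) (asSet κ))
        (R := fun C v => ¬ ∃ y : Fin n → ZFSet.{u}, (∀ b, y b ∈ C) ∧
          (∀ b : Fin n, ZFSet.pair (v 0) (y b) ∈ v ((b : ℕ) + 2)) ∧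
          Sat C (toFin φ) (fun b => if h : (Fin.snoc (fun i : Fin n => (i : ℕ)) (n + 1) :
            Fin (n + 1) → ℕ) b < n then y ⟨_, h⟩
            else v ((Fin.snoc (fun i : Fin n => (i : ℕ)) (n + 1) : Fin (n + 1) → ℕ) b - n)))
        (Dfn.satValues (toFin φ) _ _).not
        (extend_mem (fun i => (f i).2.1) S.mem)
      have hR : ∀ ξ ∈ asSet κ, ∀ x, (∃ y : Fin n → ZFSet.{u}, (∀ b, y b ∈ H θ) ∧
          (∀ b : Fin n, ZFSet.pair ξ (y b) ∈
            (ξ .: x .: extend (fun b => (f b).1) (asSet κ)) ((b : ℕ) + 2)) ∧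
          Sat (H θ) (toFin φ) (fun b => if h : (Fin.snoc (fun i : Fin n => (i : ℕ)) (n + 1) :
            Fin (n + 1) → ℕ) b < n then y ⟨_, h⟩
            else (ξ .: x .: extend (fun b => (f b).1) (asSet κ))
              ((Fin.snoc (fun i : Fin n => (i : ℕ)) (n + 1) : Fin (n + 1) → ℕ) b - n))) ↔
          Sat (H θ) (toFin φ)
            (Fin.snoc (fun k => ev (f k) ξ) x : Fin (n + 1) → ZFSet.{u}) := by
        intro ξ hξ x
        have he : ∀ b : Fin n, (ξ .: x .: extend (fun b => (f b).1) (asSet κ)) ((b : ℕ) + 2) =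
            (f b).1 := fun b => congrFun (extend_fin (fun b => (f b).1) (asSet κ)) b
        have hy : ∀ y : Fin n → ZFSet.{u},
            (fun b => if h : (Fin.snoc (fun i : Fin n => (i : ℕ)) (n + 1) :
              Fin (n + 1) → ℕ) b < n then y ⟨_, h⟩
              else (ξ .: x .: extend (fun b => (f b).1) (asSet κ))
                ((Fin.snoc (fun i : Fin n => (i : ℕ)) (n + 1) : Fin (n + 1) → ℕ) b - n)) =
            (Fin.snoc y x : Fin (n + 1) → ZFSet.{u}) := by
          intro y
          funext b
          refine Fin.lastCases ?_ (fun b => ?_) b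
          · simp [scons]
          · simp
        simp only [he, hy]
        constructor
        · rintro ⟨y, -, hyf, hs⟩
          rwa [show (fun k => ev (f k) ξ) = y from funext fun b => (eq_ev _ (hyf b)).symm]
        · intro hs
          exact ⟨_, fun b => S.ev_mem_H (f b) hξ, fun b => pair_ev_mem (f b) hξ, hs⟩
      obtain ⟨ξ, hξ, h1, h2, -⟩ := S.exists_gt hn (hg g) S.zero_mem
      have h3 := (ZFSet.mem_sep.1 h1).2
      rw [hs ξ hξ] at h3
      push Not at h3
      obtain ⟨x, hx, hnx⟩ := h3
      exact hgR ξ hξ ⟨x, hx, fun hc => hnx ((hR ξ hξ x).1 hc)⟩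
        ((hR ξ hξ _).2 (ZFSet.mem_sep.1 h2).2)
    · intro hF g
      exact S.big_of_imp hF (hM g) fun ξ hξ h1 =>
        (hs ξ hξ).1 (ZFSet.mem_sep.1 h1).2 _ (S.ev_mem_H g hξ)

end UltraSetup

end InnerFun

/-! ### The ultrapower embedding -/

section InnerFun

variable {κ θ : Cardinal.{u}} {M F : ZFSet.{u}}

theorem asSet_trans {ξ α : ZFSet.{u}} (hξ : ξ ∈ asSet κ) (hα : α ∈ ξ) : α ∈ asSet κ :=
  (ZFSet.isOrdinal_toZFSet κ.ord).mem_trans hα hξ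

theorem isTransitive_range_collapse (h : WellFoundedUltrapower κ M F) :
    (ZFSet.range (collapse h)).IsTransitive := by
  intro x hx y hy
  obtain ⟨f, rfl⟩ := ZFSet.mem_range.1 hx
  obtain ⟨g, -, rfl⟩ := mem_collapse.1 hy
  exact ZFSet.mem_range.2 ⟨g, rfl⟩

namespace UltraSetup

variable (S : UltraSetup κ θ M F)

include S

/-- The constant function with value `x`. -/
def constFun (x : M) : InnerFun κ M := (S.exists_const x.2).choose

theorem ev_constFun (x : M) {ξ : ZFSet.{u}} (hξ : ξ ∈ asSet κ) : ev (S.constFun x) ξ = x :=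
  (S.exists_const x.2).choose_spec ξ hξ

/-- The ultrapower embedding. -/
def embed (h : WellFoundedUltrapower κ M F) : M ↪ₑ[setL] ZFSet.range (collapse h) where
  toFun x := ⟨collapse h (S.constFun x), ZFSet.mem_range.2 ⟨_, rfl⟩⟩
  map_formula' n φ x := by
    set ψ : setL.BoundedFormula Empty n :=
      Language.BoundedFormula.relabel (n := n) (k := 0) (Sum.inr : Fin n → Empty ⊕ Fin n) φ with hψ
    have h1 := S.los h ψ (fun k => S.constFun (x k))
    have h2 : ∀ {D : Type (u + 1)} [setL.Structure D] (w : Fin n → D),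
        ψ.Realize default w ↔ φ.Realize w := by
      intro D _ w
      rw [hψ]
      rw [Language.BoundedFormula.realize_relabel]
      exact iff_of_eq (congrArg₂ _ rfl (Subsingleton.elim _ _))
    have h3 : ∀ ξ ∈ asSet κ, (Sat (H θ) (toFin ψ)
        (fun k => ev (S.constFun (x k)) ξ) ↔ φ.Realize x) := by
      intro ξ hξ
      rw [sat_toFin_iff _ fun k => S.ev_mem_H _ hξ, h2, S.elem.realize]
      simp only [S.ev_constFun _ hξ]
      exact ⟨fun h => ⟨_, h⟩, fun ⟨_, h⟩ => h⟩
    refine (h2 _).symm.trans (h1.trans ?_)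
    constructor
    · intro hF
      obtain ⟨ξ, hξ, h4, -, -⟩ := S.exists_gt hF hF S.zero_mem
      exact (h3 ξ hξ).1 (ZFSet.mem_sep.1 h4).2
    · intro hφ
      exact S.big_true fun ξ hξ => (h3 ξ hξ).2 hφ

theorem embed_apply (h : WellFoundedUltrapower κ M F) (x : M) :
    (S.embed h x : ZFSet.{u}) = collapse h (S.constFun x) := rfl

/-- By induction on `α`: a function below the constant `α` is regressive on a large set, hence
constant on a large set with some value in `α`. -/
theorem collapse_constFun (h : WellFoundedUltrapower κ M F) (α : ZFSet.{u})
    (hα : α ∈ asSet κ) : collapse h (S.constFun ⟨α, S.sub α hα⟩) = α := by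
  induction α using ZFSet.inductionOn with
  | _ α ih =>
    ext x
    rw [mem_collapse]
    constructor
    · rintro ⟨g, hg, rfl⟩
      rw [memSet_eq, sep_congr (q := fun ξ => ev g ξ ∈ α) fun ξ hξ => by
        rw [S.ev_constFun _ hξ] ] at hg
      obtain ⟨i, hi⟩ := S.exists_id
      have hM : (asSet κ).sep (fun ξ => ev g ξ ∈ ξ) ∈ M := by
        rw [sep_congr (q := fun ξ => ev g ξ ∈ ev i ξ) fun ξ hξ => by rw [hi ξ hξ] ]
        exact S.memSet_mem g i
      -- Almost every `ξ` is above `α`, and then `g(ξ) ∈ α ∈ ξ`.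
      have hreg : (asSet κ).sep (fun ξ => ev g ξ ∈ ξ) ∈ F := by
        by_contra hn
        rw [← S.big_not hM] at hn
        obtain ⟨ξ, hξ, h1, h2, h3⟩ := S.exists_gt hn hg hα
        obtain ⟨a, ha, rfl⟩ := Ordinal.mem_toZFSet_iff.1 hξ
        exact (ZFSet.mem_sep.1 h1).2
          ((ZFSet.isOrdinal_toZFSet a).mem_trans (ZFSet.mem_sep.1 h2).2 h3)
      obtain ⟨β, hβ, hgβ⟩ := S.exists_const_of_regressive hreg
        fun ξ _ h => (ZFSet.mem_sep.1 h).2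
      have hβα : β ∈ α := by
        obtain ⟨ξ, hξ, h1, h2, -⟩ := S.exists_gt hgβ hg hα
        rw [← (ZFSet.mem_sep.1 h1).2]
        exact (ZFSet.mem_sep.1 h2).2
      rw [S.collapse_eq_of (g := S.constFun ⟨β, S.sub β hβ⟩) ?_, ih β hβα hβ]
      · exact hβα
      · rwa [sep_congr (q := fun ξ => ev g ξ = β) fun ξ hξ => by rw [S.ev_constFun _ hξ] ]
    · intro hx
      have hxκ := asSet_trans hα hx
      refine ⟨S.constFun ⟨x, S.sub x hxκ⟩, ?_, ih x hx hxκ⟩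
      rw [memSet_eq]
      exact S.big_true fun ξ hξ => by rwa [S.ev_constFun _ hξ, S.ev_constFun _ hξ]

/-- The function `ξ ↦ A ∩ ξ` will represent `A` itself in the ultrapower. -/
theorem exists_inter {A : ZFSet.{u}} (hA : A ∈ M) :
    ∃ f : InnerFun κ M, ∀ ξ ∈ asSet κ, ∀ z, z ∈ ev f ξ ↔ z ∈ ξ ∧ z ∈ A := by
  obtain ⟨f, hf⟩ := S.exists_fun (v := fun _ => A)
    (R := fun _ v => (∀ z ∈ v 1, z ∈ v 0 ∧ z ∈ v 2) ∧ ∀ z ∈ v 0, z ∈ v 2 → z ∈ v 1)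
    ((Dfn.ball ((Dfn.mem _ _).and (Dfn.mem _ _))).and
      (Dfn.ball ((Dfn.mem _ _).imp (Dfn.mem _ _)))) (fun _ => hA)
  refine ⟨f, fun ξ hξ z => ?_⟩
  obtain ⟨h1, h2⟩ := hf ξ hξ ⟨ξ.sep (fun z => z ∈ A),
    mem_H_of_subset (S.elem.subset (S.sub ξ hξ)) ZFSet.sep_subset,
    fun z (hz : z ∈ ξ.sep (fun z => z ∈ A)) => ZFSet.mem_sep.1 hz,
    fun z hz hzA => show z ∈ ξ.sep (fun z => z ∈ A) from ZFSet.mem_sep.2 ⟨hz, hzA⟩⟩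
  exact ⟨h1 z, fun h => h2 z h.1 h.2⟩

/-- Functions below `ξ ↦ A ∩ ξ` are regressive, so they represent ordinals below `κ`, and exactly
those in `A` occur. -/
theorem subset_mem_range (h : WellFoundedUltrapower κ M F) {A : ZFSet.{u}} (hA : A ⊆ asSet κ)
    (hAM : A ∈ M) : A ∈ ZFSet.range (collapse h) := by
  obtain ⟨f, hf⟩ := S.exists_inter hAM
  refine ZFSet.mem_range.2 ⟨f, ?_⟩
  ext x
  rw [mem_collapse]
  constructor
  · rintro ⟨g, hg, rfl⟩
    rw [memSet_eq] at hg
    obtain ⟨β, hβ, hgβ⟩ := S.exists_const_of_regressive hg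
      fun ξ hξ h => ((hf ξ hξ _).1 (ZFSet.mem_sep.1 h).2).1
    obtain ⟨ξ, hξ, h1, h2, -⟩ := S.exists_gt hgβ hg S.zero_mem
    have hβA : β ∈ A := by
      rw [← (ZFSet.mem_sep.1 h1).2]
      exact ((hf ξ hξ _).1 (ZFSet.mem_sep.1 h2).2).2
    rw [S.collapse_eq_of (g := S.constFun ⟨β, S.sub β hβ⟩) ?_, S.collapse_constFun h β hβ]
    · exact hβA
    · rwa [sep_congr (q := fun ξ => ev g ξ = β) fun ξ hξ => by rw [S.ev_constFun _ hξ] ]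
  · intro hx
    have hxκ := hA hx
    refine ⟨S.constFun ⟨x, S.sub x hxκ⟩, ?_, S.collapse_constFun h x hxκ⟩
    rw [memSet_eq]
    by_contra hn
    rw [← S.big_not (S.memSet_mem _ _)] at hn
    obtain ⟨ξ, hξ, h1, -, h2⟩ := S.exists_gt hn hn hxκ
    refine (ZFSet.mem_sep.1 h1).2 ?_
    rw [S.ev_constFun _ hξ, hf ξ hξ]
    exact ⟨h2, hx⟩

/-- Amenability of `F` is what remains to be supplied. By Łoś's theorem, a subset of `κ` represented
by `f` consists of those `α` with `α ∈ f(ξ)` for almost all `ξ`, and amenability puts this set into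
`M`. -/
theorem powersetPreserving (h : WellFoundedUltrapower κ M F)
    (hamen : ∀ f : InnerFun κ M, (asSet κ).sep (fun α =>
      (asSet κ).sep (fun ξ => α ∈ ev f ξ) ∈ F) ∈ M) :
    PowersetPreserving κ (S.embed h) where
  fix_below x hx := S.collapse_constFun h x hx
  moves x hx := by
    intro hj
    rw [embed_apply] at hj
    -- The identity represents an element of `j(κ)`. If `j(κ) = κ`, this would be an ordinal below
    -- `κ`, and the identity would be constant on a large set.
    obtain ⟨i, hi⟩ := S.exists_id
    have h1 : collapse h i ∈ asSet κ := by
      rw [← hx, ← hj, S.collapse_mem_iff]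
      refine S.big_true fun ξ hξ => ?_
      rw [hi ξ hξ, S.ev_constFun _ hξ, hx]
      exact hξ
    have h2 := S.eq_of_collapse_eq (h := h) i (S.constFun ⟨_, S.sub _ h1⟩)
      (S.collapse_constFun h _ h1).symm
    obtain ⟨ξ, hξ, h3, -, h4⟩ := S.exists_gt h2 h2 h1
    have h5 := (ZFSet.mem_sep.1 h3).2
    rw [hi ξ hξ, S.ev_constFun _ hξ] at h5
    rw [h5] at h4
    exact ZFSet.mem_irrefl _ h4
  same_subsets A hA := by
    refine ⟨S.subset_mem_range h hA, fun hAN => ?_⟩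
    obtain ⟨f, rfl⟩ := ZFSet.mem_range.1 hAN
    rw [show collapse h f = (asSet κ).sep (fun α =>
      (asSet κ).sep (fun ξ => α ∈ ev f ξ) ∈ F) from ?_]
    · exact hamen f
    · ext α
      rw [ZFSet.mem_sep]
      have key : ∀ hα : α ∈ asSet κ, α ∈ collapse h f ↔
          (asSet κ).sep (fun ξ => α ∈ ev f ξ) ∈ F := by
        intro hα
        conv_lhs => rw [← S.collapse_constFun h α hα, S.collapse_mem_iff]
        rw [sep_congr fun ξ hξ => by rw [S.ev_constFun _ hξ] ]
      exact ⟨fun hα => ⟨hA hα, (key (hA hα)).1 hα⟩, fun hα => (key hα.1).2 hα.2⟩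

end UltraSetup

end InnerFun

/-! ### From the filter property to Ramseyness -/

/-- König's theorem `κ < κ^{cf κ}` contradicts the assumption if `cf κ < κ`. -/
theorem isRegular_of_powerlt {κ : Cardinal.{u}} (hκ : ℵ₀ ≤ κ) (hpow : κ ^< κ = κ) :
    κ.IsRegular := by
  refine ⟨hκ, ?_⟩
  by_contra! hlt
  exact ((Cardinal.lt_power_cof_ord hκ).trans_le (Cardinal.le_powerlt κ hlt)).ne' hpow

theorem mem_seqSet {α : Ordinal.{u}} {x : Ordinal.{u} → ZFSet.{u}} {p : ZFSet.{u}} :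
    p ∈ seqSet α x ↔ ∃ β < α, p = ZFSet.pair β.toZFSet (x β) := by
  unfold seqSet
  rw [ZFSet.mem_range]
  exact ⟨fun ⟨β, h⟩ => ⟨β, β.2, h.symm⟩, fun ⟨β, hβ, h⟩ => ⟨⟨β, hβ⟩, h.symm⟩⟩

theorem seqSet_congr {α : Ordinal.{u}} {x y : Ordinal.{u} → ZFSet.{u}}
    (h : ∀ β < α, x β = y β) : seqSet α x = seqSet α y := by
  ext p
  simp only [mem_seqSet]
  exact exists_congr fun β => and_congr_right fun hβ => by rw [h β hβ]

theorem unionBelow_congr {α : Ordinal.{u}} {x y : Ordinal.{u} → ZFSet.{u}}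
    (h : ∀ β < α, x β = y β) : unionBelow α x = unionBelow α y := by
  ext p
  simp only [mem_unionBelow]
  exact exists_congr fun β => and_congr_right fun hβ => by rw [h β hβ]

theorem pair_mem_seqSet {α β : Ordinal.{u}} {x : Ordinal.{u} → ZFSet.{u}} {z : ZFSet.{u}} :
    ZFSet.pair β.toZFSet z ∈ seqSet α x ↔ β < α ∧ z = x β := by
  rw [mem_seqSet]
  constructor
  · rintro ⟨γ, hγ, h⟩
    obtain ⟨h1, rfl⟩ := ZFSet.pair_injective h
    rw [Ordinal.toZFSet_injective h1]
    exact ⟨hγ, rfl⟩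
  · rintro ⟨h, rfl⟩
    exact ⟨β, h, rfl⟩

theorem seqSet_mem_H {θ : Cardinal.{u}} (hθ : ℵ₀ ≤ θ) {α : Ordinal.{u}} (hα : α.card < θ)
    {x : Ordinal.{u} → ZFSet.{u}} (hx : ∀ β < α, x β ∈ H θ) : seqSet α x ∈ H θ := by
  refine mem_H_iff.2 ⟨?_, fun p hp => ?_⟩
  · refine (card_le_card (y := α.toZFSet) (fun b => ZFSet.pair b (x b.rank)) fun p hp => ?_).trans_lt
      (by rwa [Ordinal.card_toZFSet])
    obtain ⟨β, hβ, rfl⟩ := mem_seqSet.1 hp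
    exact ⟨β.toZFSet, Ordinal.toZFSet_mem_toZFSet_iff.2 hβ, by rw [Ordinal.rank_toZFSet]⟩
  · obtain ⟨β, hβ, rfl⟩ := mem_seqSet.1 hp
    exact pair_mem_H hθ (toZFSet_mem_H β ((Ordinal.card_le_card hβ.le).trans_lt hα)) (hx β hβ)

theorem seqSet_value_mem {θ : Cardinal.{u}} {M : ZFSet.{u}} (h : IsElemSub M (H θ))
    {α β : Ordinal.{u}} {x : Ordinal.{u} → ZFSet.{u}} (hx : seqSet α x ∈ M)
    (hβM : β.toZFSet ∈ M) (hβ : β < α) (hH : x β ∈ H θ) : x β ∈ M := by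
  have hp : ZFSet.pair β.toZFSet (x β) ∈ seqSet α x := pair_mem_seqSet.2 ⟨hβ, rfl⟩
  have hu : ∀ y, ZFSet.pair β.toZFSet y ∈ seqSet α x → y = x β :=
    fun y hy => (pair_mem_seqSet.1 hy).2
  generalize seqSet α x = s at hx hp hu
  generalize x β = z at hH hp hu
  refine h.mem_of_unique (transClass_H θ) (v := β.toZFSet .: fun _ => s)
    (P := fun _ v => ZFSet.pair (v 1) (v 0) ∈ v 2) (Dfn.pair_mem _ _ _) ?_ hH hp
    fun y _ hy => hu y hy
  rintro (_ | i)
  exacts [hβM, hx]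

/-! ### The challenger's strategy of playing models that contain `A` -/

/-- A `κ`-model `M ≺ H(θ)` that contains `Y`, if there is one. -/
def pickModel (κ θ : Cardinal.{u}) (Y : ZFSet.{u}) : ZFSet.{u} :=
  open Classical in
  if h : ∃ M : ZFSet.{u}, IsModel κ M ∧ IsElemSub M (H θ) ∧ Y ⊆ M then h.choose else ∅

/-- The set whose elements the challenger puts into his model: `A`, the elements of his earlier
models, and the sequences of the earlier moves. -/
def required (A : ZFSet.{u}) (α : Ordinal.{u}) (M F : Ordinal.{u} → ZFSet.{u}) : ZFSet.{u} :=
  unionBelow α M ∪ {A, seqSet α M} ∪ {seqSet α (fun β => F β ∩ M β)}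

/-- The models played by the challenger against the moves `F` of the judge. -/
def pickSeq (κ θ : Cardinal.{u}) (A : ZFSet.{u}) (F : Ordinal.{u} → ZFSet.{u})
    (α : Ordinal.{u}) : ZFSet.{u} :=
  open Classical in
  pickModel κ θ (required A α (fun β => if _h : β < α then pickSeq κ θ A F β else ∅) F)
termination_by α

theorem required_congr {A : ZFSet.{u}} {α : Ordinal.{u}} {M M' F F' : Ordinal.{u} → ZFSet.{u}}
    (hM : ∀ β < α, M β = M' β) (hF : ∀ β < α, F β = F' β) :
    required A α M F = required A α M' F' := by
  unfold required
  rw [unionBelow_congr hM, seqSet_congr hM,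
    seqSet_congr (x := fun β => F β ∩ M β) (y := fun β => F' β ∩ M' β)
      fun β hβ => by simp only [hM β hβ, hF β hβ] ]

theorem pickSeq_eq (κ θ : Cardinal.{u}) (A : ZFSet.{u}) (F : Ordinal.{u} → ZFSet.{u})
    (α : Ordinal.{u}) :
    pickSeq κ θ A F α = pickModel κ θ (required A α (pickSeq κ θ A F) F) := by
  rw [pickSeq]
  congr 1
  exact required_congr (fun β hβ => dif_pos hβ) fun _ _ => rfl

theorem pickSeq_congr {κ θ : Cardinal.{u}} {A : ZFSet.{u}} {F F' : Ordinal.{u} → ZFSet.{u}}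
    {α : Ordinal.{u}} (hF : ∀ β < α, F β = F' β) :
    pickSeq κ θ A F α = pickSeq κ θ A F' α := by
  induction α using WellFoundedLT.induction with
  | ind α ih =>
    rw [pickSeq_eq, pickSeq_eq]
    congr 1
    exact required_congr (fun β hβ => ih β hβ fun γ hγ => hF γ (hγ.trans hβ)) hF

/-- The strategy of the challenger given by `pickSeq`. -/
def pickStrategy (κ θ : Cardinal.{u}) (A : ZFSet.{u}) : ChallengerStrategy.{u} :=
  fun α F => open Classical in
    pickSeq κ θ A (fun β => if h : β < α then F ⟨β, h⟩ else ∅) α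

theorem pickStrategy_play (κ θ : Cardinal.{u}) (A : ZFSet.{u}) (F : Ordinal.{u} → ZFSet.{u}) :
    (pickStrategy κ θ A).play F = pickSeq κ θ A F := by
  funext α
  exact pickSeq_congr fun β hβ => dif_pos hβ

/-- Nothing is assumed about the judge's moves `F`: only the sets `F β ∩ M β` have to be in `H θ`,
and they are subsets of earlier models. -/
theorem pickSeq_spec {κ θ : Cardinal.{u}} (hκ : κ.IsRegular) (hpow : κ ^< κ = κ)
    (hθ : θ.IsRegular) (hκθ : κ < θ) {A : ZFSet.{u}} (hA : A ⊆ asSet κ)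
    (F : Ordinal.{u} → ZFSet.{u}) (α : Ordinal.{u}) (hα : α < κ.ord) :
    IsModel κ (pickSeq κ θ A F α) ∧ IsElemSub (pickSeq κ θ A F α) (H θ) ∧
      required A α (pickSeq κ θ A F) F ⊆ pickSeq κ θ A F α := by
  induction α using WellFoundedLT.induction with
  | ind α ih =>
    have hκ0 := hκ.aleph0_le
    have hαc : α.card < κ := Cardinal.lt_ord.1 hα
    have hMH : ∀ β < α, pickSeq κ θ A F β ∈ H θ := fun β hβ => by
      obtain ⟨h1, h2, -⟩ := ih β hβ (hβ.trans hα)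
      exact mem_H_iff.2 ⟨h1.1.card_eq.trans_lt hκθ, fun x hx => h2.subset hx⟩
    have hκH : asSet κ ∈ H θ := toZFSet_mem_H κ.ord (by rwa [Cardinal.card_ord])
    have h : ∃ M : ZFSet.{u}, IsModel κ M ∧ IsElemSub M (H θ) ∧
        required A α (pickSeq κ θ A F) F ⊆ M := by
      refine exists_isModel hκ hpow hθ hκθ ?_ fun y hy => ?_
      · refine ZFSet.card_union_le.trans ((add_le_add (ZFSet.card_union_le.trans
          ((add_le_add (card_unionBelow_le hκ0 hαc.le fun β hβ =>
            (ih β hβ (hβ.trans hα)).1.1.card_eq.le)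
            ((card_pair_lt_aleph0 _ _).le.trans hκ0)).trans (Cardinal.add_eq_self hκ0).le)) ?_).trans
          (Cardinal.add_eq_self hκ0).le)
        rw [ZFSet.card_singleton]
        exact one_le_aleph0.trans hκ0
      · unfold required at hy
        simp only [ZFSet.mem_union, ZFSet.mem_pair, ZFSet.mem_singleton] at hy
        rcases hy with (hy | rfl | rfl) | rfl
        · obtain ⟨β, hβ, hy⟩ := mem_unionBelow.1 hy
          exact transClass_H θ _ (hMH β hβ) _ hy
        · exact mem_H_of_subset hκH hA
        · exact seqSet_mem_H hθ.aleph0_le (hαc.trans hκθ) hMH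
        · refine seqSet_mem_H hθ.aleph0_le (hαc.trans hκθ) fun β hβ => ?_
          exact mem_H_of_subset (hMH β hβ) fun x hx => (ZFSet.mem_inter.1 hx).2
    rw [pickSeq_eq]
    unfold pickModel
    rw [dif_pos h]
    exact h.choose_spec

theorem challengerLegal_pickSeq {κ θ : Cardinal.{u}} (hκ : κ.IsRegular) (hpow : κ ^< κ = κ)
    (hθ : θ.IsRegular) (hκθ : κ < θ) {A : ZFSet.{u}} (hA : A ⊆ asSet κ)
    (F : Ordinal.{u} → ZFSet.{u}) (α : Ordinal.{u}) (hα : α < κ.ord) :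
    ChallengerLegal κ θ (pickSeq κ θ A F) F α := by
  obtain ⟨h1, h2, h3⟩ := pickSeq_spec hκ hpow hθ hκθ hA F α hα
  refine ⟨h1, h2, fun β hβ x hx => h3 ?_, h3 ?_, h3 ?_⟩ <;> unfold required <;>
    simp only [ZFSet.mem_union, ZFSet.mem_pair, ZFSet.mem_singleton]
  · exact Or.inl (Or.inl (mem_unionBelow.2 ⟨β, hβ, hx⟩))
  · exact Or.inl (Or.inr (Or.inr trivial))
  · exact Or.inr trivial

/-- The conclusion of a run of the game of length `ω` that is won by the judge. -/
theorem exists_embedding_of_judgeWins {κ θ : Cardinal.{u}} (hκ : κ.IsRegular)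
    (hθ : θ.IsRegular) (hκθ : κ < θ) {M F : Ordinal.{u} → ZFSet.{u}}
    (hM : ∀ α < Ordinal.omega0, ChallengerLegal κ θ M F α)
    (hF : ∀ α < Ordinal.omega0, JudgeLegal κ M F α)
    (hwin : JudgeWins κ Ordinal.omega0 M F) :
    IsWeakModel κ (unionBelow Ordinal.omega0 M) ∧ IsElemSub (unionBelow Ordinal.omega0 M) (H θ) ∧
      ClosedUnderSeq ℵ₀ (unionBelow Ordinal.omega0 M) ∧ ∃ N : ZFSet.{u}, N.IsTransitive ∧
        ∃ j : unionBelow Ordinal.omega0 M ↪ₑ[setL] N, PowersetPreserving κ j := by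
  have hκ0 := hκ.aleph0_le
  have h0 := Ordinal.omega0_pos
  have hmono : ∀ k l, k ≤ l → l < Ordinal.omega0 → M k ⊆ M l := by
    intro k l hkl hl
    rcases hkl.eq_or_lt with rfl | hkl
    · exact fun _ h => h
    · exact (hM l hl).increasing k hkl
  have hsucc : (κ.ord + 1).toZFSet ⊆ unionBelow Ordinal.omega0 M := fun x hx =>
    mem_unionBelow.2 ⟨0, h0, (hM 0 h0).model.1.succ_subset hx⟩
  have hκM : ∀ α < Ordinal.omega0, asSet κ ∈ M α := fun α hα =>
    (hM α hα).model.1.succ_subset (Ordinal.toZFSet_mem_toZFSet_iff.2 (lt_add_one _))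
  have hsubM : ∀ α < Ordinal.omega0, ∀ x ∈ asSet κ, x ∈ M α := fun α hα x hx =>
    (hM α hα).model.1.succ_subset (by
      rw [Ordinal.toZFSet_add_one]
      exact ZFSet.mem_insert_of_mem _ hx)
  have helem : IsElemSub (unionBelow Ordinal.omega0 M) (H θ) :=
    isElemSub_unionBelow (transClass_H θ) h0 (fun k hk => (hM k hk).elem) hmono (hκM 0 h0)
  have hsetup : UltraSetup κ θ (unionBelow Ordinal.omega0 M) (unionBelow Ordinal.omega0 F) :=
    { reg := hκ
      lt := hκθ
      elem := helem
      mem := mem_unionBelow.2 ⟨0, h0, hκM 0 h0⟩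
      sub := fun x hx => mem_unionBelow.2 ⟨0, h0, hsubM 0 h0 x hx⟩
      normal := hwin.1 }
  refine ⟨⟨le_antisymm ?_ ?_, hsucc, ?_⟩, helem, ?_, _, isTransitive_range_collapse hwin.2,
    hsetup.embed hwin.2, hsetup.powersetPreserving hwin.2 fun f => ?_⟩
  · refine card_unionBelow_le hκ0 (by rwa [Ordinal.card_omega0]) fun k hk =>
      (hM k hk).model.1.card_eq.le
  · refine (hM 0 h0).model.1.card_eq.ge.trans ?_
    exact ZFSet.card_mono fun x hx => mem_unionBelow.2 ⟨0, h0, hx⟩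
  · refine helem.modelsZFCMinus hθ fun x hx => hsucc ?_
    refine Ordinal.toZFSet_subset_toZFSet_iff.2 ?_ hx
    have : Ordinal.omega0 ≤ κ.ord := by
      rw [← Cardinal.ord_aleph0]
      exact Cardinal.ord_le_ord.2 hκ0
    gcongr
  -- A finite sequence from the union takes its values in one of the models, which is even closed
  -- under `<κ`-sequences.
  · intro β hβ s hs
    choose! f hf using fun c (hc : c ∈ β.toZFSet) => (hs.2 c hc).exists
    choose! k hk hfk using fun c (hc : c ∈ β.toZFSet) =>
      mem_unionBelow.1 (isFunc_pair_mem hs (hf c hc)).2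
    rw [← Cardinal.ord_aleph0] at hk
    obtain ⟨γ, hγ, hkγ⟩ := exists_ordinal_bound isRegular_aleph0 (x := β.toZFSet)
      (by rw [Ordinal.card_toZFSet]; exact Cardinal.lt_ord.1 hβ) k hk
    rw [Cardinal.ord_aleph0] at hγ
    refine mem_unionBelow.2 ⟨γ, hγ, (hM γ hγ).model.2 β
      (hβ.trans_le (Cardinal.ord_le_ord.2 hκ0)) s ⟨fun p hp => ?_, hs.2⟩⟩
    obtain ⟨a, ha, b, hb, rfl⟩ := ZFSet.mem_prod.1 (hs.1 hp)
    refine ZFSet.pair_mem_prod.2 ⟨ha, hmono _ _ (hkγ a ha) hγ ?_⟩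
    rw [isFunc_eq hs hp (hf a ha)]
    exact hfk a ha
  · obtain ⟨n, hn, hfn⟩ := mem_unionBelow.1 f.2.1
    have hn1 : n + 1 < Ordinal.omega0 := Ordinal.isSuccLimit_omega0.succ_lt hn
    have hL := hM _ hn1
    have hnn : n < n + 1 := lt_add_one n
    -- The next model contains the sequence of filters up to stage `n`, and with it the last entry.
    have hGM : F n ∩ M n ∈ M (n + 1) := by
      refine seqSet_value_mem hL.elem hL.filters_mem ?_ hnn ?_
      · refine hsubM _ hn1 _ (Ordinal.toZFSet_mem_toZFSet_iff.2 (hn.trans_le ?_))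
        rw [← Cardinal.ord_aleph0]
        exact Cardinal.ord_le_ord.2 hκ0
      · exact mem_H_of_subset (y := M n) (mem_H_iff.2
          ⟨(hM n hn).model.1.card_eq.trans_lt hκθ, fun x hx => (hM n hn).elem.subset hx⟩)
          fun x hx => (ZFSet.mem_inter.1 hx).2
    refine mem_unionBelow.2 ⟨n + 1, hn1, ?_⟩
    have hfn1 : f.1 ∈ M (n + 1) := hL.increasing n hnn hfn
    have hsep := hL.elem.sep_mem (a := asSet κ) (v := f.1 .: asSet κ .: fun _ => F n ∩ M n)
      (P := fun _ v => ∃ B ∈ v 3, B ⊆ v 2 ∧ ∀ ξ ∈ v 2, ξ ∈ B ↔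
        ∃ y, ZFSet.pair ξ y ∈ v 1 ∧ v 0 ∈ y)
      (Dfn.bex ((Dfn.subset _ _).and (Dfn.ball ((Dfn.mem _ _).iff (Dfn.exPair (Dfn.mem _ _))))))
      (by rintro (_ | _ | i); exacts [hfn1, hκM _ hn1, hGM]) (hκM _ hn1)
    rw [show (asSet κ).sep (fun α => (asSet κ).sep (fun ξ => α ∈ ev f ξ) ∈
      unionBelow Ordinal.omega0 F) = _ from ?_]
    · exact hsep
    · refine sep_congr fun α hα => ?_
      have hB : ∀ B, (B ⊆ asSet κ ∧ ∀ ξ ∈ asSet κ, ξ ∈ B ↔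
          ∃ y, ZFSet.pair ξ y ∈ f.1 ∧ α ∈ y) ↔ B = (asSet κ).sep (fun ξ => α ∈ ev f ξ) := by
        intro B
        have hev : ∀ ξ ∈ asSet κ, (∃ y, ZFSet.pair ξ y ∈ f.1 ∧ α ∈ y) ↔ α ∈ ev f ξ :=
          fun ξ hξ => ⟨fun ⟨y, h1, h2⟩ => eq_ev f h1 ▸ h2, fun h => ⟨_, pair_ev_mem f hξ, h⟩⟩
        constructor
        · rintro ⟨h1, h2⟩
          ext ξ
          rw [ZFSet.mem_sep]
          exact ⟨fun h => ⟨h1 h, (hev ξ (h1 h)).1 ((h2 ξ (h1 h)).1 h)⟩,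
            fun h => (h2 ξ h.1).2 ((hev ξ h.1).2 h.2)⟩
        · rintro rfl
          refine ⟨ZFSet.sep_subset, fun ξ hξ => ?_⟩
          rw [ZFSet.mem_sep, hev ξ hξ]
          exact and_iff_right hξ
      have hTM : (asSet κ).sep (fun ξ => α ∈ ev f ξ) ∈ M n := by
        have h := (hM n hn).elem.sep_mem (a := asSet κ) (v := f.1 .: fun _ => α)
          (P := fun _ v => ∃ y, ZFSet.pair (v 0) y ∈ v 1 ∧ v 2 ∈ y)
          (Dfn.exPair (Dfn.mem _ _)) (by rintro (_ | i); exacts [hfn, hsubM n hn α hα])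
          (hκM n hn)
        rw [← (hB ((asSet κ).sep fun ξ => ∃ y, ZFSet.pair ξ y ∈ f.1 ∧ α ∈ y)).1
          ⟨ZFSet.sep_subset, fun ξ hξ => ZFSet.mem_sep.trans (and_iff_right hξ)⟩]
        exact h
      change _ ↔ ∃ B ∈ F n ∩ M n, B ⊆ asSet κ ∧ ∀ ξ ∈ asSet κ, ξ ∈ B ↔
        ∃ y, ZFSet.pair ξ y ∈ f.1 ∧ α ∈ y
      simp only [hB, exists_eq_right, ZFSet.mem_inter]
      -- As the set `{ξ | α ∈ f(ξ)}` is in `M n`, it is already measured by `F n`, and later filters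
      -- cannot reverse this decision.
      refine ⟨fun h => ⟨?_, hTM⟩, fun h => mem_unionBelow.2 ⟨n, hn, h.1⟩⟩
      refine ((hF n hn).measures _ hTM ZFSet.sep_subset).resolve_right fun hc => ?_
      obtain ⟨ξ, -, h1, h2, -⟩ := hsetup.exists_gt h (mem_unionBelow.2 ⟨n, hn, hc⟩)
        hsetup.zero_mem
      exact (ZFSet.mem_sdiff.1 h2).2 h1

theorem isRamsey_of_filterProperty {κ : Cardinal.{u}} (hκ : ℵ₀ < κ) (hpow : κ ^< κ = κ)
    (h : HasWellFoundedFilterProperty κ Ordinal.omega0) : IsRamsey ℵ₀ κ := by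
  have hreg := isRegular_of_powerlt hκ.le hpow
  refine ⟨isRegular_aleph0, hreg, hκ.le, fun μ => ?_⟩
  have hmax : ℵ₀ ≤ max μ κ := hκ.le.trans (le_max_right _ _)
  have hθ : (Order.succ (max μ κ)).IsRegular := isRegular_succ hmax
  have hκθ : κ < Order.succ (max μ κ) := Order.lt_succ_of_le (le_max_right _ _)
  refine ⟨Order.succ (max μ κ), (le_max_left _ _).trans (Order.le_succ _), hθ, fun A hA => ?_⟩
  have hω : Ordinal.omega0 ≤ κ.ord := by
    rw [← Cardinal.ord_aleph0]
    exact Cardinal.ord_le_ord.2 hκ.le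
  have hlegal : ∀ (F : Ordinal.{u} → ZFSet.{u}), ∀ α < Ordinal.omega0,
      ChallengerLegal κ (Order.succ (max μ κ)) (pickSeq κ (Order.succ (max μ κ)) A F) F α :=
    fun F α hα => challengerLegal_pickSeq hreg hpow hθ hκθ hA F α (hα.trans_le hω)
  have hnot : ¬ (pickStrategy κ (Order.succ (max μ κ)) A).IsWinning κ (Order.succ (max μ κ))
      Ordinal.omega0 := fun hw => h _ hθ hκθ ⟨_, hw⟩
  unfold ChallengerStrategy.IsWinning at hnot
  simp only [pickStrategy_play] at hnot
  push Not at hnot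
  obtain ⟨F, hF⟩ := hnot
  -- The strategy always obeys the rules, so it can only fail by losing a complete run in which the
  -- judge obeys them too.
  obtain ⟨hJ, hwin⟩ := hF fun α hα _ => hlegal F α hα
  obtain ⟨h1, h2, h3, N, hN, j, hj⟩ :=
    exists_embedding_of_judgeWins hreg hθ hκθ (hlegal F) hJ hwin
  refine ⟨_, mem_unionBelow.2 ⟨0, Ordinal.omega0_pos, ?_⟩, h1, h2, h3, N, hN, j, hj⟩
  refine (pickSeq_spec hreg hpow hθ hκθ hA F 0 (Ordinal.omega0_pos.trans_le hω)).2.2 ?_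
  unfold required
  simp

/-! ### Graphs of functions -/

/-- The graph of `g` on `k`. -/
def graphOn (k : ZFSet.{u}) (g : ZFSet.{u} → ZFSet.{u}) : ZFSet.{u} :=
  ZFSet.range fun x : k => ZFSet.pair (x : ZFSet.{u}) (g x)

theorem mem_graphOn {k p : ZFSet.{u}} {g : ZFSet.{u} → ZFSet.{u}} :
    p ∈ graphOn k g ↔ ∃ x ∈ k, ZFSet.pair x (g x) = p := by
  unfold graphOn
  rw [ZFSet.mem_range]
  exact ⟨fun ⟨x, h⟩ => ⟨x, x.2, h⟩, fun ⟨x, hx, h⟩ => ⟨⟨x, hx⟩, h⟩⟩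

theorem pair_mem_graphOn {k x y : ZFSet.{u}} {g : ZFSet.{u} → ZFSet.{u}} :
    ZFSet.pair x y ∈ graphOn k g ↔ x ∈ k ∧ y = g x := by
  rw [mem_graphOn]
  constructor
  · rintro ⟨z, hz, h⟩
    obtain ⟨rfl, rfl⟩ := ZFSet.pair_inj.1 h
    exact ⟨hz, rfl⟩
  · rintro ⟨hx, rfl⟩
    exact ⟨x, hx, rfl⟩

theorem isFn_graphOn (k : ZFSet.{u}) (g : ZFSet.{u} → ZFSet.{u}) : IsFn k (graphOn k g) := by
  refine ⟨fun p hp => ?_, fun x hx => ⟨g x, pair_mem_graphOn.2 ⟨hx, rfl⟩, fun z hz =>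
    (pair_mem_graphOn.1 hz).2⟩⟩
  obtain ⟨x, hx, rfl⟩ := mem_graphOn.1 hp
  exact ⟨x, hx, g x, hp, rfl⟩

theorem graphOn_mem_H {θ : Cardinal.{u}} (hθ : ℵ₀ ≤ θ) {k : ZFSet.{u}} (hk : k ∈ H θ)
    {g : ZFSet.{u} → ZFSet.{u}} (hg : ∀ x ∈ k, g x ∈ H θ) : graphOn k g ∈ H θ := by
  refine mem_H_iff.2 ⟨lt_of_le_of_lt (card_le_card (y := k) (fun x => ZFSet.pair x (g x))
    fun p hp => mem_graphOn.1 hp) (mem_H_iff.1 hk).1, fun p hp => ?_⟩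
  obtain ⟨x, hx, rfl⟩ := mem_graphOn.1 hp
  exact pair_mem_H hθ (transClass_H θ _ hk _ hx) (hg x hx)

/-! ### Powerset preserving embeddings -/

/-- A powerset preserving embedding of an elementary substructure of `H(θ)` into a transitive
set. -/
structure EmbeddingSetup (κ θ : Cardinal.{u}) (M N : ZFSet.{u}) (j : M ↪ₑ[setL] N) : Prop where
  reg : κ.IsRegular
  le : ℵ₀ ≤ θ
  card_le : M.card ≤ κ
  lt : κ < θ
  elem : IsElemSub M (H θ)
  mem : asSet κ ∈ M
  sub : ∀ x ∈ asSet κ, x ∈ M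
  trans : N.IsTransitive
  pres : PowersetPreserving κ j

namespace EmbeddingSetup

variable {κ θ : Cardinal.{u}} {M N : ZFSet.{u}} {j : M ↪ₑ[setL] N}

/-- The image of `x ∈ M` under the embedding. -/
def app (_ : EmbeddingSetup κ θ M N j) (x : ZFSet.{u}) : ZFSet.{u} :=
  open Classical in if h : x ∈ M then j ⟨x, h⟩ else ∅

variable (S : EmbeddingSetup κ θ M N j)

include S

theorem app_mem {x : ZFSet.{u}} (hx : x ∈ M) : S.app x ∈ N := by
  unfold app
  rw [dif_pos hx]
  exact (j ⟨x, hx⟩).2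

theorem transfer {P : Set ZFSet.{u} → (ℕ → ZFSet.{u}) → Prop} (hP : Dfn Set.univ P)
    (v : ℕ → ZFSet.{u}) (hv : ∀ i, v i ∈ M) :
    P (H θ) v ↔ P {x | x ∈ N} (fun i => S.app (v i)) := by
  rw [S.elem.transfer (transClass_H θ) S.trans j hP (fun i => ⟨v i, hv i⟩)]
  unfold app
  simp only [hv, dite_true]

theorem app_mem_app {x y : ZFSet.{u}} (hx : x ∈ M) (hy : y ∈ M) :
    S.app x ∈ S.app y ↔ x ∈ y :=
  (S.transfer (Dfn.mem 0 1) (x .: fun _ => y) (by rintro (_ | i) <;> assumption)).symm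

theorem app_subset_app {x y : ZFSet.{u}} (hx : x ∈ M) (hy : y ∈ M) :
    S.app x ⊆ S.app y ↔ x ⊆ y :=
  (S.transfer (Dfn.subset 0 1) (x .: fun _ => y) (by rintro (_ | i) <;> assumption)).symm

theorem app_of_mem {α : ZFSet.{u}} (hα : α ∈ asSet κ) : S.app α = α := by
  unfold app
  rw [dif_pos (S.sub α hα)]
  exact S.pres.fix_below ⟨α, S.sub α hα⟩ hα

theorem app_pair {x y : ZFSet.{u}} (hx : x ∈ M) (hy : y ∈ M) :
    S.app (ZFSet.pair x y) = ZFSet.pair (S.app x) (S.app y) :=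
  (S.transfer (Dfn.eq_pair 0 1 2) (ZFSet.pair x y .: x .: fun _ => y)
    (by rintro (_ | _ | i); exacts [S.elem.pair_mem S.le hx hy, hx, hy])).1 rfl

theorem pair_app_mem {x y f : ZFSet.{u}} (hx : x ∈ M) (hy : y ∈ M) (hf : f ∈ M) :
    ZFSet.pair (S.app x) (S.app y) ∈ S.app f ↔ ZFSet.pair x y ∈ f := by
  rw [← S.app_pair hx hy, S.app_mem_app (S.elem.pair_mem S.le hx hy) hf]

theorem isFn_app {k f : ZFSet.{u}} (hk : k ∈ M) (hf : f ∈ M) :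
    IsFn (S.app k) (S.app f) ↔ IsFn k f :=
  (S.transfer (Dfn.isFn 0 1) (k .: fun _ => f) (by rintro (_ | i) <;> assumption)).symm

/-- The image of `κ` is an ordinal by elementarity. It includes `κ`, as smaller ordinals are fixed,
and differs from `κ`. -/
theorem card_mem_app : asSet κ ∈ S.app (asSet κ) := by
  have hsub : asSet κ ⊆ S.app (asSet κ) := fun α hα => by
    rw [← S.app_of_mem hα]
    exact (S.app_mem_app (S.sub α hα) S.mem).2 hα
  have hne : asSet κ ≠ S.app (asSet κ) := by
    have := S.pres.moves ⟨_, S.mem⟩ rfl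
    unfold app
    rw [dif_pos S.mem]
    exact this.symm
  have hord : (S.app (asSet κ)).IsOrdinal := by
    rw [ZFSet.isOrdinal_iff_forall_mem_isTransitive]
    have h := (S.transfer (P := fun _ v => (∀ x ∈ v 0, x ⊆ v 0) ∧
      ∀ x ∈ v 0, ∀ y ∈ x, y ⊆ x) ((Dfn.ball (Dfn.subset _ _)).and
        (Dfn.ball (P := fun _ x _ => ∀ y ∈ x, y ⊆ x) (Dfn.ball (Dfn.subset _ _))))
      (fun _ => asSet κ) fun _ => S.mem).1 ?_
    · exact h
    · have := ZFSet.isOrdinal_iff_forall_mem_isTransitive.1 (ZFSet.isOrdinal_toZFSet κ.ord)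
      exact this
  exact (((ZFSet.isOrdinal_toZFSet κ.ord).subset_iff_eq_or_mem hord).1 hsub).resolve_left hne

theorem mem_app_iff {A α : ZFSet.{u}} (hA : A ∈ M) (hα : α ∈ asSet κ) :
    α ∈ S.app A ↔ α ∈ A := by
  have := S.app_mem_app (S.sub α hα) hA
  rwa [S.app_of_mem hα] at this

theorem pair_mem_app_iff {A α x : ZFSet.{u}} (hA : A ∈ M) (hα : α ∈ asSet κ) (hx : x ∈ M) :
    ZFSet.pair α (S.app x) ∈ S.app A ↔ ZFSet.pair α x ∈ A := by
  have := S.pair_app_mem (S.sub α hα) hx hA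
  rwa [S.app_of_mem hα] at this

/-- Every nonempty element of `ω` has a maximum. If `κ = ω`, this would transfer to the elements of
`j(κ)`, one of which is `ω` itself. -/
theorem aleph0_lt : ℵ₀ < κ := by
  refine S.reg.aleph0_le.lt_of_ne ?_
  rintro rfl
  have h := (S.transfer (P := fun _ v => ∀ x ∈ v 0, (∃ y ∈ x, y = y) →
      ∃ y ∈ x, ∀ z ∈ x, z = y ∨ z ∈ y)
    (Dfn.ball (P := fun _ x _ => (∃ y ∈ x, y = y) → ∃ y ∈ x, ∀ z ∈ x, z = y ∨ z ∈ y)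
      ((Dfn.bex (P := fun _ y _ => y = y) (Dfn.eq _ _)).imp
        (Dfn.bex (P := fun _ y v => ∀ z ∈ v 0, z = y ∨ z ∈ y)
          (Dfn.ball ((Dfn.eq _ _).or (Dfn.mem _ _)))))) (fun _ => asSet ℵ₀) fun _ => S.mem).1 ?_
  · obtain ⟨y, hy, hmax⟩ := h _ S.card_mem_app
      ⟨∅, by
        rw [← Ordinal.toZFSet_zero]
        exact Ordinal.toZFSet_mem_toZFSet_iff.2 (by simp [Ordinal.omega0_pos]), rfl⟩
    unfold asSet at hy hmax
    rw [Cardinal.ord_aleph0] at hy hmax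
    obtain ⟨n, hn, rfl⟩ := Ordinal.mem_toZFSet_iff.1 hy
    rcases hmax _ (Ordinal.toZFSet_mem_toZFSet_iff.2
      (Ordinal.isSuccLimit_omega0.succ_lt hn)) with h | h
    · exact absurd (Ordinal.toZFSet_injective h) (Order.lt_succ n).ne'
    · exact absurd (Ordinal.toZFSet_mem_toZFSet_iff.1 h) (Order.lt_succ n).not_gt
  · intro x hx
    unfold asSet at hx
    rw [Cardinal.ord_aleph0] at hx
    obtain ⟨a, ha, rfl⟩ := Ordinal.mem_toZFSet_iff.1 hx
    obtain ⟨n, rfl⟩ := Ordinal.lt_omega0.1 ha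
    rintro ⟨y, hy, -⟩
    rcases n with _ | n
    · simp at hy
    · refine ⟨(n : Ordinal).toZFSet, ?_, ?_⟩
      · exact Ordinal.toZFSet_mem_toZFSet_iff.2 (by exact_mod_cast n.lt_succ_self)
      · intro z hz
        rw [Nat.cast_succ, Ordinal.toZFSet_add_one] at hz
        exact ZFSet.mem_insert_iff.1 hz

/-- If `κ ≤ 2^l`, there is in `M` an injection `h` from `κ` into the subsets of `l`. The value `a =
j(h)(κ)` is a subset of `l` in `N`, hence in `M`, and is fixed by `j`. Since `a` is a value of
`j(h)`, it is a value `h(ξ)` with `ξ < κ`; then `j(h)` takes the value `a` both at `ξ` and at `κ`.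
-/
theorem isStrongPrelimit : κ.IsStrongPrelimit := by
  intro l hl
  by_contra! hle
  have hlκ : asSet l ∈ asSet κ := Ordinal.toZFSet_mem_toZFSet_iff.2 (Cardinal.ord_lt_ord.2 hl)
  have hlM := S.sub _ hlκ
  have hlsub : asSet l ⊆ asSet κ := (ZFSet.isOrdinal_toZFSet κ.ord).subset_of_mem hlκ
  obtain ⟨g, hg, hgi⟩ : ∃ g : ZFSet.{u} → ZFSet.{u}, (∀ x ∈ asSet κ, g x ⊆ asSet l) ∧
      ∀ x ∈ asSet κ, ∀ y ∈ asSet κ, g x = g y → x = y := by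
    have h1 : (asSet κ).card ≤ (ZFSet.powerset (asSet l)).card := by
      unfold asSet
      rwa [ZFSet.card_powerset, Ordinal.card_toZFSet, Ordinal.card_toZFSet, Cardinal.card_ord,
        Cardinal.card_ord]
    obtain ⟨e⟩ : Nonempty ((asSet κ) ↪ (ZFSet.powerset (asSet l))) := by
      rw [← Cardinal.le_def, ZFSet.cardinalMk_coe_sort, ZFSet.cardinalMk_coe_sort]
      exact Cardinal.lift_le.2 h1
    classical
    refine ⟨fun x => if h : x ∈ asSet κ then e ⟨x, h⟩ else ∅, fun x hx => ?_,
      fun x hx y hy hxy => ?_⟩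
    · simp only [hx, dite_true]
      exact ZFSet.mem_powerset.1 (e ⟨x, hx⟩).2
    · simp only [hx, hy, dite_true] at hxy
      exact congrArg Subtype.val (e.injective (Subtype.ext hxy))
  have hκH : asSet κ ∈ H θ := S.elem.subset S.mem
  have hfH : graphOn (asSet κ) g ∈ H θ :=
    graphOn_mem_H S.le hκH fun x hx => mem_H_of_subset hκH ((hg x hx).trans hlsub)
  have hdef : ∀ 𝒞, Dfn 𝒞 (fun _ v => IsFn (v 1) (v 0) ∧
      (∀ x ∈ v 1, ∀ y, ZFSet.pair x y ∈ v 0 → y ⊆ v 2) ∧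
      ∀ x ∈ v 1, ∀ x' ∈ v 1, ∀ y, ZFSet.pair x y ∈ v 0 → ZFSet.pair x' y ∈ v 0 → x = x') :=
    fun 𝒞 => (Dfn.isFn _ _).and ((Dfn.ball (P := fun _ x v => ∀ y, ZFSet.pair x y ∈ v 0 → y ⊆ v 2)
      (Dfn.allPair (Dfn.subset _ _))).and
        (Dfn.ball (P := fun _ x v => ∀ x' ∈ v 1, ∀ y, ZFSet.pair x y ∈ v 0 →
          ZFSet.pair x' y ∈ v 0 → x = x')
          (Dfn.ball (P := fun _ x' v => ∀ y, ZFSet.pair (v 0) y ∈ v 1 →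
            ZFSet.pair x' y ∈ v 1 → v 0 = x')
            (Dfn.allPair (P := fun _ y v => ZFSet.pair (v 0) y ∈ v 2 → v 1 = v 0)
              ((Dfn.pair_mem _ _ _).imp (Dfn.eq _ _))))))
  obtain ⟨h, hhM, hh⟩ := S.elem.exists_mem (transClass_H θ) (hdef _)
    (v := asSet κ .: fun _ => asSet l) (by rintro (_ | i); exacts [S.mem, hlM]) ⟨_, hfH, by
      refine ⟨isFn_graphOn _ _, fun x hx y hxy => ?_, fun x hx x' hx' y h1 h2 => ?_⟩
      · rw [(pair_mem_graphOn.1 hxy).2]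
        exact hg x hx
      · exact hgi x hx x' hx' ((pair_mem_graphOn.1 h1).2.symm.trans (pair_mem_graphOn.1 h2).2)⟩
  have hv : ∀ i, (h .: asSet κ .: fun _ => asSet l) i ∈ M := by
    rintro (_ | _ | i)
    exacts [hhM, S.mem, hlM]
  have hJ := (S.transfer (hdef _) _ hv).1 hh
  obtain ⟨⟨-, hJ1⟩, hJ2, hJ3⟩ := hJ
  change ∀ x ∈ S.app (asSet κ), ∃ y, ZFSet.pair x y ∈ S.app h ∧ _ at hJ1
  change ∀ x ∈ S.app (asSet κ), ∀ y, ZFSet.pair x y ∈ S.app h → y ⊆ S.app (asSet l) at hJ2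
  change ∀ x ∈ S.app (asSet κ), ∀ x' ∈ S.app (asSet κ), ∀ y, ZFSet.pair x y ∈ S.app h →
    ZFSet.pair x' y ∈ S.app h → x = x' at hJ3
  -- The value of `j(h)` at `κ`.
  obtain ⟨a, ha, -⟩ := hJ1 _ S.card_mem_app
  have hal := hJ2 _ S.card_mem_app a ha
  rw [S.app_of_mem hlκ] at hal
  have haN : a ∈ N := S.trans _ (S.trans _ (S.trans _ (S.app_mem hhM) ha)
    (show {asSet κ, a} ∈ ZFSet.pair (asSet κ) a by simp [ZFSet.pair])) (by simp)
  have haM : a ∈ M := (S.pres.same_subsets a (hal.trans hlsub)).2 haN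
  have haa : S.app a = a := by
    ext x
    constructor
    · intro hx
      have hxl := (S.app_subset_app haM hlM).2 hal hx
      rw [S.app_of_mem hlκ] at hxl
      exact (S.mem_app_iff haM (hlsub hxl)).1 hx
    · intro hx
      exact (S.mem_app_iff haM (hlsub (hal hx))).2 hx
  obtain ⟨ξ, hξ, hξa⟩ := (S.transfer (P := fun _ v => ∃ ξ ∈ v 1, ZFSet.pair ξ (v 2) ∈ v 0)
    (Dfn.bex (Dfn.pair_mem _ _ _)) (h .: asSet κ .: fun _ => a)
    (by rintro (_ | _ | i); exacts [hhM, S.mem, haM])).2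
      ⟨asSet κ, S.card_mem_app, by
        change ZFSet.pair (asSet κ) (S.app a) ∈ S.app h
        rwa [haa]⟩
  have hξ' : ZFSet.pair ξ a ∈ S.app h := by
    have := (S.pair_mem_app_iff hhM hξ haM).2 hξa
    rwa [haa] at this
  have hξJ : ξ ∈ S.app (asSet κ) := (S.mem_app_iff S.mem hξ).2 hξ
  have := hJ3 _ hξJ _ S.card_mem_app a hξ' ha
  rw [this] at hξ
  exact ZFSet.mem_irrefl _ hξ

/-- The graph of a function from `l < κ` to `κ` is a subset of size below `κ` of a set of size `κ`.
A regular strong limit has only `κ` many such subsets. -/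
theorem powerlt_self : κ ^< κ = κ := by
  refine le_antisymm (Cardinal.powerlt_le.2 fun l hl => ?_) ?_
  · rcases eq_or_ne l 0 with rfl | hl0
    · rw [power_zero]
      exact one_le_aleph0.trans S.reg.aleph0_le
    · have hmk : #(l.out × κ.out) = κ := by
        rw [mk_prod, mk_out, mk_out, lift_id, lift_id]
        exact mul_eq_right S.reg.aleph0_le hl.le hl0
      have hsub := mk_subset_mk_lt_cof (α := l.out × κ.out) (by rw [hmk]; exact S.isStrongPrelimit)
      rw [hmk, S.reg.cof_ord] at hsub
      refine le_of_le_of_eq ?_ hsub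
      conv_lhs => rw [← mk_out l, ← mk_out κ, power_def]
      refine mk_le_of_injective (f := fun f => ⟨Set.range fun x => (x, f x), ?_⟩) ?_
      · refine mk_range_le.trans_lt ?_
        rwa [mk_out]
      · intro f g hfg
        have h : (Set.range fun x => (x, f x)) = Set.range fun x => (x, g x) :=
          congrArg Subtype.val hfg
        funext x
        have hx : (x, f x) ∈ Set.range fun x => (x, g x) := h.subset ⟨x, rfl⟩
        obtain ⟨y, hy⟩ := hx
        obtain ⟨rfl, hy⟩ := Prod.mk.inj hy
        exact hy.symm
  · calc κ = κ ^ (1 : Cardinal) := (power_one κ).symm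
      _ ≤ _ := le_powerlt _ (one_lt_aleph0.trans_le S.reg.aleph0_le)

end EmbeddingSetup

/-! ### Codes for strategies -/

/-- `D` is the diagonal intersection of the sequence `X` of length `k`. -/
def IsDiag (k X D : ZFSet.{u}) : Prop :=
  D ⊆ k ∧ ∀ ξ ∈ k, ξ ∈ D ↔ ∀ α ∈ ξ, ∀ A, ZFSet.pair α A ∈ X → ξ ∈ A

/-- `B` is the complement of `A` in `k`. -/
def IsComplIn (k A B : ZFSet.{u}) : Prop :=
  B ⊆ k ∧ ∀ ξ ∈ k, ξ ∈ B ↔ ξ ∉ A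

/-- `U` is a base of a filter on `k` whose elements are unbounded in `k`. -/
def IsUnboundedBase (k U : ZFSet.{u}) : Prop :=
  (∀ A ∈ U, A ⊆ k ∧ ∀ α ∈ k, ∃ ξ ∈ A, α ∈ ξ) ∧
    ∀ A ∈ U, ∀ B ∈ U, ∃ D ∈ U, D ⊆ A ∧ D ⊆ B

/-- `U` contains the diagonal intersections of the `k`-sequences of its elements that are in `Z`. -/
def IsDiagClosed (k U Z : ZFSet.{u}) : Prop :=
  ∀ X ∈ Z, IsFn k X → (∀ α ∈ k, ∀ A, ZFSet.pair α A ∈ X → A ∈ U) → ∃ D ∈ U, IsDiag k X D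

/-- The membership relation modulo `U` is well-founded on the functions in `Z`, as seen in `C`. -/
def IsWellFoundedMod (C : Set ZFSet.{u}) (k U Z : ZFSet.{u}) : Prop :=
  ∀ Y ∈ C, Y ⊆ Z → (∃ f ∈ Y, f = f) → (∀ f ∈ Y, IsFn k f) →
    ∃ f ∈ Y, ∀ g ∈ Y, ¬ ∃ D ∈ U, ∀ ξ ∈ D, ∃ x, ZFSet.pair ξ x ∈ g ∧
      ∃ y, ZFSet.pair ξ y ∈ f ∧ x ∈ y

/-- From the positions in `R`, the strategy `S` plays subsets of `Z`, and there is a response with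
elements of `U` that leads to a position in `R`. -/
def IsRun (C : Set ZFSet.{u}) (k S U R Z : ZFSet.{u}) : Prop :=
  (∃ p ∈ R, p = ∅) ∧ ∀ p ∈ R, ∃ m, ZFSet.pair p m ∈ S ∧ m ⊆ Z ∧
    ∃ F, ZFSet.pair p F ∈ R ∧ F ⊆ U ∧ (∀ A ∈ m, A ⊆ k → A ∈ F ∨ ∃ B ∈ U, IsComplIn k A B) ∧
      ∀ p' ∈ C, ∀ F' ∈ C, p = ZFSet.pair p' F' → F' ⊆ F

/-- `S` is a relation between positions and sets of size at most `k` that is total on the positions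
and that cannot be defeated. -/
def IsCode (C : Set ZFSet.{u}) (k S : ZFSet.{u}) : Prop :=
  (∃ p ∈ C, p = ∅ ∧ ∃ m, ZFSet.pair p m ∈ S ∧ m = m) ∧
  (∀ p ∈ C, ∀ m, ZFSet.pair p m ∈ S → ∀ F ∈ C, (∀ A ∈ F, A ⊆ k) →
    ∃ q ∈ C, q = ZFSet.pair p F ∧ ∃ m', ZFSet.pair q m' ∈ S ∧ m' = m') ∧
  (∀ p ∈ C, ∀ m, ZFSet.pair p m ∈ S →
    ∃ e ∈ C, IsFn k e ∧ ∀ x ∈ m, ∃ α ∈ k, ZFSet.pair α x ∈ e) ∧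
  ¬ ∃ U ∈ C, ∃ R ∈ C, ∃ Z ∈ C, IsUnboundedBase k U ∧ IsDiagClosed k U Z ∧
    IsWellFoundedMod C k U Z ∧ IsRun C k S U R Z

namespace Dfn

variable {𝒞 : Set (Set ZFSet.{u})}

theorem eq_empty (i : ℕ) : Dfn 𝒞 (fun _ v => v i = ∅) := by
  refine (ball (i := i) (P := fun _ _ _ => False) (const _)).congr fun C _ _ v _ => ?_
  rw [ZFSet.eq_empty]

theorem isDiag (i j k : ℕ) : Dfn 𝒞 (fun _ v => IsDiag (v i) (v j) (v k)) :=
  (subset _ _).and (ball ((mem _ _).iff (ball (allPair (mem _ _)))))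

theorem isComplIn (i j k : ℕ) : Dfn 𝒞 (fun _ v => IsComplIn (v i) (v j) (v k)) :=
  (subset _ _).and (ball ((mem _ _).iff (mem _ _).not))

theorem isUnboundedBase (i j : ℕ) : Dfn 𝒞 (fun _ v => IsUnboundedBase (v i) (v j)) :=
  (ball ((subset _ _).and (ball (bex (mem _ _))))).and
    (ball (ball (bex ((subset _ _).and (subset _ _)))))

theorem isDiagClosed (i j k : ℕ) : Dfn 𝒞 (fun _ v => IsDiagClosed (v i) (v j) (v k)) :=
  ball ((isFn _ _).imp ((ball (allPair (mem _ _))).imp (bex (isDiag _ _ _))))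

theorem isWellFoundedMod (i j k : ℕ) :
    Dfn 𝒞 (fun C v => IsWellFoundedMod C (v i) (v j) (v k)) :=
  all ((subset _ _).imp ((bex (eq _ _)).imp ((ball (isFn _ _)).imp
    (bex (ball (bex (ball (exPair (exPair (mem _ _))))).not)))))

theorem isRun (i j k l m : ℕ) :
    Dfn 𝒞 (fun C v => IsRun C (v i) (v j) (v k) (v l) (v m)) :=
  (bex (eq_empty _)).and (ball (exPair ((subset _ _).and (exPair ((subset _ _).and
    ((ball ((subset _ _).imp ((mem _ _).or (bex (isComplIn _ _ _))))).and
      (all (all ((eq_pair _ _ _).imp (subset _ _))))))))))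

theorem isCode (i j : ℕ) : Dfn 𝒞 (fun C v => IsCode C (v i) (v j)) :=
  (ex ((eq_empty _).and (exPair (eq _ _)))).and
    ((all (allPair (all ((ball (subset _ _)).imp
      (ex ((eq_pair _ _ _).and (exPair (eq _ _)))))))).and
    ((all (allPair (ex ((isFn _ _).and (ball (bex (pair_mem _ _ _))))))).and
    (ex (ex (ex ((isUnboundedBase _ _).and ((isDiagClosed _ _ _).and
      ((isWellFoundedMod _ _ _).and (isRun _ _ _ _ _))))))).not))

end Dfn

theorem TransClass.of_pair {C : Set ZFSet.{u}} (h : TransClass C) {x y : ZFSet.{u}}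
    (hp : ZFSet.pair x y ∈ C) : x ∈ C ∧ y ∈ C := by
  have : {x, y} ∈ C := h _ hp _ (by simp [ZFSet.pair])
  exact ⟨h _ this _ (by simp), h _ this _ (by simp)⟩

/-! ### The filter derived from an embedding and the failure of codes in `M` -/

namespace EmbeddingSetup

variable {κ θ : Cardinal.{u}} {M N : ZFSet.{u}} {j : M ↪ₑ[setL] N}

/-- The filter on `P(κ) ∩ M` that is derived from the embedding. -/
def derived (S : EmbeddingSetup κ θ M N j) : ZFSet.{u} :=
  M.sep fun A => A ⊆ asSet κ ∧ asSet κ ∈ S.app A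

variable (S : EmbeddingSetup κ θ M N j)

include S

theorem mem_derived {A : ZFSet.{u}} :
    A ∈ S.derived ↔ A ∈ M ∧ A ⊆ asSet κ ∧ asSet κ ∈ S.app A :=
  ZFSet.mem_sep

theorem mem_H : M ∈ H θ :=
  mem_H_iff.2 ⟨S.card_le.trans_lt S.lt, fun _ hx => S.elem.subset hx⟩

theorem exists_snd_mem {p s : ZFSet.{u}} (hp : p ∈ M) (hs : s ∈ M)
    (h : ∃ m, ZFSet.pair p m ∈ s) : ∃ m ∈ M, ZFSet.pair p m ∈ s := by
  obtain ⟨m, hm⟩ := h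
  have ht := transClass_H θ
  exact S.elem.exists_mem ht (P := fun _ v => ZFSet.pair (v 1) (v 0) ∈ v 2)
    (v := p .: fun _ => s) (Dfn.pair_mem _ _ _) (by rintro (_ | i) <;> assumption)
    ⟨m, (ht.of_pair (ht _ (S.elem.subset hs) _ hm)).2, hm⟩

theorem app_eq_of_pair {k f x y : ZFSet.{u}} (hf : f ∈ M) (hk : k ∈ M) (hfn : IsFn k f)
    (hxk : x ∈ k) (hx : x ∈ M) {z : ZFSet.{u}} (hy : y ∈ M) (hxy : ZFSet.pair x y ∈ f)
    (hz : ZFSet.pair (S.app x) z ∈ S.app f) : z = S.app y := by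
  obtain ⟨w, -, hw⟩ := ((S.isFn_app hk hf).2 hfn).2 _ ((S.app_mem_app hx hk).2 hxk)
  rw [hw z hz, hw _ ((S.pair_app_mem hx hy hf).2 hxy)]

theorem exists_compl {A : ZFSet.{u}} (hA : A ∈ M) (hAκ : A ⊆ asSet κ) :
    A ∈ S.derived ∨ ∃ B ∈ S.derived, IsComplIn (asSet κ) A B := by
  have hB : (asSet κ).sep (fun ξ => ξ ∉ A) ∈ M :=
    S.elem.sep_mem (P := fun _ v => v 0 ∉ v 1) (v := fun _ => A) (Dfn.mem _ _).not
      (fun _ => hA) S.mem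
  have hc : IsComplIn (asSet κ) A ((asSet κ).sep (fun ξ => ξ ∉ A)) :=
    ⟨ZFSet.sep_subset, fun ξ hξ => ZFSet.mem_sep.trans (and_iff_right hξ)⟩
  by_cases h : asSet κ ∈ S.app A
  · exact Or.inl (S.mem_derived.2 ⟨hA, hAκ, h⟩)
  · refine Or.inr ⟨_, S.mem_derived.2 ⟨hB, hc.1, ?_⟩, hc⟩
    have := (S.transfer (Dfn.isComplIn 0 1 2)
      (asSet κ .: A .: fun _ => (asSet κ).sep (fun ξ => ξ ∉ A))
      (by rintro (_ | _ | i); exacts [S.mem, hA, hB])).1 hc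
    exact (this.2 _ S.card_mem_app).2 h

/-- The set `j(A)` has the element `κ` above `j(α) = α`; reflecting this yields an element of `A`
above `α`. For intersections, `κ` belongs to both images. -/
theorem isUnboundedBase_derived : IsUnboundedBase (asSet κ) S.derived := by
  refine ⟨fun A hA => ?_, fun A hA B hB => ?_⟩
  · obtain ⟨hAM, hAκ, hA⟩ := S.mem_derived.1 hA
    refine ⟨hAκ, fun α hα => ?_⟩
    refine (S.transfer (P := fun _ v => ∃ ξ ∈ v 0, v 1 ∈ ξ) (Dfn.bex (Dfn.mem _ _))
      (A .: fun _ => α) (by rintro (_ | i); exacts [hAM, S.sub α hα])).2 ⟨asSet κ, hA, ?_⟩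
    change S.app α ∈ asSet κ
    rwa [S.app_of_mem hα]
  · obtain ⟨hAM, hAκ, hA⟩ := S.mem_derived.1 hA
    obtain ⟨hBM, hBκ, hB⟩ := S.mem_derived.1 hB
    have hD : A.sep (fun ξ => ξ ∈ B) ∈ M :=
      S.elem.sep_mem (P := fun _ v => v 0 ∈ v 1) (v := fun _ => B) (Dfn.mem _ _)
        (fun _ => hBM) hAM
    refine ⟨A.sep (fun ξ => ξ ∈ B), S.mem_derived.2 ⟨hD, ZFSet.sep_subset.trans hAκ, ?_⟩,
      ZFSet.sep_subset, fun ξ hξ => (ZFSet.mem_sep.1 hξ).2⟩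
    have := (S.transfer (P := fun _ v => ∀ ξ ∈ v 0, ξ ∈ v 1 → ξ ∈ v 2)
      (Dfn.ball ((Dfn.mem _ _).imp (Dfn.mem _ _))) (A .: B .: fun _ => A.sep (fun ξ => ξ ∈ B))
      (by rintro (_ | _ | i); exacts [hAM, hBM, hD])).1
      fun ξ hξ hξB => ZFSet.mem_sep.2 ⟨hξ, hξB⟩
    exact this _ hA hB

/-- For `α < κ`, the entry of `j(X)` at `α` is `j(X_α)`, which contains `κ`. Thus `κ` is in the
diagonal intersection of `j(X)`. -/
theorem isDiagClosed_derived : IsDiagClosed (asSet κ) S.derived M := by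
  intro X hX hfn hXU
  have hD : (asSet κ).sep (fun ξ => ∀ α ∈ ξ, ∀ A, ZFSet.pair α A ∈ X → ξ ∈ A) ∈ M :=
    S.elem.sep_mem (P := fun _ v => ∀ α ∈ v 0, ∀ A, ZFSet.pair α A ∈ v 1 → v 0 ∈ A)
      (v := fun _ => X) (Dfn.ball (Dfn.allPair (Dfn.mem _ _))) (fun _ => hX) S.mem
  have hd : IsDiag (asSet κ) X
      ((asSet κ).sep (fun ξ => ∀ α ∈ ξ, ∀ A, ZFSet.pair α A ∈ X → ξ ∈ A)) :=
    ⟨ZFSet.sep_subset, fun ξ hξ => ZFSet.mem_sep.trans (and_iff_right hξ)⟩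
  refine ⟨_, S.mem_derived.2 ⟨hD, hd.1, ?_⟩, hd⟩
  have h := (S.transfer (Dfn.isDiag 0 1 2) (asSet κ .: X .: fun _ => (asSet κ).sep
    (fun ξ => ∀ α ∈ ξ, ∀ A, ZFSet.pair α A ∈ X → ξ ∈ A))
    (by rintro (_ | _ | i); exacts [S.mem, hX, hD])).1 hd
  refine (h.2 _ S.card_mem_app).2 fun α hα A hA => ?_
  obtain ⟨B, hB, -⟩ := hfn.2 α hα
  have hBU := S.mem_derived.1 (hXU α hα B hB)
  rw [S.app_eq_of_pair hX S.mem hfn hα (S.sub α hα) (z := A) hBU.1 hB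
    (by rw [S.app_of_mem hα]; exact hA)]
  exact hBU.2.2

/-- The map `f ↦ j(f)(κ)` sends membership modulo the derived filter to true membership, so a
minimal value gives a minimal function. -/
theorem isWellFoundedMod_derived : IsWellFoundedMod (H θ) (asSet κ) S.derived M := by
  intro Y _ hY hne hfn
  have hval : ∀ f ∈ Y, ∃ y, ∀ z, ZFSet.pair (asSet κ) z ∈ S.app f ↔ z = y := by
    intro f hf
    obtain ⟨y, hy, hu⟩ := ((S.isFn_app S.mem (hY hf)).2 (hfn f hf)).2 _ S.card_mem_app
    exact ⟨y, fun z => ⟨hu z, fun h => h ▸ hy⟩⟩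
  choose! val hval using hval
  obtain ⟨f, hf, hmin⟩ := (InvImage.wf val ZFSet.mem_wf).has_min {f | f ∈ Y}
    (hne.imp fun f hf => hf.1)
  refine ⟨f, hf, fun g hg ⟨D, hD, hDfg⟩ => hmin g hg ?_⟩
  obtain ⟨hDM, -, hκD⟩ := S.mem_derived.1 hD
  have h := (S.transfer (P := fun _ v => ∀ ξ ∈ v 0, ∃ x, ZFSet.pair ξ x ∈ v 1 ∧
      ∃ y, ZFSet.pair ξ y ∈ v 2 ∧ x ∈ y) (Dfn.ball (Dfn.exPair (Dfn.exPair (Dfn.mem _ _))))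
    (D .: g .: fun _ => f) (by rintro (_ | _ | i); exacts [hDM, hY hg, hY hf])).1 hDfg
  obtain ⟨x, hx, y, hy, hxy⟩ := h _ hκD
  rw [(hval g hg x).1 hx, (hval f hf y).1 hy] at hxy
  exact hxy

/-- The derived filter is amenable to `M`. -/
theorem preimage_derived_mem {e : ZFSet.{u}} (he : e ∈ M) (hfn : IsFn (asSet κ) e) :
    (asSet κ).sep (fun α => ∃ y, ZFSet.pair α y ∈ e ∧ y ∈ S.derived) ∈ M := by
  -- An instance of separation that holds in `H θ` is transferred to `N`, where it is applied to
  -- `j(e)`, `κ` and `j(κ)`. The resulting subset of `κ` belongs to `N`, hence to `M`.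
  have hsep := (S.transfer (P := fun C _ => ∀ f ∈ C, ∀ k ∈ C, ∀ k' ∈ C, ∃ B ∈ C, B ⊆ k ∧
      ∀ α ∈ k, α ∈ B ↔ ∃ y, ZFSet.pair α y ∈ f ∧ y ⊆ k' ∧ k ∈ y)
    (Dfn.all (Dfn.all (Dfn.all (Dfn.ex ((Dfn.subset _ _).and (Dfn.ball ((Dfn.mem _ _).iff
      (Dfn.exPair ((Dfn.subset _ _).and (Dfn.mem _ _)))))))))) (fun _ => asSet κ)
    fun _ => S.mem).1 fun f _ k hk k' _ =>
      ⟨k.sep (fun α => ∃ y, ZFSet.pair α y ∈ f ∧ y ⊆ k' ∧ k ∈ y),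
        mem_H_of_subset hk ZFSet.sep_subset, ZFSet.sep_subset,
        fun α hα => ZFSet.mem_sep.trans (and_iff_right hα)⟩
  have hκN : asSet κ ∈ N := S.trans _ (S.app_mem S.mem) S.card_mem_app
  obtain ⟨B, hB, hBκ, hBe⟩ := hsep _ (S.app_mem he) _ hκN _ (S.app_mem S.mem)
  rw [show (asSet κ).sep (fun α => ∃ y, ZFSet.pair α y ∈ e ∧ y ∈ S.derived) = B from ?_]
  · exact (S.pres.same_subsets B hBκ).2 hB
  ext α
  rw [ZFSet.mem_sep]
  have key : ∀ hα : α ∈ asSet κ, (∃ y, ZFSet.pair α y ∈ e ∧ y ∈ S.derived) ↔ α ∈ B := by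
    intro hα
    rw [hBe α hα]
    constructor
    · rintro ⟨y, hy, hyU⟩
      obtain ⟨hyM, hyκ, hy'⟩ := S.mem_derived.1 hyU
      exact ⟨S.app y, (S.pair_mem_app_iff he hα hyM).2 hy,
        (S.app_subset_app hyM S.mem).2 hyκ, hy'⟩
    · rintro ⟨z, hz, hzκ, hκz⟩
      obtain ⟨w, hw, -⟩ := hfn.2 α hα
      obtain ⟨y, hyM, hy⟩ := S.exists_snd_mem (S.sub α hα) he ⟨w, hw⟩
      obtain rfl := S.app_eq_of_pair he S.mem hfn hα (S.sub α hα) hyM hy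
        (by rw [S.app_of_mem hα]; exact hz)
      exact ⟨y, hy, S.mem_derived.2 ⟨hyM, (S.app_subset_app hyM S.mem).1 hzκ, hκz⟩⟩
  exact ⟨fun h => (key h.1).1 h.2, fun h => ⟨hBκ h, (key (hBκ h)).2 h⟩⟩

/-- With the enumeration `e`, the part of `m` in the derived filter is the image of a set of indices
below `κ`, and this set of indices is in `M` by amenability. -/
theorem union_inter_derived_mem {e m G : ZFSet.{u}} (he : e ∈ M) (hfn : IsFn (asSet κ) e)
    (hm : m ∈ M) (hem : ∀ x ∈ m, ∃ α ∈ asSet κ, ZFSet.pair α x ∈ e) (hG : G ∈ M) :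
    G ∪ m.sep (fun A => A ∈ S.derived) ∈ M := by
  have hθ := S.le
  have hB := S.preimage_derived_mem he hfn
  set B := (asSet κ).sep (fun α => ∃ y, ZFSet.pair α y ∈ e ∧ y ∈ S.derived) with hBdef
  have h1 : m.sep (fun A => ∃ α ∈ B, ZFSet.pair α A ∈ e) ∈ M :=
    S.elem.sep_mem (P := fun _ v => ∃ α ∈ v 1, ZFSet.pair α (v 0) ∈ v 2) (v := B .: fun _ => e)
      (Dfn.bex (Dfn.pair_mem _ _ _)) (by rintro (_ | i); exacts [hB, he]) hm
  rw [show m.sep (fun A => ∃ α ∈ B, ZFSet.pair α A ∈ e) = m.sep (fun A => A ∈ S.derived) from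
    sep_congr fun A hA => ?_] at h1
  · refine S.elem.mem_of_unique (transClass_H θ) (v := G .: fun _ => m.sep (fun A => A ∈ S.derived))
      (P := fun _ v => (v 1 ⊆ v 0 ∧ v 2 ⊆ v 0) ∧ ∀ x ∈ v 0, x ∈ v 1 ∨ x ∈ v 2)
      (((Dfn.subset _ _).and (Dfn.subset _ _)).and (Dfn.ball ((Dfn.mem _ _).or (Dfn.mem _ _))))
      (by rintro (_ | i); exacts [hG, h1]) ?_ ?_ ?_
    · have hGH := S.elem.subset hG
      have h1H := S.elem.subset h1
      refine mem_H_iff.2 ⟨ZFSet.card_union_le.trans_lt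
        (add_lt_of_lt hθ (mem_H_iff.1 hGH).1 (mem_H_iff.1 h1H).1), fun y hy => ?_⟩
      rcases ZFSet.mem_union.1 hy with hy | hy
      exacts [transClass_H θ _ hGH _ hy, transClass_H θ _ h1H _ hy]
    · exact ⟨⟨fun x hx => ZFSet.mem_union.2 (Or.inl hx), fun x hx => ZFSet.mem_union.2 (Or.inr hx)⟩,
        fun x hx => ZFSet.mem_union.1 hx⟩
    · rintro y - ⟨⟨hy1, hy2⟩, hy3⟩
      ext x
      rw [ZFSet.mem_union]
      exact ⟨hy3 x, fun h => h.elim (fun h => hy1 h) fun h => hy2 h⟩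
  · constructor
    · rintro ⟨α, hα, hαA⟩
      obtain ⟨hακ, y, hy, hyU⟩ := ZFSet.mem_sep.1 hα
      obtain ⟨w, -, hw⟩ := hfn.2 α hακ
      rwa [hw A hαA, ← hw y hy]
    · intro hAU
      obtain ⟨α, hα, hαA⟩ := hem A hA
      exact ⟨α, ZFSet.mem_sep.2 ⟨hα, A, hαA, hAU⟩, hαA⟩

/-- The judge adds to her previous filter the elements of the challenger's move `m` that are in the
derived filter. The new filter is in `M`, and so is the next position. -/
theorem exists_response {s : ZFSet.{u}} (hs : s ∈ M) (hcode : IsCode (H θ) (asSet κ) s)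
    {p G : ZFSet.{u}} (hp : p ∈ M) (hps : ∃ m, ZFSet.pair p m ∈ s) (hG : G ∈ M)
    (hGU : G ⊆ S.derived) :
    ∃ F ∈ M, F ⊆ S.derived ∧ G ⊆ F ∧ (∃ m, ZFSet.pair p m ∈ s ∧ m ⊆ M ∧
      ∀ A ∈ m, A ⊆ asSet κ → A ∈ F ∨ ∃ B ∈ S.derived, IsComplIn (asSet κ) A B) ∧
      ∃ m, ZFSet.pair (ZFSet.pair p F) m ∈ s := by
  obtain ⟨-, hc1, hc2, -⟩ := hcode
  have hpH := S.elem.subset hp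
  obtain ⟨m, hm, hpm⟩ := S.exists_snd_mem hp hs hps
  -- An enumeration of `m` by `κ` exists in `M`, so `m ⊆ M` follows from `κ ⊆ M`.
  obtain ⟨e, he, hfn, hem⟩ := S.elem.exists_mem (transClass_H θ)
    (P := fun _ v => IsFn (v 1) (v 0) ∧ ∀ x ∈ v 2, ∃ α ∈ v 1, ZFSet.pair α x ∈ v 0)
    (v := asSet κ .: fun _ => m)
    ((Dfn.isFn _ _).and (Dfn.ball (Dfn.bex (Dfn.pair_mem _ _ _))))
    (by rintro (_ | i); exacts [S.mem, hm]) (hc2 p hpH m hpm)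
  change IsFn (asSet κ) e at hfn
  change ∀ x ∈ m, ∃ α ∈ asSet κ, ZFSet.pair α x ∈ e at hem
  have hmM : m ⊆ M := by
    intro x hx
    obtain ⟨α, hα, hαx⟩ := hem x hx
    obtain ⟨w, -, hw⟩ := hfn.2 α hα
    obtain ⟨y, hyM, hy⟩ := S.exists_snd_mem (S.sub α hα) he ⟨x, hαx⟩
    rwa [hw x hαx, ← hw y hy]
  have hFU : G ∪ m.sep (fun A => A ∈ S.derived) ⊆ S.derived := by
    intro x hx
    rcases ZFSet.mem_union.1 hx with hx | hx
    exacts [hGU hx, (ZFSet.mem_sep.1 hx).2]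
  have hFM := S.union_inter_derived_mem he hfn hm hem hG
  refine ⟨_, hFM, hFU, fun x hx => ZFSet.mem_union.2 (Or.inl hx), ⟨m, hpm, hmM, fun A hA hAκ => ?_⟩,
    ?_⟩
  · exact (S.exists_compl (hmM hA) hAκ).imp_left fun h =>
      ZFSet.mem_union.2 (Or.inr (ZFSet.mem_sep.2 ⟨hA, h⟩))
  · obtain ⟨q, -, rfl, m', hm', -⟩ := hc1 p hpH m hpm _ (S.elem.subset hFM)
      fun A hA => (S.mem_derived.1 (hFU hA)).2.1
    exact ⟨m', hm'⟩

/-- Iterating the response gives an infinite run whose positions are all in `M`. Their set need not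
be in `M`, but it is a subset of `M ∈ H θ`, so it refutes the last clause of the code in `H θ`. -/
theorem not_isCode {s : ZFSet.{u}} (hs : s ∈ M) : ¬ IsCode (H θ) (asSet κ) s := by
  intro hcode
  have hstep := fun (p G : ZFSet.{u}) hp hps hG hGU =>
    S.exists_response hs hcode (p := p) (G := G) hp hps hG hGU
  have h0 : (∅ : ZFSet.{u}) ∈ M := by
    refine S.sub _ ?_
    rw [← Ordinal.toZFSet_zero]
    exact Ordinal.toZFSet_mem_toZFSet_iff.2 (by
      rw [Cardinal.lt_ord]; simpa using S.reg.pos)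
  -- States of the run: the position, and a part of the derived filter in `M` that includes the last
  -- filter played, if any.
  let T := {x : ZFSet.{u} × ZFSet.{u} // x.1 ∈ M ∧ (∃ m, ZFSet.pair x.1 m ∈ s) ∧ x.2 ∈ M ∧
    x.2 ⊆ S.derived ∧ ∀ p' F', x.1 = ZFSet.pair p' F' → F' ⊆ x.2}
  have hnext : ∀ x : T, ∃ y : T, ∃ F, y.1.1 = ZFSet.pair x.1.1 F ∧ F ⊆ S.derived ∧ x.1.2 ⊆ F ∧
      ∃ m, ZFSet.pair x.1.1 m ∈ s ∧ m ⊆ M ∧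
        ∀ A ∈ m, A ⊆ asSet κ → A ∈ F ∨ ∃ B ∈ S.derived, IsComplIn (asSet κ) A B := by
    rintro ⟨⟨p, G⟩, hp, hps, hG, hGU, hpG⟩
    obtain ⟨F, hFM, hFU, hGF, hm, hm'⟩ := hstep p G hp hps hG hGU
    exact ⟨⟨(ZFSet.pair p F, F), S.elem.pair_mem S.le hp hFM, hm', hFM, hFU,
      fun p' F' h => (ZFSet.pair_inj.1 h).2 ▸ fun _ h => h⟩, F, rfl, hFU, hGF, hm⟩
  choose next hnext using hnext
  have hpe : ∀ p' F' : ZFSet.{u}, ∅ ≠ ZFSet.pair p' F' := fun p' F' h =>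
    ZFSet.notMem_empty {p'} (h ▸ by simp [ZFSet.pair])
  let x0 : T := ⟨(∅, ∅), h0, by
    obtain ⟨⟨p, -, rfl, m, hm, -⟩, -⟩ := hcode
    exact ⟨m, hm⟩, h0, fun x hx => absurd hx (ZFSet.notMem_empty x),
    fun p' F' h => absurd h (hpe p' F')⟩
  let pos : ℕ → T := fun n => next^[n] x0
  have hpos : ∀ n, pos (n + 1) = next (pos n) := fun n => Function.iterate_succ_apply' _ _ _
  refine hcode.2.2.2 ⟨S.derived, mem_H_of_subset S.mem_H ZFSet.sep_subset,
    ZFSet.range fun n => (pos n).1.1, mem_H_of_subset S.mem_H fun p hp => ?_, M, S.mem_H,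
    S.isUnboundedBase_derived, S.isDiagClosed_derived, S.isWellFoundedMod_derived,
    ⟨∅, ZFSet.mem_range.2 ⟨0, rfl⟩, rfl⟩, fun p hp => ?_⟩
  · obtain ⟨n, rfl⟩ := ZFSet.mem_range.1 hp
    exact (pos n).2.1
  · obtain ⟨n, rfl⟩ := ZFSet.mem_range.1 hp
    obtain ⟨F, hF, hFU, hGF, m, hm, hmM, hmA⟩ := hnext (pos n)
    refine ⟨m, hm, hmM, F, ZFSet.mem_range.2 ⟨n + 1, by rw [hpos, hF]⟩, hFU, hmA,
      fun p' _ F' _ h => ?_⟩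
    exact ((pos n).2.2.2.2.2 p' F' h).trans hGF

end EmbeddingSetup

/-! ### The code of a winning strategy -/

/-- The position after the judge's moves `l` (in reverse order). -/
def position : List ZFSet.{u} → ZFSet.{u}
  | [] => ∅
  | F :: l => ZFSet.pair (position l) F

/-- The sequence of the judge's moves `l` (in reverse order). -/
def moves : List ZFSet.{u} → Ordinal.{u} → ZFSet.{u}
  | [] => fun _ => ∅
  | F :: l => Function.update (moves l) l.length F

theorem empty_ne_pair (p F : ZFSet.{u}) : ∅ ≠ ZFSet.pair p F := fun h =>
  ZFSet.notMem_empty {p} (h ▸ by simp [ZFSet.pair])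

theorem position_injective : Function.Injective position.{u} := by
  intro l
  induction l with
  | nil =>
    rintro (_ | ⟨G, l'⟩) h
    · rfl
    · exact absurd h (empty_ne_pair _ _)
  | cons F l ih =>
    rintro (_ | ⟨G, l'⟩) h
    · exact absurd h.symm (empty_ne_pair _ _)
    · obtain ⟨h1, rfl⟩ := ZFSet.pair_inj.1 h
      rw [ih h1]

/-- The response of the strategy `σ` to the judge's moves `l`, if it has size at most `κ`. -/
def response (σ : ChallengerStrategy.{u}) (κ : Cardinal.{u}) (l : List ZFSet.{u}) : ZFSet.{u} :=
  open Classical in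
  if (σ.play (moves l) l.length).card ≤ κ then σ.play (moves l) l.length else ∅

/-- The code also covers positions after illegal moves, where nothing is known about `σ`. Replacing
oversized responses by `∅` secures the bound everywhere and changes nothing in legal runs. -/
theorem card_response_le (σ : ChallengerStrategy.{u}) (κ : Cardinal.{u}) (l : List ZFSet.{u}) :
    (response σ κ l).card ≤ κ := by
  unfold response
  split_ifs with h
  · exact h
  · rw [ZFSet.card_empty]
    exact zero_le

/-- The strategy `σ`, as a relation between positions and responses. -/
def code (σ : ChallengerStrategy.{u}) (κ : Cardinal.{u}) : ZFSet.{u} :=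
  ZFSet.range fun l : List (ZFSet.powerset (ZFSet.powerset (asSet κ))) =>
    ZFSet.pair (position (l.map Subtype.val)) (response σ κ (l.map Subtype.val))

theorem pair_mem_code {σ : ChallengerStrategy.{u}} {κ : Cardinal.{u}} {p m : ZFSet.{u}} :
    ZFSet.pair p m ∈ code σ κ ↔ ∃ l : List ZFSet.{u},
      (∀ F ∈ l, ∀ A ∈ F, A ⊆ asSet κ) ∧ p = position l ∧ m = response σ κ l := by
  unfold code
  rw [ZFSet.mem_range]
  constructor
  · rintro ⟨l, hl⟩
    obtain ⟨rfl, rfl⟩ := ZFSet.pair_inj.1 hl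
    refine ⟨_, fun F hF A hA => ?_, rfl, rfl⟩
    obtain ⟨G, -, rfl⟩ := List.mem_map.1 hF
    exact ZFSet.mem_powerset.1 (ZFSet.mem_powerset.1 G.2 hA)
  · rintro ⟨l, hl, rfl, rfl⟩
    have : ∃ l' : List (ZFSet.powerset (ZFSet.powerset (asSet κ))), l'.map Subtype.val = l := by
      induction l with
      | nil => exact ⟨[], rfl⟩
      | cons F l ih =>
        obtain ⟨l', hl'⟩ := ih fun G hG => hl G (List.mem_cons_of_mem _ hG)
        exact ⟨⟨F, ZFSet.mem_powerset.2 fun A hA => ZFSet.mem_powerset.2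
          (hl F List.mem_cons_self A hA)⟩ :: l', by rw [List.map_cons, hl']⟩
    obtain ⟨l', rfl⟩ := this
    exact ⟨l', rfl⟩

theorem pair_position_mem_code {σ : ChallengerStrategy.{u}} {κ : Cardinal.{u}}
    {l : List ZFSet.{u}} {m : ZFSet.{u}} (h : ZFSet.pair (position l) m ∈ code σ κ) :
    m = response σ κ l := by
  obtain ⟨l', -, hl, rfl⟩ := pair_mem_code.1 h
  rw [position_injective hl]

theorem exists_isFn_onto {κ θ : Cardinal.{u}} (hκ : ℵ₀ ≤ κ) (hκθ : κ < θ) {m : ZFSet.{u}}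
    (hm : m.card ≤ κ) (hmH : m ∈ H θ) :
    ∃ e ∈ H θ, IsFn (asSet κ) e ∧ ∀ x ∈ m, ∃ α ∈ asSet κ, ZFSet.pair α x ∈ e := by
  have hκH : asSet κ ∈ H θ := toZFSet_mem_H κ.ord (by rwa [Cardinal.card_ord])
  obtain ⟨i⟩ : Nonempty (m ↪ asSet κ) := by
    rw [← Cardinal.le_def, ZFSet.cardinalMk_coe_sort, ZFSet.cardinalMk_coe_sort, Cardinal.lift_le]
    unfold asSet
    rwa [Ordinal.card_toZFSet, Cardinal.card_ord]
  classical
  let g : ZFSet.{u} → ZFSet.{u} := fun α => if h : ∃ x : m, (i x : ZFSet.{u}) = α then h.choose else ∅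
  have hg : ∀ x : m, g (i x) = x := fun x => by
    have h : ∃ y : m, (i y : ZFSet.{u}) = i x := ⟨x, rfl⟩
    simp only [g, h, dite_true]
    exact congrArg Subtype.val (i.injective (Subtype.ext h.choose_spec))
  refine ⟨graphOn (asSet κ) g, graphOn_mem_H (hκ.trans hκθ.le) hκH fun α _ => ?_,
    isFn_graphOn _ _, fun x hx => ⟨i ⟨x, hx⟩, (i ⟨x, hx⟩).2,
      pair_mem_graphOn.2 ⟨(i ⟨x, hx⟩).2, (hg ⟨x, hx⟩).symm⟩⟩⟩
  simp only [g]
  split_ifs with h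
  · exact transClass_H θ _ hmH _ h.choose.2
  · exact mem_H_of_subset hκH (ZFSet.empty_subset _)

/-! ### Filters and ultrapowers obtained from a base -/

theorem card_eq_of_unbounded {κ : Cardinal.{u}} (hκ : κ.IsRegular) {D : ZFSet.{u}}
    (hD : D ⊆ asSet κ) (h : ∀ α ∈ asSet κ, ∃ ξ ∈ D, α ∈ ξ) : D.card = κ := by
  refine le_antisymm ?_ ?_
  · refine (ZFSet.card_mono hD).trans ?_
    unfold asSet
    rw [Ordinal.card_toZFSet, Cardinal.card_ord]
  · by_contra! hlt
    obtain ⟨γ, hγ, hγD⟩ := exists_ordinal_bound hκ hlt ZFSet.rank fun x hx => by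
      obtain ⟨a, ha, rfl⟩ := Ordinal.mem_toZFSet_iff.1 (hD hx)
      rwa [Ordinal.rank_toZFSet]
    obtain ⟨ξ, hξ, hγξ⟩ := h _ (Ordinal.toZFSet_mem_toZFSet_iff.2 hγ)
    have := ZFSet.rank_lt_of_mem hγξ
    rw [Ordinal.rank_toZFSet] at this
    exact this.not_ge (hγD ξ hξ)

/-- A finite intersection includes an element of the base, or is `κ` itself; an unbounded subset of
the regular cardinal `κ` has size `κ`. -/
theorem IsUnboundedBase.isFilter {κ : Cardinal.{u}} (hκ : κ.IsRegular) {U F : ZFSet.{u}}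
    (hU : IsUnboundedBase (asSet κ) U) (hF : F ⊆ U) : IsFilter κ F := by
  refine ⟨fun A hA => (hU.1 A (hF hA)).1, fun n A hA => ?_⟩
  have hκκ : ∀ α ∈ asSet κ, ∃ ξ ∈ asSet κ, α ∈ ξ := by
    intro α hα
    obtain ⟨a, ha, rfl⟩ := Ordinal.mem_toZFSet_iff.1 hα
    exact ⟨(Order.succ a).toZFSet, Ordinal.toZFSet_mem_toZFSet_iff.2
      ((Cardinal.isSuccLimit_ord hκ.aleph0_le).succ_lt ha),
      Ordinal.toZFSet_mem_toZFSet_iff.2 (Order.lt_succ a)⟩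
  obtain ⟨D, hDκ, hD, hDA⟩ : ∃ D, D ⊆ asSet κ ∧ (∀ α ∈ asSet κ, ∃ ξ ∈ D, α ∈ ξ) ∧
      ∀ i, D ⊆ A i := by
    rcases n with _ | n
    · exact ⟨asSet κ, fun _ h => h, hκκ, fun i => i.elim0⟩
    · suffices h : ∃ D ∈ U, ∀ i, D ⊆ A i by
        obtain ⟨D, hD, hDA⟩ := h
        exact ⟨D, (hU.1 D hD).1, (hU.1 D hD).2, hDA⟩
      induction n with
      | zero => exact ⟨A 0, hF (hA 0), Fin.cases (fun _ h => h) fun i => i.elim0⟩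
      | succ n ih =>
        obtain ⟨D, hD, hDA⟩ := ih (fun i => A i.succ) fun i => hA _
        obtain ⟨E, hE, hE1, hE2⟩ := hU.2 D hD _ (hF (hA 0))
        exact ⟨E, hE, Fin.cases hE2 fun i => hE1.trans (hDA i)⟩
  refine card_eq_of_unbounded hκ ZFSet.sep_subset fun α hα => ?_
  obtain ⟨ξ, hξ, hαξ⟩ := hD α hα
  exact ⟨ξ, ZFSet.mem_sep.2 ⟨hDκ hξ, fun i => hDA i hξ⟩, hαξ⟩

theorem isFn_of_isFunc {k y f : ZFSet.{u}} (h : ZFSet.IsFunc k y f) : IsFn k f := by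
  refine ⟨fun p hp => ?_, fun x hx => ?_⟩
  · obtain ⟨a, ha, b, -, rfl⟩ := ZFSet.mem_prod.1 (h.1 hp)
    exact ⟨a, ha, b, hp, rfl⟩
  · obtain ⟨w, hw⟩ := (h.2 x hx).exists
    exact ⟨w, hw, fun z hz => (h.2 x hx).unique hz hw⟩

/-- Functions that represent the same element of the ultrapower agree on a set in `U`. -/
theorem exists_agree {κ : Cardinal.{u}} {M F U : ZFSet.{u}} (hU : IsUnboundedBase (asSet κ) U)
    (hF : F ⊆ U) (hne : ∃ D, D ∈ U) {f g : InnerFun κ M}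
    (h : (Quot.mk _ f : Ultrapower κ M F) = Quot.mk _ g) :
    ∃ D ∈ U, ∀ ξ ∈ D, ev f ξ = ev g ξ := by
  replace h := Quot.eqvGen_exact h
  induction h with
  | rel f g h => exact ⟨eqSet κ f g, hF h, fun ξ hξ => (ZFSet.mem_sep.1 ((eqSet_eq f g).subset hξ)).2⟩
  | refl f => exact hne.imp fun D hD => ⟨hD, fun _ _ => rfl⟩
  | symm f g _ ih => exact ih.imp fun D hD => ⟨hD.1, fun ξ hξ => (hD.2 ξ hξ).symm⟩
  | trans f g k _ _ ih1 ih2 =>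
    obtain ⟨D, hD, hfg⟩ := ih1
    obtain ⟨E, hE, hgk⟩ := ih2
    obtain ⟨I, hI, h1, h2⟩ := hU.2 D hD E hE
    exact ⟨I, hI, fun ξ hξ => (hfg ξ (h1 hξ)).trans (hgk ξ (h2 hξ))⟩

/-- A minimal representative of a set of classes is sought. Passing between representatives costs
only further sets in `U`, which is directed under reverse inclusion. -/
theorem IsWellFoundedMod.wellFoundedUltrapower {κ θ : Cardinal.{u}} {U Z M F : ZFSet.{u}}
    (h : IsWellFoundedMod (H θ) (asSet κ) U Z) (hU : IsUnboundedBase (asSet κ) U)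
    (hZ : Z ∈ H θ) (hM : M ⊆ Z) (hF : F ⊆ U) (hne : ∃ D, D ∈ U) :
    WellFoundedUltrapower κ M F := by
  refine WellFounded.wellFounded_iff_has_min.2 fun s hs => ?_
  let Y : ZFSet.{u} := Z.sep fun f => ∃ f' : InnerFun κ M, f'.1 = f ∧ Quot.mk _ f' ∈ s
  have hYne : ∃ f ∈ Y, f = f := by
    obtain ⟨b, hb⟩ := hs
    induction b using Quot.inductionOn with
    | h f => exact ⟨f.1, ZFSet.mem_sep.2 ⟨hM f.2.1, f, rfl, hb⟩, rfl⟩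
  have hYfn : ∀ f ∈ Y, IsFn (asSet κ) f := by
    intro f hf
    obtain ⟨-, f, rfl, -⟩ := ZFSet.mem_sep.1 hf
    exact isFn_of_isFunc f.2.2
  obtain ⟨f, hf, hmin⟩ := h Y (mem_H_of_subset hZ ZFSet.sep_subset) ZFSet.sep_subset hYne hYfn
  obtain ⟨-, f, rfl, hfs⟩ := ZFSet.mem_sep.1 hf
  refine ⟨_, hfs, ?_⟩
  rintro b hb ⟨g, f', rfl, hf', hgf⟩
  obtain ⟨D, hD, hDf⟩ := exists_agree hU hF hne hf'
  obtain ⟨E, hE, hE1, hE2⟩ := hU.2 D hD _ (hF hgf)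
  refine hmin g.1 (ZFSet.mem_sep.2 ⟨hM g.2.1, g, rfl, hb⟩) ⟨E, hE, fun ξ hξ => ?_⟩
  have hξ2 := hE2 hξ
  rw [memSet_eq, ZFSet.mem_sep, hDf ξ (hE1 hξ)] at hξ2
  exact ⟨_, pair_ev_mem g hξ2.1, _, pair_ev_mem f hξ2.1, hξ2.2⟩

/-! ### Runs of length `ω` against a strategy -/

/-- The sequence of length `ω` with the values `F`. -/
def ofNatSeq (F : ℕ → ZFSet.{u}) (α : Ordinal.{u}) : ZFSet.{u} := F (Cardinal.toNat α.card)

theorem ofNatSeq_natCast (F : ℕ → ZFSet.{u}) (n : ℕ) : ofNatSeq F n = F n := by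
  simp [ofNatSeq]

/-- The list of the first `n` values of `F`, in reverse order. -/
def revTake (F : ℕ → ZFSet.{u}) : ℕ → List ZFSet.{u}
  | 0 => []
  | n + 1 => F n :: revTake F n

theorem length_revTake (F : ℕ → ZFSet.{u}) (n : ℕ) : (revTake F n).length = n := by
  induction n with
  | zero => rfl
  | succ n ih => simp [revTake, ih]

theorem moves_revTake (F : ℕ → ZFSet.{u}) {n k : ℕ} (hk : k < n) :
    moves (revTake F n) k = F k := by
  induction n with
  | zero => omega
  | succ n ih =>
    simp only [revTake, moves, length_revTake]
    rcases eq_or_ne k n with rfl | hkn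
    · rw [Function.update_self]
    · rw [Function.update_of_ne (by exact_mod_cast hkn), ih (by omega)]

theorem play_moves_revTake (σ : ChallengerStrategy.{u}) (F : ℕ → ZFSet.{u}) (n : ℕ) :
    σ.play (moves (revTake F n)) n = σ.play (ofNatSeq F) n := by
  unfold ChallengerStrategy.play
  congr 1
  funext ⟨β, hβ⟩
  obtain ⟨k, rfl⟩ := Ordinal.lt_omega0.1 ((Set.mem_Iio.1 hβ).trans (Ordinal.natCast_lt_omega0 n))
  have hk : k < n := by exact_mod_cast Set.mem_Iio.1 hβ
  rw [moves_revTake F hk, ofNatSeq_natCast]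

/-- The assumptions about a run of the game in which the judge answers with elements of `U` and
the challenger plays subsets of `Z`. -/
structure GuidedRun (C : Set ZFSet.{u}) (κ : Cardinal.{u}) (U Z : ZFSet.{u})
    (σ : ChallengerStrategy.{u}) (F : ℕ → ZFSet.{u}) : Prop where
  base : IsUnboundedBase (asSet κ) U
  diag : IsDiagClosed (asSet κ) U Z
  wf : IsWellFoundedMod C (asSet κ) U Z
  sub : ∀ n, response σ κ (revTake F n) ⊆ Z
  filter_sub : ∀ n, F n ⊆ U
  measures : ∀ n, ∀ A ∈ response σ κ (revTake F n), A ⊆ asSet κ →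
    A ∈ F n ∨ ∃ B ∈ U, IsComplIn (asSet κ) A B
  mono : ∀ n, F n ⊆ F (n + 1)

namespace GuidedRun

variable {θ θ' κ : Cardinal.{u}} {U Z : ZFSet.{u}} {σ : ChallengerStrategy.{u}}
  {F : ℕ → ZFSet.{u}}

theorem sdiff_mem {M A : ZFSet.{u}} (h : IsElemSub M (H θ)) (hκ : asSet κ ∈ M) (hA : A ∈ M) :
    asSet κ \ A ∈ M := by
  have := h.sep_mem (P := fun _ v => v 0 ∉ v 1) (v := fun _ => A) (Dfn.mem _ _).not
    (fun _ => hA) hκ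
  rwa [show asSet κ \ A = (asSet κ).sep (fun ξ => ξ ∉ A) from ?_]
  ext ξ
  rw [ZFSet.mem_sdiff, ZFSet.mem_sep]

theorem mem_of_isModel {M : ZFSet.{u}} (h : IsModel κ M) : asSet κ ∈ M :=
  h.1.succ_subset (Ordinal.toZFSet_mem_toZFSet_iff.2 (lt_add_one _))

theorem response_eq {n : ℕ} (h : IsModel κ (σ.play (ofNatSeq F) n)) :
    response σ κ (revTake F n) = σ.play (ofNatSeq F) n := by
  unfold response
  rw [length_revTake, play_moves_revTake, if_pos h.1.card_eq.le]

variable (R : GuidedRun (H θ') κ U Z σ F)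

include R

theorem disjoint (hκ : κ.IsRegular) {A B : ZFSet.{u}} (hA : A ∈ U) (hB : B ∈ U)
    (h : ∀ ξ ∈ A, ξ ∉ B) : False := by
  obtain ⟨D, hD, hDA, hDB⟩ := R.base.2 A hA B hB
  have h0 : (∅ : ZFSet.{u}) ∈ asSet κ := by
    rw [← Ordinal.toZFSet_zero]
    exact Ordinal.toZFSet_mem_toZFSet_iff.2 (by
      rw [Cardinal.lt_ord]; simpa using hκ.pos)
  obtain ⟨ξ, hξ, -⟩ := (R.base.1 D hD).2 _ h0
  exact h ξ (hDA hξ) (hDB hξ)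

theorem monotone {k n : ℕ} (h : k ≤ n) : F k ⊆ F n := by
  induction n, h using Nat.le_induction with
  | base => exact fun _ h => h
  | succ n _ ih => exact ih.trans (R.mono n)

/-- A guided run only promises that `A` is in `F n` or has a complement in `U`. In the second case
apply the same to `κ \ A`, which is in the model as well: its complement cannot be in `U` too, so `κ
\ A` is in `F n`. -/
theorem judgeLegal (hκ : κ.IsRegular) {n : ℕ} (h : ChallengerLegal κ θ (σ.play (ofNatSeq F))
    (ofNatSeq F) n) : JudgeLegal κ (σ.play (ofNatSeq F)) (ofNatSeq F) n := by
  have hm := R.measures n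
  rw [response_eq h.model] at hm
  constructor
  · rw [ofNatSeq_natCast]
    exact R.base.isFilter hκ (R.filter_sub n)
  · intro A hA hAκ
    rw [ofNatSeq_natCast]
    refine (hm A hA hAκ).imp_right fun ⟨B, hB, hBA⟩ => ?_
    refine (hm _ (sdiff_mem h.elem (mem_of_isModel h.model) hA)
      fun x hx => (ZFSet.mem_sdiff.1 hx).1).resolve_right ?_
    rintro ⟨B', hB', hB'A⟩
    refine R.disjoint hκ hB hB' fun ξ hξ hξ' => ?_
    refine (hB'A.2 ξ (hB'A.1 hξ')).1 hξ' (ZFSet.mem_sdiff.2 ⟨hBA.1 hξ, ?_⟩)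
    exact (hBA.2 ξ (hBA.1 hξ)).1 hξ
  · intro β hβ
    obtain ⟨k, rfl⟩ := Ordinal.lt_omega0.1 (hβ.trans (Ordinal.natCast_lt_omega0 n))
    rw [ofNatSeq_natCast, ofNatSeq_natCast]
    exact R.monotone (by exact_mod_cast hβ.le)

/-- A winning strategy obeys the rules as long as the judge does, and its legal moves make her
answers legal; the two facts are proved by a joint induction. -/
theorem legal (hκ : κ.IsRegular) (hσ : σ.IsWinning κ θ Ordinal.omega0) (n : ℕ) :
    ChallengerLegal κ θ (σ.play (ofNatSeq F)) (ofNatSeq F) n ∧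
      JudgeLegal κ (σ.play (ofNatSeq F)) (ofNatSeq F) n := by
  induction n using Nat.strong_induction_on with
  | _ n ih =>
    have h := (hσ (ofNatSeq F)).1 n (Ordinal.natCast_lt_omega0 n) fun β hβ => by
      obtain ⟨k, rfl⟩ := Ordinal.lt_omega0.1 (hβ.trans (Ordinal.natCast_lt_omega0 n))
      exact (ih k (by exact_mod_cast hβ)).2
    exact ⟨h, R.judgeLegal hκ h⟩

/-- Filter, normality and well-foundedness for the union of the run all follow from the
corresponding properties of `U` and `Z`. The game is played at `θ`, whereas `U` and `Z` are judged
in `H θ'`. -/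
theorem not_isWinning (hκ : κ.IsRegular) (hZ : Z ∈ H θ') :
    ¬ σ.IsWinning κ θ Ordinal.omega0 := by
  intro hσ
  have hlegal := R.legal hκ hσ
  refine (hσ (ofNatSeq F)).2 (fun α hα => ?_) ?_
  · obtain ⟨n, rfl⟩ := Ordinal.lt_omega0.1 hα
    exact (hlegal n).2
  have hM : ∀ {x}, x ∈ unionBelow Ordinal.omega0 (σ.play (ofNatSeq F)) ↔
      ∃ n : ℕ, x ∈ σ.play (ofNatSeq F) n := by
    intro x
    rw [mem_unionBelow]
    constructor
    · rintro ⟨β, hβ, hx⟩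
      obtain ⟨n, rfl⟩ := Ordinal.lt_omega0.1 hβ
      exact ⟨n, hx⟩
    · rintro ⟨n, hx⟩
      exact ⟨n, Ordinal.natCast_lt_omega0 n, hx⟩
  have hF : ∀ {x}, x ∈ unionBelow Ordinal.omega0 (ofNatSeq F) ↔ ∃ n : ℕ, x ∈ F n := by
    intro x
    rw [mem_unionBelow]
    constructor
    · rintro ⟨β, hβ, hx⟩
      obtain ⟨n, rfl⟩ := Ordinal.lt_omega0.1 hβ
      exact ⟨n, by rwa [ofNatSeq_natCast] at hx⟩
    · rintro ⟨n, hx⟩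
      exact ⟨n, Ordinal.natCast_lt_omega0 n, by rwa [ofNatSeq_natCast]⟩
  have hFU : unionBelow Ordinal.omega0 (ofNatSeq F) ⊆ U := fun x hx => by
    obtain ⟨n, hn⟩ := hF.1 hx
    exact R.filter_sub n hn
  have hMZ : unionBelow Ordinal.omega0 (σ.play (ofNatSeq F)) ⊆ Z := fun x hx => by
    obtain ⟨n, hn⟩ := hM.1 hx
    refine R.sub n ?_
    rwa [response_eq (hlegal n).1.model]
  have hmeas : ∀ (n : ℕ), ∀ A ∈ σ.play (ofNatSeq F) n, A ⊆ asSet κ → A ∈ F n ∨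
      asSet κ \ A ∈ F n := fun n A hA hAκ => by
    have := (hlegal n).2.measures A hA hAκ
    rwa [ofNatSeq_natCast] at this
  refine ⟨⟨R.base.isFilter hκ hFU, fun A hA hAκ => ?_, fun X hX hXF => ?_⟩,
    R.wf.wellFoundedUltrapower R.base hZ hMZ hFU ?_⟩
  · obtain ⟨n, hn⟩ := hM.1 hA
    exact (hmeas n A hn hAκ).imp (fun h => hF.2 ⟨n, h⟩) fun h => hF.2 ⟨n, h⟩
  · obtain ⟨n, hn⟩ := hM.1 hX
    obtain ⟨D, hD, hDX⟩ := R.diag X (hMZ hX) (isFn_of_isFunc hXF) fun α hα A hA =>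
      hFU (isFunc_pair_mem hXF hA).2
    have hDd : D = diagInter κ X := by
      ext ξ
      unfold diagInter
      rw [ZFSet.mem_sep]
      exact ⟨fun h => ⟨hDX.1 h, (hDX.2 ξ (hDX.1 h)).1 h⟩, fun h => (hDX.2 ξ h.1).2 h.2⟩
    have hdM : diagInter κ X ∈ σ.play (ofNatSeq F) n :=
      (hlegal n).1.elem.sep_mem
        (P := fun _ v => ∀ α ∈ v 0, ∀ A, ZFSet.pair α A ∈ v 1 → v 0 ∈ A) (v := fun _ => X)
        (Dfn.ball (Dfn.allPair (Dfn.mem _ _))) (fun _ => hn) (mem_of_isModel (hlegal n).1.model)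
    -- The diagonal intersection is in `U` and in the model at stage `n`. It is thus measured by `F
    -- n`, and its complement cannot be chosen since elements of `U` meet.
    refine hF.2 ⟨n, (hmeas n _ hdM ZFSet.sep_subset).resolve_right fun hc => ?_⟩
    refine R.disjoint hκ hD (R.filter_sub n hc) fun ξ hξ hξ' => ?_
    rw [hDd] at hξ
    exact (ZFSet.mem_sdiff.1 hξ').2 hξ
  · rcases hmeas 0 _ (mem_of_isModel (hlegal 0).1.model) (fun _ h => h) with h | h
    exacts [⟨_, R.filter_sub 0 h⟩, ⟨_, R.filter_sub 0 h⟩]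

end GuidedRun

/-- The last clause carries the content: a walk through `R` by successive choices is a run in which
the judge answers inside `U`, and such a run defeats `σ`. -/
theorem isCode_code {κ θ θ' : Cardinal.{u}} (hκ : κ.IsRegular) (hκθ : κ < θ')
    {σ : ChallengerStrategy.{u}} (hσ : σ.IsWinning κ θ Ordinal.omega0)
    (hc : code σ κ ∈ H θ') : IsCode (H θ') (asSet κ) (code σ κ) := by
  have ht := transClass_H θ'
  have hθ := hκ.aleph0_le.trans hκθ.le
  have hnil : ZFSet.pair ∅ (response σ κ []) ∈ code σ κ :=
    pair_mem_code.2 ⟨[], by simp, rfl, rfl⟩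
  refine ⟨⟨∅, (ht.of_pair (ht _ hc _ hnil)).1, rfl, _, hnil, rfl⟩,
    fun p hp m hpm F hF hFκ => ?_, fun p hp m hpm => ?_, ?_⟩
  · obtain ⟨l, hl, rfl, rfl⟩ := pair_mem_code.1 hpm
    refine ⟨_, pair_mem_H hθ hp hF, rfl, _, pair_mem_code.2 ⟨F :: l, ?_, rfl, rfl⟩, rfl⟩
    intro G hG
    rcases List.mem_cons.1 hG with rfl | hG
    exacts [hFκ, hl G hG]
  · have hmH := (ht.of_pair (ht _ hc _ hpm)).2
    obtain ⟨l, -, -, rfl⟩ := pair_mem_code.1 hpm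
    exact exists_isFn_onto hκ.aleph0_le hκθ (card_response_le σ κ l) hmH
  · rintro ⟨U, -, R, hR, Z, hZ, hU, hd, hwf, ⟨p, hpR, rfl⟩, hrun⟩
    have hstep : ∀ l : {l : List ZFSet.{u} // position l ∈ R}, ∃ F, position (F :: l.1) ∈ R ∧
        response σ κ l.1 ⊆ Z ∧ F ⊆ U ∧ (∀ A ∈ response σ κ l.1, A ⊆ asSet κ →
          A ∈ F ∨ ∃ B ∈ U, IsComplIn (asSet κ) A B) ∧
        ∀ p' F', position l.1 = ZFSet.pair p' F' → F' ⊆ F := by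
      rintro ⟨l, hl⟩
      obtain ⟨m, hm, hmZ, F, hFR, hFU, hmF, hmono⟩ := hrun _ hl
      obtain rfl := pair_position_mem_code hm
      refine ⟨F, hFR, hmZ, hFU, hmF, fun p' F' h => ?_⟩
      have hH := ht.of_pair (x := p') (y := F') (h ▸ ht _ hR _ hl)
      exact hmono p' hH.1 F' hH.2 h
    choose next hnext using hstep
    -- The walk starts at the empty position and always extends by the chosen answer.
    let L : ℕ → {l : List ZFSet.{u} // position l ∈ R} := fun n =>
      Nat.rec ⟨[], hpR⟩ (fun _ l => ⟨next l :: l.1, (hnext l).1⟩) n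
    have hL : ∀ n, revTake (fun n => next (L n)) n = (L n).1 := by
      intro n
      induction n with
      | zero => rfl
      | succ n ih =>
        change next (L n) :: revTake (fun n => next (L n)) n = next (L n) :: (L n).1
        rw [ih]
    have hG : GuidedRun (H θ') κ U Z σ (fun n => next (L n)) :=
      { base := hU
        diag := hd
        wf := hwf
        sub := fun n => by rw [hL]; exact (hnext (L n)).2.1
        filter_sub := fun n => (hnext (L n)).2.2.1
        measures := fun n => by rw [hL]; exact (hnext (L n)).2.2.2.1
        mono := fun n => (hnext (L (n + 1))).2.2.2.2 (position (L n).1) (next (L n)) rfl }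
    exact hG.not_isWinning hκ hZ hσ

/-! ### Filter properties of Ramsey-like cardinals -/

theorem IsRamsey.exists_embeddingSetup {κ : Cardinal.{u}} (h : IsRamsey ℵ₀ κ)
    (μ : Cardinal.{u}) : ∃ θ, μ < θ ∧ ∃ (M N : ZFSet.{u}) (j : M ↪ₑ[setL] N),
      EmbeddingSetup κ θ M N j := by
  obtain ⟨-, hκ, -, h⟩ := h
  obtain ⟨θ, hμθ, hθ, h⟩ := h (Order.succ (max μ κ))
  have hlt : max μ κ < θ := (Order.lt_succ _).trans_le hμθ
  -- Any subset of `κ` would do, since only `κ` is needed as a parameter.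
  obtain ⟨M, -, hM, helem, -, N, hN, j, hj⟩ := h ∅ (ZFSet.empty_subset _)
  refine ⟨θ, (le_max_left _ _).trans_lt hlt, M, N, j, hκ, hθ.aleph0_le, hM.card_eq.le,
    (le_max_right _ _).trans_lt hlt, helem, hM.succ_subset ?_, fun x hx => hM.succ_subset ?_, hN,
    hj⟩
  · exact Ordinal.toZFSet_mem_toZFSet_iff.2 (lt_add_one _)
  · rw [Ordinal.toZFSet_add_one]
    exact ZFSet.mem_insert_of_mem _ hx

theorem IsRamsey.aleph0_lt {κ : Cardinal.{u}} (h : IsRamsey ℵ₀ κ) : ℵ₀ < κ := by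
  obtain ⟨_, -, M, N, j, S⟩ := h.exists_embeddingSetup 0
  exact S.aleph0_lt

theorem IsRamsey.powerlt_self {κ : Cardinal.{u}} (h : IsRamsey ℵ₀ κ) : κ ^< κ = κ := by
  obtain ⟨_, -, M, N, j, S⟩ := h.exists_embeddingSetup 0
  exact S.powerlt_self

theorem IsRamsey.hasWellFoundedFilterProperty {κ : Cardinal.{u}} (h : IsRamsey ℵ₀ κ) :
    HasWellFoundedFilterProperty κ Ordinal.omega0 := by
  rintro θ - - ⟨σ, hσ⟩
  obtain ⟨μ, hμ⟩ := exists_forall_mem_H (code σ κ)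
  obtain ⟨θ', hμθ, M, N, j, S⟩ := h.exists_embeddingSetup μ
  -- The code of `σ` need not be in `M`, but it shows that `H θ'` contains a code, and hence that
  -- `M` does.
  obtain ⟨s, hs, hcode⟩ := S.elem.exists_mem (transClass_H θ') (Dfn.isCode 1 0)
    (v := fun _ => asSet κ) (fun _ => S.mem)
    ⟨code σ κ, hμ θ' hμθ, isCode_code S.reg S.lt hσ (hμ θ' hμθ)⟩
  exact S.not_isCode hs hcode

end

end RamseyGames

theorem corollary5p8 (κ : Cardinal.{u}) :
    RamseyGames.IsRamsey Cardinal.aleph0 κ ↔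
      Cardinal.aleph0 < κ ∧ Cardinal.powerlt κ κ = κ ∧
        RamseyGames.HasWellFoundedFilterProperty κ Ordinal.omega0 :=
  ⟨fun h => ⟨h.aleph0_lt, h.powerlt_self, h.hasWellFoundedFilterProperty⟩,
    fun h => RamseyGames.isRamsey_of_filterProperty h.1 h.2.1 h.2.2⟩
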